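/- **Setting.** Let $\mathbf{Cat}\text{-}\mathbf{Gph}\text{-}\mathbf{Gph}$ be the 2-category of graphs enriched in $\mathbf{Cat}$-graphs: an object has 0-cells, 1-cells, and for each pair of parallel 1-cells a category of 2-cells and 3-cells; 2-cells of this 2-category are iconic (they exist only between morphisms that agree on 0-cells and 1-cells, and are then natural transformations on the hom-categories). Let $H$ be the 2-monad on it for strict horizontal composition (composition along 0-cells): $HA$ has (possibly empty) composable strings of 1-cells, of 2-cells and of 3-cells. Let $V$ be the 2-monad for weak vertical composition (composition along 1-cells), given by the free contractible operad on one binary and one nullary operation: $VA$ has the same 0-cells and 1-cells as $A$, its 2-cells are formal binary/nullary composites of 2-cells, and a 3-cell between two formal composites with the same boundary and the same number of leaves is a list of 3-cells, one for each leaf. Strict interchange gives a distributive law $VH \Rightarrow HV$, hence a composite 2-monad $HV$. A *doubly-degenerate $\mathbf{Bicat}_s$-category* is a strict $HV$-algebra with exactly one 0-cell and exactly one 1-cell. Its underlying data is a category $X$ with a weak (vertical) tensor product $\frac{a}{b}$, with associativity isomorphisms $\alpha$ and unit isomorphisms $\tau_a\colon \frac{1}{a}\to a$, $\beta_a\colon\frac{a}{1}\to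 a$, and a strict (horizontal) tensor product $a|b$ with the same unit object $1$, such that $\frac{a|b}{c|d}=\frac{a}{c}\big|\frac{b}{d}$ strictly. A *weak map* of doubly-degenerate $\mathbf{Bicat}_s$-categories $(X,x)\to(Y,y)$ is a weak map of $HV$-algebras: a 1-cell $f\colon X\to Y$ with an invertible 2-cell $\varphi\colon y\circ HVf \Rightarrow f\circ x$ satisfying the unit and multiplication axioms of the 2-monad. **Proposition.** Let $X$ and $Y$ be doubly-degenerate $\mathbf{Bicat}_s$-categories. A weak map $X\to Y$ is exactly a functor $F\colon X\to Y$ on the underlying categories equipped with isomorphisms $$v_{a,b}\colon \frac{Fa}{Fb}\xrightarrow{\ \sim\ }F\Big(\frac{a}{b}\Big),\qquad h_{a,b}\colon Fa|Fb\xrightarrow{\ \sim\ }F(a|b),\qquad \eta\colon 1\xrightarrow{\ \sim\ }F1,$$ with $v$ and $h$ natural in $a$ and $b$, such that the following axioms hold for all objects $a,b,c,d$ of $X$ (the canonical equalities of objects coming from the strict structure being left implicit). 1. $(F,v,\eta)$ is a monoidal functor for the vertical tensor products: $F(\alpha_{a,b,c})\circ v_{\frac{a}{b},c}\circ \frac{v_{a,b}}{1}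 = v_{a,\frac{b}{c}}\circ\frac{1}{v_{b,c}}\circ\alpha_{Fa,Fb,Fc}$, $\;F(\tau_a)\circ v_{1,a}\circ\frac{\eta}{1}=\tau_{Fa}$, $\;F(\beta_a)\circ v_{a,1}\circ\frac{1}{\eta}=\beta_{Fa}$. 2. $(F,h,\eta)$ is a monoidal functor for the strict horizontal tensor products: $h_{a|b,c}\circ(h_{a,b}|1)=h_{a,b|c}\circ(1|h_{b,c})$, $\;h_{1,a}\circ(\eta|1)=1_{Fa}$, $\;h_{a,1}\circ(1|\eta)=1_{Fa}$. 3. Interaction axiom: as maps $\frac{Fa|Fb}{Fc|Fd}\to F\Big(\frac{a|b}{c|d}\Big)$, $$v_{a|b,\,c|d}\circ\frac{h_{a,b}}{h_{c,d}} = h_{\frac{a}{c},\frac{b}{d}}\circ\big(v_{a,c}\,|\,v_{b,d}\big).$$ Precisely: for every weak map, its underlying functor together with its binary vertical, binary horizontal and nullary horizontal constraints (the components of $\varphi$ at the corresponding formal composites) satisfies 1–3, and its nullary vertical constraint coincides with its nullary horizontal constraint $\eta$; conversely, for every $(F,v,h,\eta)$ satisfying 1–3 there is exactly one weak map with these constraints.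 -/

import Mathlib

open CategoryTheory Bicategory

universe v u w

noncomputable section

namespace BicatS

/-! ### Lists of morphisms -/

/-- Morphisms between two lists of objects: the lists have the same length and there is a
morphism in each position. -/
def LHom {C : Type u} [Category.{v} C] : List C → List C → Type v
  | [], [] => PUnit
  | a :: l, b :: m => (a ⟶ b) × LHom l m
  | [], _ :: _ => PEmpty
  | _ :: _, [] => PEmpty

namespace LHom

variable {C : Type u} [Category.{v} C] {D : Type u} [Category.{v} D]

def nil : LHom ([] : List C) [] := PUnit.unit

def cons {a b : C} {l m : List C} (f : a ⟶ b) (g : LHom l m) : LHom (a :: l) (b :: m) := (f, g)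

def id : (l : List C) → LHom l l
  | [] => nil
  | a :: l => cons (𝟙 a) (id l)

def comp : {l m n : List C} → LHom l m → LHom m n → LHom l n
  | [], [], [], _, _ => nil
  | _ :: _, _ :: _, _ :: _, f, g => cons (f.1 ≫ g.1) (comp f.2 g.2)
  | [], _ :: _, _, f, _ => nomatch f
  | _ :: _, [], _, f, _ => nomatch f
  | [], [], _ :: _, _, g => nomatch g
  | _ :: _, _ :: _, [], _, g => nomatch g

def append : {l m l' m' : List C} → LHom l m → LHom l' m' → LHom (l ++ l') (m ++ m')
  | [], [], _, _, _, g => g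
  | _ :: _, _ :: _, _, _, f, g => cons f.1 (append f.2 g)
  | [], _ :: _, _, _, f, _ => nomatch f
  | _ :: _, [], _, _, f, _ => nomatch f

def map (F : C ⥤ D) : {l m : List C} → LHom l m → LHom (l.map F.obj) (m.map F.obj)
  | [], [], _ => nil
  | _ :: _, _ :: _, f => cons (F.map f.1) (map F f.2)
  | [], _ :: _, f => nomatch f
  | _ :: _, [], f => nomatch f

def flatMap (g : C → List D) (G : ∀ {x y : C}, (x ⟶ y) → LHom (g x) (g y)) :
    {l m : List C} → LHom l m → LHom (l.flatMap g) (m.flatMap g)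
  | [], [], _ => nil
  | _ :: _, _ :: _, f => append (G f.1) (flatMap g G f.2)
  | [], _ :: _, f => nomatch f
  | _ :: _, [], f => nomatch f

/-- A family of morphisms evaluated along a list of indices. -/
def fam {ι : Type w} {f g : ι → C} (α : ∀ i, f i ⟶ g i) : (l : List ι) → LHom (l.map f) (l.map g)
  | [] => nil
  | i :: l => cons (α i) (fam α l)

/-- The morphism in position `i`, if there is one. -/
def get : {l m : List C} → LHom l m → (i : ℕ) → LHom l[i]?.toList m[i]?.toList
  | [], [], _, _ => nil
  | _ :: _, _ :: _, f, 0 => cons f.1 nil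
  | _ :: _, _ :: _, f, i + 1 => get f.2 i
  | [], _ :: _, f, _ => nomatch f
  | _ :: _, [], f, _ => nomatch f

def cast {l l' m m' : List C} (h : l = l') (h' : m = m') (f : LHom l m) : LHom l' m' :=
  h ▸ h' ▸ f

/-- The list of the components. -/
def arrows : {l m : List C} → LHom l m → List (Arrow C)
  | [], [], _ => []
  | _ :: _, _ :: _, f => Arrow.mk f.1 :: arrows f.2
  | [], _ :: _, f => nomatch f
  | _ :: _, [], f => nomatch f

/-- Case analysis. -/
theorem ind {motive : ∀ l m : List C, LHom l m → Prop} (nil : motive [] [] nil)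
    (cons : ∀ {a b : C} {l m : List C} (f : a ⟶ b) (g : LHom l m), motive l m g →
      motive (a :: l) (b :: m) (.cons f g)) : ∀ {l m : List C} (f : LHom l m), motive l m f
  | [], [], _ => nil
  | _ :: _, _ :: _, f => cons f.1 f.2 (ind nil cons f.2)
  | [], _ :: _, f => nomatch f
  | _ :: _, [], f => nomatch f

section
variable {a b c : C} {l m n : List C}
@[simp] theorem arrows_nil : (nil : LHom ([] : List C) []).arrows = [] := rfl
@[simp] theorem arrows_cons (f : a ⟶ b) (g : LHom l m) :
    (cons f g).arrows = Arrow.mk f :: g.arrows := rfl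
@[simp] theorem nil_comp (f : LHom [] l) : comp nil f = f := by
  cases l with
  | nil => rfl
  | cons => exact nomatch f
@[simp] theorem cons_comp (f : a ⟶ b) (g : LHom l m) (f' : b ⟶ c) (g' : LHom m n) :
    comp (cons f g) (cons f' g') = cons (f ≫ f') (comp g g') := rfl
@[simp] theorem map_nil (F : C ⥤ D) : map F nil = nil := rfl
@[simp] theorem map_cons (F : C ⥤ D) (f : a ⟶ b) (g : LHom l m) :
    map F (cons f g) = cons (F.map f) (map F g) := rfl
@[simp] theorem append_nil_left (g : LHom l m) : append nil g = g := rfl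
@[simp] theorem append_cons (f : a ⟶ b) (g : LHom l m) {l' m' : List C} (g' : LHom l' m') :
    append (cons f g) g' = cons f (append g g') := rfl
@[simp] theorem flatMap_nil (g : C → List D) (G : ∀ {x y : C}, (x ⟶ y) → LHom (g x) (g y)) :
    flatMap g G nil = nil := rfl
@[simp] theorem flatMap_cons (g : C → List D) (G : ∀ {x y : C}, (x ⟶ y) → LHom (g x) (g y))
    (f : a ⟶ b) (f' : LHom l m) :
    flatMap g G (cons f f') = append (G f) (flatMap g G f') := rfl
@[simp] theorem fam_nil {ι : Type w} {f g : ι → C} (α : ∀ i, f i ⟶ g i) : fam α [] = nil := rfl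
@[simp] theorem fam_cons {ι : Type w} {f g : ι → C} (α : ∀ i, f i ⟶ g i) (i : ι) (l : List ι) :
    fam α (i :: l) = cons (α i) (fam α l) := rfl
@[simp] theorem id_nil : id ([] : List C) = nil := rfl
@[simp] theorem id_cons : id (a :: l) = cons (𝟙 a) (id l) := rfl
end

theorem ext_arrows : ∀ {l m : List C} {f g : LHom l m}, f.arrows = g.arrows → f = g
  | [], [], _, _, _ => rfl
  | _ :: _, _ :: _, f, g, h => by
    obtain ⟨f1, f2⟩ := f
    obtain ⟨g1, g2⟩ := g
    simp only [arrows, List.cons.injEq] at h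
    have h1 : f1 = g1 := Arrow.mk_injective _ _ h.1
    rw [h1, ext_arrows h.2]
  | [], _ :: _, f, _, _ => nomatch f
  | _ :: _, [], f, _, _ => nomatch f

@[simp] theorem arrows_cast {l l' m m' : List C} (h : l = l') (h' : m = m') (f : LHom l m) :
    (cast h h' f).arrows = f.arrows := by subst h h'; rfl

@[simp] theorem arrows_append {l m l' m' : List C} (f : LHom l m) (g : LHom l' m') :
    (append f g).arrows = f.arrows ++ g.arrows := by
  induction f using ind with
  | nil => rfl
  | cons f g ih => simp [ih]

@[simp] theorem arrows_map (F : C ⥤ D) {l m : List C} (f : LHom l m) :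
    (map F f).arrows = f.arrows.map (fun a => Arrow.mk (F.map a.hom)) := by
  induction f using ind with
  | nil => rfl
  | cons f g ih => simp only [map_cons, arrows_cons, ih, List.map_cons]; rfl

@[simp] theorem arrows_flatMap (g : C → List D) (G : ∀ {x y : C}, (x ⟶ y) → LHom (g x) (g y))
    {l m : List C} (f : LHom l m) :
    (flatMap g G f).arrows = f.arrows.flatMap (fun a => (G a.hom).arrows) := by
  induction f using ind with
  | nil => rfl
  | cons f g ih => simp only [flatMap_cons, arrows_cons, ih, arrows_append, List.flatMap_cons]; rfl

@[simp] theorem arrows_fam {ι : Type w} {f g : ι → C} (α : ∀ i, f i ⟶ g i) (l : List ι) :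
    (fam α l).arrows = l.map (fun i => Arrow.mk (α i)) := by
  induction l with
  | nil => rfl
  | cons i l ih => exact congrArg (Arrow.mk (α i) :: ·) ih

@[simp] theorem arrows_get {l m : List C} (f : LHom l m) (i : ℕ) :
    (get f i).arrows = f.arrows[i]?.toList := by
  induction f using ind generalizing i with
  | nil => rfl
  | cons f g ih => cases i with
    | zero => rfl
    | succ i => exact ih i

@[simp] theorem arrows_id (l : List C) : (id l).arrows = l.map (fun a => Arrow.mk (𝟙 a)) := by
  induction l with
  | nil => rfl
  | cons i l ih => exact congrArg (Arrow.mk (𝟙 i) :: ·) ih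

theorem arrows_left {l m : List C} (f : LHom l m) : f.arrows.map (fun a => a.left) = l := by
  induction f using ind with
  | nil => rfl
  | cons f g ih => exact congrArg (_ :: ·) ih

theorem arrows_right {l m : List C} (f : LHom l m) : f.arrows.map (fun a => a.right) = m := by
  induction f using ind with
  | nil => rfl
  | cons f g ih => exact congrArg (_ :: ·) ih

theorem map_eq {ι : Type w} {g : C → ι} (hg : ∀ {x y : C}, (x ⟶ y) → g x = g y) {l m : List C}
    (f : LHom l m) : l.map g = m.map g := by
  induction f using ind with
  | nil => rfl
  | cons f _ ih => exact congrArg₂ List.cons (hg f) ih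

@[simp] theorem id_comp {l m : List C} (f : LHom l m) : comp (id l) f = f := by
  induction f using ind with
  | nil => rfl
  | cons f g ih => simp [ih]

@[simp] theorem comp_id {l m : List C} (f : LHom l m) : comp f (id m) = f := by
  induction f using ind with
  | nil => rfl
  | cons f g ih => simp [ih]

/-- Case analysis for composable pairs. -/
theorem ind₂ {motive : ∀ l m n : List C, LHom l m → LHom m n → Prop}
    (nil : motive [] [] [] nil nil)
    (cons : ∀ {a b c : C} {l m n : List C} (f : a ⟶ b) (g : LHom l m) (f' : b ⟶ c)
      (g' : LHom m n), motive l m n g g' →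
      motive (a :: l) (b :: m) (c :: n) (.cons f g) (.cons f' g')) :
    ∀ {l m n : List C} (f : LHom l m) (g : LHom m n), motive l m n f g
  | [], [], [], _, _ => nil
  | _ :: _, _ :: _, _ :: _, f, g => cons f.1 f.2 g.1 g.2 (ind₂ nil cons f.2 g.2)
  | [], _ :: _, _, f, _ => nomatch f
  | _ :: _, [], _, f, _ => nomatch f
  | [], [], _ :: _, _, g => nomatch g
  | _ :: _, _ :: _, [], _, g => nomatch g

theorem assoc {l m n k : List C} (f : LHom l m) (g : LHom m n) (h : LHom n k) :
    comp (comp f g) h = comp f (comp g h) := by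
  induction f, g using ind₂ generalizing k with
  | nil => simp
  | cons f g f' g' ih => cases k with
    | nil => exact nomatch h
    | cons c k =>
      change cons ((f ≫ f') ≫ h.1) (comp (comp g g') h.2) =
        cons (f ≫ f' ≫ h.1) (comp g (comp g' h.2))
      rw [Category.assoc, ih]

theorem append_comp {l m n l' m' n' : List C} (f : LHom l m) (g : LHom m n) (f' : LHom l' m')
    (g' : LHom m' n') : append (comp f g) (comp f' g') = comp (append f f') (append g g') := by
  induction f, g using ind₂ with
  | nil => rfl
  | cons f g f' g' ih => exact congrArg (cons _) ih

theorem map_comp (F : C ⥤ D) {l m n : List C} (f : LHom l m) (g : LHom m n) :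
    map F (comp f g) = comp (map F f) (map F g) := by
  induction f, g using ind₂ with
  | nil => rfl
  | cons f g f' g' ih => simp only [cons_comp, map_cons, F.map_comp, ih]

theorem flatMap_comp (g : C → List D) (G : ∀ {x y : C}, (x ⟶ y) → LHom (g x) (g y))
    (hG : ∀ {x y z : C} (a : x ⟶ y) (b : y ⟶ z), G (a ≫ b) = comp (G a) (G b))
    {l m n : List C} (a : LHom l m) (b : LHom m n) :
    flatMap g G (comp a b) = comp (flatMap g G a) (flatMap g G b) := by
  induction a, b using ind₂ with
  | nil => rfl
  | cons f g f' g' ih => rw [cons_comp, flatMap_cons, hG, ih, append_comp]; rfl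

theorem get_comp {l m n : List C} (f : LHom l m) (g : LHom m n) (i : ℕ) :
    get (comp f g) i = comp (get f i) (get g i) := by
  induction f, g using ind₂ generalizing i with
  | nil => rfl
  | cons f g f' g' ih => cases i with
    | zero => rfl
    | succ i => exact ih i

theorem fam_comp {ι : Type w} {f g h : ι → C} (α : ∀ i, f i ⟶ g i) (β : ∀ i, g i ⟶ h i)
    (l : List ι) : comp (fam α l) (fam β l) = fam (fun i => α i ≫ β i) l := by
  induction l with
  | nil => rfl
  | cons i l ih => exact congrArg (cons _) ih

theorem cast_comp {l l' m m' n n' : List C} (h : l = l') (h' : m = m') (h'' : n = n')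
    (f : LHom l m) (g : LHom m n) :
    cast h h'' (comp f g) = comp (cast h h' f) (cast h' h'' g) := by subst h h' h''; rfl

theorem fam_naturality {F G : C ⥤ D} (α : F ⟶ G) {l m : List C} (f : LHom l m) :
    comp (map F f) (fam α.app m) = comp (fam α.app l) (map G f) := by
  induction f using ind with
  | nil => rfl
  | cons f g ih =>
    exact congrArg₂ cons (α.naturality f) ih

theorem flatMap_id (g : C → List D) (G : ∀ {x y : C}, (x ⟶ y) → LHom (g x) (g y))
    (hG : ∀ x : C, G (𝟙 x) = id (g x)) (l : List C) : flatMap g G (id l) = id (l.flatMap g) := by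
  apply ext_arrows
  rw [arrows_flatMap, arrows_id, arrows_id, List.flatMap_map, List.map_flatMap]
  congr 1
  funext x
  exact (congrArg arrows (hG x)).trans (arrows_id _)

theorem get_id (l : List C) (i : ℕ) : get (id l) i = id l[i]?.toList := by
  apply ext_arrows
  rw [arrows_get, arrows_id, arrows_id, List.getElem?_map]
  cases l[i]? <;> rfl

theorem map_id (F : C ⥤ D) (l : List C) : map F (id l) = id (l.map F.obj) := by
  apply ext_arrows
  simp [Function.comp_def]

theorem fam_id {ι : Type w} (f : ι → C) (l : List ι) : fam (fun i => 𝟙 (f i)) l = id (l.map f) := by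
  apply ext_arrows
  simp [Function.comp_def]

theorem cast_id {l l' : List C} (h : l = l') : cast h h (id l) = id l' := by
  subst h; rfl

end LHom

theorem arrow_mk_congr {C : Type u} [Category.{v} C] {a b a' b' : C} {f : a ⟶ b} {g : a' ⟶ b'}
    (ha : a = a') (hb : b = b') (h : HEq f g) : Arrow.mk f = Arrow.mk g := by
  subst ha hb; cases h; rfl

theorem heq_of_arrow {C : Type u} [Category.{v} C] {a b a' b' : C} {f : a ⟶ b} {g : a' ⟶ b'}
    (h : Arrow.mk f = Arrow.mk g) : HEq f g := by
  have ha : a = a' := congrArg (fun x : Arrow C => x.left) h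
  have hb : b = b' := congrArg (fun x : Arrow C => x.right) h
  subst ha hb
  exact heq_of_eq (Arrow.mk_injective _ _ h)

theorem functor_ext {C D : Type u} [Category.{v} C] [Category.{v} D] {F G : C ⥤ D}
    (h : ∀ {x y : C} (f : x ⟶ y), Arrow.mk (F.map f) = Arrow.mk (G.map f)) : F = G :=
  CategoryTheory.Functor.hext (fun x => congrArg (fun a : Arrow D => a.left) (h (𝟙 x)))
    (fun _ _ f => heq_of_arrow (h f))

/-! ### The 2-category of graphs enriched in graphs enriched in categories -/

/-- A graph enriched in `Cat`-graphs, i.e. a `Cat`-enriched 2-graph: sets of 0-cells and 1-cells,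
and for all parallel 1-cells `f g` a category of 2-cells (objects) and 3-cells (morphisms).
The family of these hom-categories is given by its total category `C2` (their coproduct) with the
boundary 1-cells `src`, `tgt`, which are constant along 3-cells. -/
structure Cat2Gph : Type (max (u + 1) (v + 1)) where
  C0 : Type u
  C1 : Type u
  C2 : Type u
  [cat : Category.{v} C2]
  s : C1 → C0
  t : C1 → C0
  src : C2 → C1
  tgt : C2 → C1
  s_eq : ∀ x, s (src x) = s (tgt x)
  t_eq : ∀ x, t (src x) = t (tgt x)
  src_eq : ∀ {x y : C2}, (x ⟶ y) → src x = src y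
  tgt_eq : ∀ {x y : C2}, (x ⟶ y) → tgt x = tgt y

attribute [instance] Cat2Gph.cat

namespace Cat2Gph

/-- Morphisms: functions on 0-cells and 1-cells and functors on hom-categories, compatible with
the boundaries. -/
@[ext] structure Hom (X Y : Cat2Gph.{v, u}) where
  f0 : X.C0 → Y.C0
  f1 : X.C1 → Y.C1
  f2 : X.C2 ⥤ Y.C2
  s_f1 : ∀ f, Y.s (f1 f) = f0 (X.s f)
  t_f1 : ∀ f, Y.t (f1 f) = f0 (X.t f)
  src_f2 : ∀ x, Y.src (f2.obj x) = f1 (X.src x)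
  tgt_f2 : ∀ x, Y.tgt (f2.obj x) = f1 (X.tgt x)

/-- Iconic 2-cells: they exist only between morphisms which agree on 0-cells and 1-cells, and are
then given by natural transformations on hom-categories. -/
@[ext] structure Hom₂ {X Y : Cat2Gph.{v, u}} (F G : Hom X Y) where
  e0 : F.f0 = G.f0
  e1 : F.f1 = G.f1
  nat : F.f2 ⟶ G.f2

variable {X Y Z W : Cat2Gph.{v, u}}

@[simps] def Hom.id (X : Cat2Gph.{v, u}) : Hom X X :=
  ⟨fun a => a, fun a => a, 𝟭 _, fun _ => rfl, fun _ => rfl, fun _ => rfl, fun _ => rfl⟩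

@[simps] def Hom.comp (F : Hom X Y) (G : Hom Y Z) : Hom X Z where
  f0 := fun a => G.f0 (F.f0 a)
  f1 := fun a => G.f1 (F.f1 a)
  f2 := F.f2 ⋙ G.f2
  s_f1 f := (G.s_f1 _).trans (congrArg G.f0 (F.s_f1 f))
  t_f1 f := (G.t_f1 _).trans (congrArg G.f0 (F.t_f1 f))
  src_f2 f := (G.src_f2 _).trans (congrArg G.f1 (F.src_f2 f))
  tgt_f2 f := (G.tgt_f2 _).trans (congrArg G.f1 (F.tgt_f2 f))

instance : CategoryStruct Cat2Gph.{v, u} where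
  Hom := Hom
  id := Hom.id
  comp := Hom.comp

instance homCat (X Y : Cat2Gph.{v, u}) : Category (X ⟶ Y) where
  Hom F G := Hom₂ (X := X) (Y := Y) F G
  id _ := ⟨rfl, rfl, 𝟙 _⟩
  comp α β := ⟨α.e0.trans β.e0, α.e1.trans β.e1, α.nat ≫ β.nat⟩
  id_comp _ := Hom₂.ext (Category.id_comp _)
  comp_id _ := Hom₂.ext (Category.comp_id _)
  assoc _ _ _ := Hom₂.ext (Category.assoc _ _ _)

section
variable (F : X ⟶ Y) (G : Y ⟶ Z) (a : X.C0) (f : X.C1) {x y : X.C2} (m : x ⟶ y)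
@[simp] theorem id_f0 : (𝟙 X : X ⟶ X).f0 a = a := rfl
@[simp] theorem id_f1 : (𝟙 X : X ⟶ X).f1 f = f := rfl
@[simp] theorem id_obj : (𝟙 X : X ⟶ X).f2.obj x = x := rfl
@[simp] theorem id_map : (𝟙 X : X ⟶ X).f2.map m = m := rfl
@[simp] theorem comp_f0 : (F ≫ G).f0 a = G.f0 (F.f0 a) := rfl
@[simp] theorem comp_f1 : (F ≫ G).f1 f = G.f1 (F.f1 f) := rfl
@[simp] theorem comp_obj : (F ≫ G).f2.obj x = G.f2.obj (F.f2.obj x) := rfl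
@[simp] theorem comp_map : (F ≫ G).f2.map m = G.f2.map (F.f2.map m) := rfl
end

theorem hom₂_ext {F G : X ⟶ Y} {α β : F ⟶ G} (h : ∀ x, α.nat.app x = β.nat.app x) : α = β :=
  Hom₂.ext (NatTrans.ext (funext h))

theorem hom_ext {F G : X ⟶ Y} (h0 : ∀ a, F.f0 a = G.f0 a) (h1 : ∀ a, F.f1 a = G.f1 a)
    (h2 : ∀ {x y : X.C2} (f : x ⟶ y), Arrow.mk (F.f2.map f) = Arrow.mk (G.f2.map f)) : F = G :=
  Hom.ext (funext h0) (funext h1) (functor_ext h2)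

theorem hom₂_heq {F G F' G' : X ⟶ Y} {α : F ⟶ G} {β : F' ⟶ G'} (hF : F = F') (hG : G = G')
    (h : ∀ x, Arrow.mk (α.nat.app x) = Arrow.mk (β.nat.app x)) : HEq α β := by
  subst hF hG
  exact heq_of_eq (hom₂_ext fun x => Arrow.mk_injective _ _ (h x))

instance : Bicategory Cat2Gph.{v, u} where
  homCategory := homCat
  whiskerLeft F _ _ α := ⟨congrArg (fun h a => h (F.f0 a)) α.e0,
    congrArg (fun h a => h (F.f1 a)) α.e1, Functor.whiskerLeft F.f2 α.nat⟩
  whiskerRight α G := ⟨congrArg (fun h a => G.f0 (h a)) α.e0,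
    congrArg (fun h a => G.f1 (h a)) α.e1, Functor.whiskerRight α.nat G.f2⟩
  associator F G H := Iso.refl (F ≫ G ≫ H)
  leftUnitor F := Iso.refl F
  rightUnitor F := Iso.refl F
  whiskerLeft_id _ _ := hom₂_ext fun _ => rfl
  whiskerLeft_comp _ _ _ _ _ _ := hom₂_ext fun _ => rfl
  id_whiskerLeft α := hom₂_ext fun x => by
    exact ((Category.id_comp _).trans (Category.comp_id _)).symm
  comp_whiskerLeft _ _ _ _ α := hom₂_ext fun x => by
    exact ((Category.id_comp _).trans (Category.comp_id _)).symm
  id_whiskerRight _ G := hom₂_ext fun _ => G.f2.map_id _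
  comp_whiskerRight _ _ G := hom₂_ext fun _ => G.f2.map_comp _ _
  whiskerRight_id α := hom₂_ext fun x => by
    exact ((Category.id_comp _).trans (Category.comp_id _)).symm
  whiskerRight_comp α _ _ := hom₂_ext fun x => by
    exact ((Category.id_comp _).trans (Category.comp_id _)).symm
  whisker_assoc _ _ _ _ _ := hom₂_ext fun x => by
    exact ((Category.id_comp _).trans (Category.comp_id _)).symm
  whisker_exchange α β := hom₂_ext fun x => (β.nat.naturality _).symm
  pentagon F G H K := hom₂_ext fun x => by
    change K.f2.map (𝟙 _) ≫ 𝟙 _ ≫ 𝟙 _ = 𝟙 _ ≫ 𝟙 _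
    simp
  triangle F G := hom₂_ext fun x => by
    change 𝟙 _ ≫ 𝟙 _ = G.f2.map (𝟙 _)
    simp

instance : Bicategory.Strict Cat2Gph.{v, u} where
  id_comp _ := rfl
  comp_id _ := rfl
  assoc _ _ _ := rfl
  leftUnitor_eqToIso _ := rfl
  rightUnitor_eqToIso _ := rfl
  associator_eqToIso _ _ _ := rfl

end Cat2Gph

/-! ### 2-monads, distributive laws and weak maps of algebras -/

section TwoMonads

variable {K : Type u} [Bicategory.{w, v} K] [Bicategory.Strict K]

variable (K) in
/-- A (strict) 2-monad on a strict 2-category: a monad on the underlying category, whose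
endofunctor acts 2-functorially on 2-cells and whose unit and multiplication are 2-natural. -/
structure TwoMonad extends Monad K where
  map₂ {A B : K} {f g : A ⟶ B} (θ : f ⟶ g) : toFunctor.map f ⟶ toFunctor.map g
  map₂_id {A B : K} (f : A ⟶ B) : map₂ (𝟙 f) = 𝟙 (toFunctor.map f)
  map₂_comp {A B : K} {f g h : A ⟶ B} (θ : f ⟶ g) (κ : g ⟶ h) :
    map₂ (θ ≫ κ) = map₂ θ ≫ map₂ κ
  map₂_whiskerLeft {A B D : K} (f : A ⟶ B) {g h : B ⟶ D} (θ : g ⟶ h) :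
    map₂ (f ◁ θ) = eqToHom (toFunctor.map_comp f g) ≫ toFunctor.map f ◁ map₂ θ ≫
      eqToHom (toFunctor.map_comp f h).symm
  map₂_whiskerRight {A B D : K} {f g : A ⟶ B} (θ : f ⟶ g) (h : B ⟶ D) :
    map₂ (θ ▷ h) = eqToHom (toFunctor.map_comp f h) ≫ map₂ θ ▷ toFunctor.map h ≫
      eqToHom (toFunctor.map_comp g h).symm
  η_naturality₂ {A B : K} {f g : A ⟶ B} (θ : f ⟶ g) :
    θ ▷ η.app B = eqToHom (η.naturality f) ≫ η.app A ◁ map₂ θ ≫ eqToHom (η.naturality g).symm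
  μ_naturality₂ {A B : K} {f g : A ⟶ B} (θ : f ⟶ g) :
    map₂ (map₂ θ) ▷ μ.app B =
      eqToHom (μ.naturality f) ≫ μ.app A ◁ map₂ θ ≫ eqToHom (μ.naturality g).symm

/-- A (strict) 2-categorical distributive law `S T ⟹ T S` of `S` over `T`. -/
structure DistribLaw (S T : TwoMonad K) where
  law : T.toFunctor ⋙ S.toFunctor ⟶ S.toFunctor ⋙ T.toFunctor
  law_naturality₂ {A B : K} {f g : A ⟶ B} (θ : f ⟶ g) :
    S.map₂ (T.map₂ θ) ▷ law.app B =
      eqToHom (law.naturality f) ≫ law.app A ◁ T.map₂ (S.map₂ θ) ≫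
        eqToHom (law.naturality g).symm
  unit_left (A : K) : S.η.app (T.obj A) ≫ law.app A = T.map (S.η.app A)
  unit_right (A : K) : S.map (T.η.app A) ≫ law.app A = T.η.app (S.obj A)
  mul_left (A : K) : S.μ.app (T.obj A) ≫ law.app A =
    S.map (law.app A) ≫ law.app (S.obj A) ≫ T.map (S.μ.app A)
  mul_right (A : K) : S.map (T.μ.app A) ≫ law.app A =
    law.app (T.obj A) ≫ T.map (law.app A) ≫ T.μ.app (S.obj A)

theorem TwoMonad.map₂_eqToHom (T : TwoMonad K) {A B : K} {f g : A ⟶ B} (h : f = g) :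
    T.map₂ (eqToHom h) = eqToHom (congrArg T.map h) := by
  subst h; exact T.map₂_id f

theorem TwoMonad.map₂_heq (T : TwoMonad K) {A B : K} {f g f' g' : A ⟶ B} {θ : f ⟶ g}
    {θ' : f' ⟶ g'} (hf : f = f') (hg : g = g') (h : HEq θ θ') : HEq (T.map₂ θ) (T.map₂ θ') := by
  subst hf hg; cases h; rfl

theorem whiskerLeft_heq {A B D : K} (h : A ⟶ B) {f g f' g' : B ⟶ D} {θ : f ⟶ g}
    {θ' : f' ⟶ g'} (hf : f = f') (hg : g = g') (e : HEq θ θ') : HEq (h ◁ θ) (h ◁ θ') := by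
  subst hf hg; cases e; rfl

theorem whiskerRight_heq {A B D : K} (h : B ⟶ D) {f g f' g' : A ⟶ B} {θ : f ⟶ g}
    {θ' : f' ⟶ g'} (hf : f = f') (hg : g = g') (e : HEq θ θ') : HEq (θ ▷ h) (θ' ▷ h) := by
  subst hf hg; cases e; rfl

theorem heq_of_conj {A B : K} {f g f' g' : A ⟶ B} {θ : f ⟶ g} {θ' : f' ⟶ g'} {h : f = f'}
    {h' : g' = g} (e : θ = eqToHom h ≫ θ' ≫ eqToHom h') : HEq θ θ' :=
  (conj_eqToHom_iff_heq θ θ' h h'.symm).1 e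

theorem conj_of_heq {A B : K} {f g f' g' : A ⟶ B} {θ : f ⟶ g} {θ' : f' ⟶ g'} (h : f = f')
    (h' : g' = g) (e : HEq θ θ') : θ = eqToHom h ≫ θ' ≫ eqToHom h' :=
  (conj_eqToHom_iff_heq θ θ' h h'.symm).2 e

theorem comp_whiskerLeft_heq {A B D E : K} (h : A ⟶ B) (k : B ⟶ D) {f g : D ⟶ E} (θ : f ⟶ g) :
    HEq ((h ≫ k) ◁ θ) (h ◁ k ◁ θ) := by
  rw [comp_whiskerLeft]
  simp only [Strict.associator_eqToIso, eqToIso.hom, eqToIso.inv]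
  exact heq_of_conj rfl

theorem whiskerRight_comp_heq {A B D E : K} {f g : A ⟶ B} (θ : f ⟶ g) (h : B ⟶ D) (k : D ⟶ E) :
    HEq (θ ▷ (h ≫ k)) (θ ▷ h ▷ k) := by
  rw [whiskerRight_comp]
  simp only [Strict.associator_eqToIso, eqToIso.hom, eqToIso.inv]
  exact heq_of_conj rfl

theorem whisker_assoc_heq {A B D E : K} (h : A ⟶ B) {f g : B ⟶ D} (θ : f ⟶ g) (k : D ⟶ E) :
    HEq ((h ◁ θ) ▷ k) (h ◁ θ ▷ k) := by
  rw [whisker_assoc]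
  simp only [Strict.associator_eqToIso, eqToIso.hom, eqToIso.inv]
  exact heq_of_conj rfl

section
variable {K : Type u} [Category.{v} K] (S T : Monad K)
  (l : T.toFunctor ⋙ S.toFunctor ⟶ S.toFunctor ⋙ T.toFunctor)

theorem beck_left_unit (hl : ∀ A, S.η.app (T.obj A) ≫ l.app A = T.map (S.η.app A)) (A : K) :
    (S.η.app (T.obj (S.obj A)) ≫ T.η.app (S.obj (T.obj (S.obj A)))) ≫
      T.map (l.app (S.obj A)) ≫ T.map (T.map (S.μ.app A)) ≫ T.μ.app (S.obj A) = 𝟙 _ := by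
  have h1 := T.η.naturality (l.app (S.obj A))
  have h2 := T.η.naturality (T.map (S.μ.app A))
  dsimp at h1 h2
  rw [Category.assoc, ← reassoc_of% h1, ← reassoc_of% h2, T.left_unit]
  erw [Category.comp_id]
  rw [reassoc_of% (hl (S.obj A)), ← T.map_comp, S.left_unit]
  exact T.map_id _

theorem beck_right_unit (hr : ∀ A, S.map (T.η.app A) ≫ l.app A = T.η.app (S.obj A)) (A : K) :
    T.map (S.map (S.η.app A ≫ T.η.app (S.obj A))) ≫
      T.map (l.app (S.obj A)) ≫ T.map (T.map (S.μ.app A)) ≫ T.μ.app (S.obj A) = 𝟙 _ := by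
  have h : S.map (S.η.app A ≫ T.η.app (S.obj A)) ≫ l.app (S.obj A) ≫ T.map (S.μ.app A) =
      T.η.app (S.obj A) := by
    rw [S.map_comp, Category.assoc, reassoc_of% (hr (S.obj A)), ← T.unit_naturality,
      ← Category.assoc, S.right_unit, Category.id_comp]
  rw [← T.map_comp_assoc, ← T.map_comp_assoc, Category.assoc, h, T.right_unit]
  rfl

theorem beck_assoc (hl : ∀ A, S.μ.app (T.obj A) ≫ l.app A =
      S.map (l.app A) ≫ l.app (S.obj A) ≫ T.map (S.μ.app A))
    (hr : ∀ A, S.map (T.μ.app A) ≫ l.app A =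
      l.app (T.obj A) ≫ T.map (l.app A) ≫ T.μ.app (S.obj A)) (A : K) :
    T.map (S.map (T.map (l.app (S.obj A)) ≫ T.map (T.map (S.μ.app A)) ≫ T.μ.app (S.obj A))) ≫
      T.map (l.app (S.obj A)) ≫ T.map (T.map (S.μ.app A)) ≫ T.μ.app (S.obj A) =
    (T.map (l.app (S.obj (T.obj (S.obj A)))) ≫ T.map (T.map (S.μ.app (T.obj (S.obj A)))) ≫
      T.μ.app (S.obj (T.obj (S.obj A)))) ≫
      T.map (l.app (S.obj A)) ≫ T.map (T.map (S.μ.app A)) ≫ T.μ.app (S.obj A) := by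
  have n1 := l.naturality (T.map (S.μ.app A))
  have n2 := l.naturality (l.app (S.obj A))
  have n3 := l.naturality (S.μ.app A)
  dsimp at n1 n2 n3
  have inner : S.map (T.map (l.app (S.obj A)) ≫ T.map (T.map (S.μ.app A)) ≫ T.μ.app (S.obj A)) ≫
      l.app (S.obj A) ≫ T.map (S.μ.app A) =
      l.app (S.obj (T.obj (S.obj A))) ≫ T.map (S.map (l.app (S.obj A))) ≫
      T.map (l.app (S.obj (S.obj A))) ≫ T.map (T.map (S.μ.app (S.obj A))) ≫
      T.map (T.map (S.μ.app A)) ≫ T.μ.app (S.obj A) := by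
    have a1 : T.map (T.map (S.map (S.μ.app A))) ≫ T.map (T.map (S.μ.app A)) =
        T.map (T.map (S.μ.app (S.obj A))) ≫ T.map (T.map (S.μ.app A)) := by
      rw [← T.map_comp, ← T.map_comp, S.assoc, T.map_comp, T.map_comp]
    have a2 : T.map (S.map (T.map (S.μ.app A))) ≫ T.map (l.app (S.obj A)) =
        T.map (l.app (S.obj (S.obj A))) ≫ T.map (T.map (S.map (S.μ.app A))) := by
      rw [← T.map_comp, n3, T.map_comp]
    rw [S.map_comp, S.map_comp, Category.assoc, Category.assoc, reassoc_of% (hr (S.obj A)),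
      reassoc_of% n1, reassoc_of% n2, reassoc_of% a2, ← T.mu_naturality, reassoc_of% a1]
  have b1 : T.map (T.map (S.μ.app (T.obj (S.obj A)))) ≫ T.map (T.map (l.app (S.obj A))) =
      T.map (T.map (S.map (l.app (S.obj A)))) ≫ T.map (T.map (l.app (S.obj (S.obj A)))) ≫
      T.map (T.map (T.map (S.μ.app (S.obj A)))) := by
    rw [← T.map_comp, ← T.map_comp, hl]
    simp only [T.map_comp]
  rw [← T.map_comp_assoc, ← T.map_comp_assoc, Category.assoc, inner]
  simp only [T.map_comp, Category.assoc]
  have m5 := T.μ.naturality (T.map (S.μ.app A))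
  have m6 := T.μ.naturality (l.app (S.obj A))
  dsimp at m5 m6
  rw [T.assoc, T.mu_naturality_assoc, ← reassoc_of% m6, reassoc_of% b1, ← reassoc_of% m5]
end

/-- The composite 2-monad `T S` given by a distributive law of `S` over `T`. -/
def DistribLaw.composite {S T : TwoMonad K} (d : DistribLaw S T) : TwoMonad K where
  toFunctor := S.toFunctor ⋙ T.toFunctor
  η :=
    { app := fun A => S.η.app A ≫ T.η.app (S.obj A)
      naturality := fun A B f => by
        have h1 := S.η.naturality f
        have h2 := T.η.naturality (S.map f)
        dsimp at h1 h2 ⊢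
        rw [← Category.assoc, h1, Category.assoc, h2, Category.assoc] }
  μ :=
    { app := fun A => T.map (d.law.app (S.obj A)) ≫ T.map (T.map (S.μ.app A)) ≫ T.μ.app (S.obj A)
      naturality := fun A B f => by
        have h1 := d.law.naturality (S.map f)
        have h2 := S.μ.naturality f
        have h3 := T.μ.naturality (S.map f)
        dsimp at h1 h2 h3 ⊢
        rw [← Category.assoc, ← T.map_comp, h1, T.map_comp, Category.assoc, Category.assoc,
          Category.assoc, ← h3]
        rw [← Category.assoc (T.map (T.map (S.map (S.map f)))), ← T.map_comp, ← T.map_comp, h2,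
          T.map_comp, T.map_comp, Category.assoc] }
  assoc A := beck_assoc S.toMonad T.toMonad d.law d.mul_left d.mul_right A
  left_unit A := beck_left_unit S.toMonad T.toMonad d.law d.unit_left A
  right_unit A := beck_right_unit S.toMonad T.toMonad d.law d.unit_right A
  map₂ θ := T.map₂ (S.map₂ θ)
  map₂_id f := by rw [S.map₂_id, T.map₂_id]; rfl
  map₂_comp θ κ := by rw [S.map₂_comp, T.map₂_comp]
  map₂_whiskerLeft f _ _ θ := conj_of_heq _ _ <| by
    rw [S.map₂_whiskerLeft, T.map₂_comp, T.map₂_comp, T.map₂_eqToHom, T.map₂_eqToHom,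
      T.map₂_whiskerLeft]
    exact (heq_of_conj rfl).trans (heq_of_conj rfl)
  map₂_whiskerRight θ h := conj_of_heq _ _ <| by
    rw [S.map₂_whiskerRight, T.map₂_comp, T.map₂_comp, T.map₂_eqToHom, T.map₂_eqToHom,
      T.map₂_whiskerRight]
    exact (heq_of_conj rfl).trans (heq_of_conj rfl)
  η_naturality₂ {A B f g} θ := conj_of_heq _ _ <| by
    refine (whiskerRight_comp_heq _ _ _).trans ?_
    refine (whiskerRight_heq _ (S.η.naturality f) (S.η.naturality g)
      (heq_of_conj (S.η_naturality₂ θ))).trans ?_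
    refine (whisker_assoc_heq _ _ _).trans ?_
    refine (whiskerLeft_heq _ (T.η.naturality _) (T.η.naturality _)
      (heq_of_conj (T.η_naturality₂ (S.map₂ θ)))).trans ?_
    exact (comp_whiskerLeft_heq _ _ _).symm
  μ_naturality₂ {A B f g} θ := conj_of_heq _ _ <| by
    have m1 (k : A ⟶ B) : T.map (S.map (T.map (S.map k))) ≫ T.map (d.law.app (S.obj B)) =
        T.map (d.law.app (S.obj A)) ≫ T.map (T.map (S.map (S.map k))) := by
      rw [← T.map_comp, ← T.map_comp]
      exact congrArg T.map (d.law.naturality (S.map k))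
    have m2 (k : A ⟶ B) : T.map (S.map (S.map k)) ≫ T.map (S.μ.app B) =
        T.map (S.μ.app A) ≫ T.map (S.map k) := by
      rw [← T.map_comp, ← T.map_comp]
      exact congrArg T.map (S.μ.naturality k)
    have m3 (k : A ⟶ B) : T.map (T.map (S.map (S.map k))) ≫ T.map (T.map (S.μ.app B)) =
        T.map (T.map (S.μ.app A)) ≫ T.map (T.map (S.map k)) := by
      rw [← T.map_comp, m2, T.map_comp]
    have m4 (k : A ⟶ B) : T.map (T.map (S.map k)) ≫ T.μ.app (S.obj B) =
        T.μ.app (S.obj A) ≫ T.map (S.map k) := T.μ.naturality (S.map k)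
    have h1 : HEq (T.map₂ (S.map₂ (T.map₂ (S.map₂ θ))) ▷ T.map (d.law.app (S.obj B)))
        (T.map (d.law.app (S.obj A)) ◁ T.map₂ (T.map₂ (S.map₂ (S.map₂ θ)))) :=
      (heq_of_conj (T.map₂_whiskerRight _ _)).symm.trans <|
      (T.map₂_heq (d.law.naturality _) (d.law.naturality _)
        (heq_of_conj (d.law_naturality₂ (S.map₂ θ)))).trans (heq_of_conj (T.map₂_whiskerLeft _ _))
    have h2 : HEq (T.map₂ (T.map₂ (S.map₂ (S.map₂ θ))) ▷ T.map (T.map (S.μ.app B)))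
        (T.map (T.map (S.μ.app A)) ◁ T.map₂ (T.map₂ (S.map₂ θ))) :=
      (heq_of_conj (T.map₂_whiskerRight _ _)).symm.trans <|
      (T.map₂_heq (m2 f) (m2 g) <|
        (heq_of_conj (T.map₂_whiskerRight _ _)).symm.trans <|
        (T.map₂_heq (S.μ.naturality f) (S.μ.naturality g)
          (heq_of_conj (S.μ_naturality₂ θ))).trans
        (heq_of_conj (T.map₂_whiskerLeft _ _))).trans
      (heq_of_conj (T.map₂_whiskerLeft _ _))
    have h3 := heq_of_conj (T.μ_naturality₂ (S.map₂ θ))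
    refine (whiskerRight_comp_heq _ _ _).trans ?_
    refine (whiskerRight_heq _ (m1 f) (m1 g) h1).trans ?_
    refine (whisker_assoc_heq _ _ _).trans ?_
    refine (whiskerLeft_heq _ (by rw [← Category.assoc, m3, Category.assoc, m4])
      (by rw [← Category.assoc, m3, Category.assoc, m4]) ((whiskerRight_comp_heq _ _ _).trans
      ((whiskerRight_heq _ (m3 f) (m3 g) h2).trans ((whisker_assoc_heq _ _ _).trans
      (whiskerLeft_heq _ (m4 f) (m4 g) h3))))).trans ?_
    exact ((comp_whiskerLeft_heq _ _ _).trans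
      (whiskerLeft_heq _ (by rw [Category.assoc]) (by rw [Category.assoc]) (comp_whiskerLeft_heq _ _ _))).symm

/-- A weak map of strict algebras for a 2-monad `T`: a 1-cell `f` and an invertible 2-cell
`b ∘ T f ⟹ f ∘ a` satisfying the unit and multiplication axioms. -/
structure WeakMap (T : TwoMonad K) (A B : T.toMonad.Algebra) where
  f : A.A ⟶ B.A
  φ : T.map f ≫ B.a ≅ A.a ≫ f
  unit : T.η.app A.A ◁ φ.hom = eqToHom (by
    rw [← Category.assoc, ← T.unit_naturality, Category.assoc, B.unit, ← Category.assoc, A.unit]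
    exact (Category.comp_id f).trans (Category.id_comp f).symm)
  mul : T.μ.app A.A ◁ φ.hom =
    eqToHom (by
      rw [T.map_comp, Category.assoc, ← B.assoc, ← Category.assoc, ← Category.assoc,
        T.mu_naturality]) ≫
    T.map₂ φ.hom ▷ B.a ≫ eqToHom (by rw [T.map_comp, Category.assoc]) ≫
    T.map A.a ◁ φ.hom ≫ eqToHom (by rw [← Category.assoc, ← Category.assoc, A.assoc])

end TwoMonads

/-! ### Horizontal composition: strings of cells composable along 0-cells -/

/-- The list `l` is composable, starting at `a`. -/
def IsChain {O E : Type u} (s t : E → O) : O → List E → Prop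
  | _, [] => True
  | a, e :: l => s e = a ∧ IsChain s t (t e) l

/-- The end point of a composable list starting at `a`. -/
def chainEnd {O E : Type u} (t : E → O) : O → List E → O
  | a, [] => a
  | _, e :: l => chainEnd t (t e) l

section chains
variable {O E O' E' : Type u} {s t : E → O} {s' t' : E' → O'}

theorem chainEnd_map {f0 : O → O'} {f1 : E → E'} (ht : ∀ e, t' (f1 e) = f0 (t e)) (a : O)
    (l : List E) : chainEnd t' (f0 a) (l.map f1) = f0 (chainEnd t a l) := by
  induction l generalizing a with
  | nil => rfl
  | cons e l ih => simp only [List.map_cons, chainEnd, ht, ih]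

theorem IsChain.map {f0 : O → O'} {f1 : E → E'} (hs : ∀ e, s' (f1 e) = f0 (s e))
    (ht : ∀ e, t' (f1 e) = f0 (t e)) {a : O} {l : List E} (h : IsChain s t a l) :
    IsChain s' t' (f0 a) (l.map f1) := by
  induction l generalizing a with
  | nil => trivial
  | cons e l ih => exact ⟨(hs e).trans (congrArg f0 h.1), (ht e).symm ▸ ih h.2⟩

theorem chainEnd_append (a : O) (l m : List E) :
    chainEnd t a (l ++ m) = chainEnd t (chainEnd t a l) m := by
  induction l generalizing a with
  | nil => rfl
  | cons e l ih => exact ih _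

theorem IsChain.append {a : O} {l m : List E} (h : IsChain s t a l)
    (h' : IsChain s t (chainEnd t a l) m) : IsChain s t a (l ++ m) := by
  induction l generalizing a with
  | nil => exact h'
  | cons e l ih => exact ⟨h.1, ih h.2 h'⟩

variable (s t) in
/-- Composable strings, including an empty string at each `a : O`. -/
@[ext] structure Str where
  start : O
  list : List E
  ok : IsChain s t start list

def Str.map (f0 : O → O') (f1 : E → E') (hs : ∀ e, s' (f1 e) = f0 (s e))
    (ht : ∀ e, t' (f1 e) = f0 (t e)) (p : Str s t) : Str s' t' :=
  ⟨f0 p.start, p.list.map f1, p.ok.map hs ht⟩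

theorem flatMap_end {g : E' → Str s t} {S' T' : E' → O} (hs : ∀ e, S' e = (g e).start)
    (ht : ∀ e, T' e = chainEnd t (g e).start (g e).list) {a : O} {l : List E'}
    (h : IsChain S' T' a l) :
    chainEnd t a (l.flatMap fun e => (g e).list) = chainEnd T' a l := by
  induction l generalizing a with
  | nil => rfl
  | cons e l ih =>
    rw [List.flatMap_cons, chainEnd_append, ← h.1, hs, ← ht, ih h.2]
    rfl

theorem flatMap_ok {g : E' → Str s t} {S' T' : E' → O} (hs : ∀ e, S' e = (g e).start)
    (ht : ∀ e, T' e = chainEnd t (g e).start (g e).list) {a : O} {l : List E'}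
    (h : IsChain S' T' a l) : IsChain s t a (l.flatMap fun e => (g e).list) := by
  induction l generalizing a with
  | nil => trivial
  | cons e l ih =>
    refine IsChain.append ?_ ?_
    · rw [← h.1, hs]; exact (g e).ok
    · rw [← h.1, hs, ← ht]; exact ih h.2

/-- Concatenation of a string of strings. -/
def Str.join (g : E' → Str s t) {S' T' : E' → O} (hs : ∀ e, S' e = (g e).start)
    (ht : ∀ e, T' e = chainEnd t (g e).start (g e).list) (p : Str S' T') : Str s t :=
  ⟨p.start, p.list.flatMap fun e => (g e).list, flatMap_ok hs ht p.ok⟩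

end chains

section strCat
variable {O O' O'' : Type u} {C C' : Type u} [Category.{v} C] [Category.{v} C']
  {s t : C → O} {s' t' : C' → O'}

/-- Morphisms of strings of objects of a category: componentwise. -/
@[ext] structure Str.Hom (p q : Str s t) : Type v where
  start_eq : p.start = q.start
  hom : LHom p.list q.list

instance Str.category : Category.{v} (Str s t) where
  Hom := Str.Hom
  id _ := ⟨rfl, LHom.id _⟩
  comp f g := ⟨f.start_eq.trans g.start_eq, LHom.comp f.hom g.hom⟩
  id_comp _ := Str.Hom.ext (LHom.id_comp _)
  comp_id _ := Str.Hom.ext (LHom.comp_id _)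
  assoc _ _ _ := Str.Hom.ext (LHom.assoc _ _ _)

theorem Str.hom_ext {p q : Str s t} {f g : p ⟶ q} (h : f.hom = g.hom) : f = g := Str.Hom.ext h

theorem Str.arrow_ext {p q p' q' : Str s t} {f : p ⟶ q} {g : p' ⟶ q'} (hs : p.start = p'.start)
    (h : f.hom.arrows = g.hom.arrows) : Arrow.mk f = Arrow.mk g := by
  have hp : p = p' := Str.ext hs (by rw [← f.hom.arrows_left, h, g.hom.arrows_left])
  have hq : q = q' := Str.ext (by rw [← f.start_eq, ← g.start_eq, hs])
    (by rw [← f.hom.arrows_right, h, g.hom.arrows_right])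
  subst hp hq
  exact congrArg Arrow.mk (Str.hom_ext (LHom.ext_arrows h))

def Str.mapFunctor (f0 : O → O') (F : C ⥤ C') (hs : ∀ e, s' (F.obj e) = f0 (s e))
    (ht : ∀ e, t' (F.obj e) = f0 (t e)) : Str s t ⥤ Str s' t' where
  obj := Str.map f0 F.obj hs ht
  map f := ⟨congrArg f0 f.start_eq, LHom.map F f.hom⟩
  map_id p := Str.hom_ext (LHom.map_id F p.list)
  map_comp f g := Str.hom_ext (LHom.map_comp F f.hom g.hom)

def Str.joinFunctor (g : C' ⥤ Str s t) {S' T' : C' → O} (hs : ∀ e, S' e = (g.obj e).start)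
    (ht : ∀ e, T' e = chainEnd t (g.obj e).start (g.obj e).list) : Str S' T' ⥤ Str s t where
  obj := Str.join g.obj hs ht
  map f := ⟨f.start_eq, LHom.flatMap _ (fun a => (g.map a).hom) f.hom⟩
  map_id p := Str.hom_ext (LHom.flatMap_id _ _ (fun x => by rw [g.map_id]; rfl) p.list)
  map_comp a b := Str.hom_ext
    (LHom.flatMap_comp _ _ (fun a b => by rw [g.map_comp]; rfl) a.hom b.hom)

/-- Strings of length one. -/
def Str.singleFunctor (s t : C → O) (hs : ∀ {x y : C}, (x ⟶ y) → s x = s y) : C ⥤ Str s t where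
  obj x := ⟨s x, [x], rfl, trivial⟩
  map f := ⟨hs f, .cons f .nil⟩

end strCat

namespace Cat2Gph

/-- Free horizontal composites: 0-cells are unchanged, 1-cells are composable strings of 1-cells,
and 2-cells and 3-cells are composable strings of 2-cells and 3-cells. -/
abbrev hObj (X : Cat2Gph.{v, u}) : Cat2Gph.{v, u} where
  C0 := X.C0
  C1 := Str X.s X.t
  C2 := Str (fun x => X.s (X.src x)) (fun x => X.t (X.src x))
  cat := Str.category
  s p := p.start
  t p := chainEnd X.t p.start p.list
  src := Str.map (fun a => a) X.src (fun _ => rfl) (fun _ => rfl)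
  tgt := Str.map (fun a => a) X.tgt (fun x => (X.s_eq x).symm) (fun x => (X.t_eq x).symm)
  s_eq _ := rfl
  t_eq _ := (chainEnd_map (f0 := fun a => a) (t := fun x => X.t (X.src x)) (fun _ => rfl) _ _).trans
    (chainEnd_map (f0 := fun a => a) (fun x => (X.t_eq x).symm) _ _).symm
  src_eq {p q} (f : Str.Hom p q) := Str.ext f.start_eq (LHom.map_eq X.src_eq f.hom)
  tgt_eq {p q} (f : Str.Hom p q) := Str.ext f.start_eq (LHom.map_eq X.tgt_eq f.hom)

variable {X Y Z : Cat2Gph.{v, u}}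

def hMap (F : X ⟶ Y) : hObj X ⟶ hObj Y where
  f0 := F.f0
  f1 := Str.map F.f0 F.f1 F.s_f1 F.t_f1
  f2 := Str.mapFunctor F.f0 F.f2 (fun x => (congrArg Y.s (F.src_f2 x)).trans (F.s_f1 _))
    (fun x => (congrArg Y.t (F.src_f2 x)).trans (F.t_f1 _))
  s_f1 _ := rfl
  t_f1 p := chainEnd_map F.t_f1 _ _
  src_f2 p := Str.ext rfl (by simp [hObj, Str.mapFunctor, Str.map, F.src_f2])
  tgt_f2 p := Str.ext rfl (by simp [hObj, Str.mapFunctor, Str.map, F.tgt_f2])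

def hMap₂ {F G : X ⟶ Y} (α : F ⟶ G) : hMap F ⟶ hMap G where
  e0 := α.e0
  e1 := funext fun p => Str.ext (congrFun α.e0 _) (congrArg (fun f => p.list.map f) α.e1)
  nat :=
    { app := fun p => ⟨congrFun α.e0 _, LHom.fam α.nat.app p.list⟩
      naturality := fun _ _ f => Str.hom_ext (LHom.fam_naturality α.nat f.hom) }

def hUnit (X : Cat2Gph.{v, u}) : X ⟶ hObj X where
  f0 a := a
  f1 f := ⟨X.s f, [f], rfl, trivial⟩
  f2 := Str.singleFunctor _ _ (fun f => congrArg X.s (X.src_eq f))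
  s_f1 _ := rfl
  t_f1 _ := rfl
  src_f2 _ := rfl
  tgt_f2 x := Str.ext (X.s_eq x) rfl

def hMul (X : Cat2Gph.{v, u}) : hObj (hObj X) ⟶ hObj X where
  f0 a := a
  f1 := Str.join (fun p => p) (fun _ => rfl) (fun _ => rfl)
  f2 := Str.joinFunctor (C' := (hObj X).C2) (𝟭 (hObj X).C2) (fun _ => rfl)
    (fun p => chainEnd_map (f0 := fun a => a) (fun _ => rfl) p.start p.list)
  s_f1 _ := rfl
  t_f1 p := flatMap_end (g := fun p : (hObj X).C1 => p) (fun _ => rfl) (fun _ => rfl) p.ok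
  src_f2 p := Str.ext rfl (by
    change (p.list.flatMap fun q => q.list).map X.src =
      (p.list.map (hObj X).src).flatMap fun q => q.list
    rw [List.map_flatMap, List.flatMap_map]
    rfl)
  tgt_f2 p := Str.ext rfl (by
    change (p.list.flatMap fun q => q.list).map X.tgt =
      (p.list.map (hObj X).tgt).flatMap fun q => q.list
    rw [List.map_flatMap, List.flatMap_map]
    rfl)

/-- The list of components of a morphism of strings. -/
def hArr {p q : (hObj X).C2} (f : p ⟶ q) : List (Arrow X.C2) := LHom.arrows (Str.Hom.hom f)

theorem hArrow_ext {p q p' q' : (hObj X).C2} {f : p ⟶ q} {g : p' ⟶ q'}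
    (hs : p.start = p'.start) (h : hArr f = hArr g) : Arrow.mk f = Arrow.mk g :=
  Str.arrow_ext hs h

section
variable (F : X ⟶ Y) {p q : (hObj X).C2} (f : p ⟶ q) (r : (hObj X).C1)
@[simp] theorem hMap_arr :
    hArr ((hMap F).f2.map f) = (hArr f).map fun a => Arrow.mk (F.f2.map a.hom) :=
  LHom.arrows_map _ _
@[simp] theorem hMap_f0 (a : X.C0) : (hMap F).f0 a = F.f0 a := rfl
@[simp] theorem hMap_f1_start : ((hMap F).f1 r).start = F.f0 r.start := rfl
@[simp] theorem hMap_f1_list : ((hMap F).f1 r).list = r.list.map F.f1 := rfl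
@[simp] theorem hMap_obj_start : ((hMap F).f2.obj p).start = F.f0 p.start := rfl
@[simp] theorem hMap_obj_list : ((hMap F).f2.obj p).list = p.list.map F.f2.obj := rfl
@[simp] theorem hUnit_arr {x y : X.C2} (m : x ⟶ y) :
    hArr ((hUnit X).f2.map m) = [Arrow.mk m] := rfl
@[simp] theorem hUnit_f0 (a : X.C0) : (hUnit X).f0 a = a := rfl
@[simp] theorem hUnit_f1_start (r : X.C1) : ((hUnit X).f1 r).start = X.s r := rfl
@[simp] theorem hUnit_f1_list (r : X.C1) : ((hUnit X).f1 r).list = [r] := rfl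
@[simp] theorem hUnit_obj_start (x : X.C2) : ((hUnit X).f2.obj x).start = X.s (X.src x) := rfl
@[simp] theorem hUnit_obj_list (x : X.C2) : ((hUnit X).f2.obj x).list = [x] := rfl
end

section
variable {p q : (hObj (hObj X)).C2} (f : p ⟶ q) (r : (hObj (hObj X)).C1)
@[simp] theorem hMul_arr :
    hArr ((hMul X).f2.map f) = (hArr f).flatMap fun a => hArr a.hom :=
  LHom.arrows_flatMap _ _ _
@[simp] theorem hMul_f0 (a : X.C0) : (hMul X).f0 a = a := rfl
@[simp] theorem hMul_f1_start : ((hMul X).f1 r).start = r.start := rfl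
@[simp] theorem hMul_f1_list : ((hMul X).f1 r).list = r.list.flatMap fun t => t.list := rfl
@[simp] theorem hMul_obj_start : ((hMul X).f2.obj p).start = p.start := rfl
@[simp] theorem hMul_obj_list : ((hMul X).f2.obj p).list = p.list.flatMap fun t => t.list := rfl
end

theorem hMap_id (X : Cat2Gph.{v, u}) : hMap (𝟙 X) = 𝟙 (hObj X) :=
  hom_ext (fun _ => rfl) (fun _ => Str.ext rfl (List.map_id _))
    (fun _ => hArrow_ext rfl ((hMap_arr ..).trans (List.map_id _)))

theorem hMap_comp (F : X ⟶ Y) (G : Y ⟶ Z) : hMap (F ≫ G) = hMap F ≫ hMap G :=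
  hom_ext (fun _ => rfl) (fun _ => Str.ext rfl (by simp [Function.comp_def]))
    (fun _ => hArrow_ext rfl (by simp [Function.comp_def]))

theorem hUnit_naturality (F : X ⟶ Y) : F ≫ hUnit Y = hUnit X ≫ hMap F :=
  hom_ext (fun _ => rfl) (fun f => Str.ext (F.s_f1 f) rfl)
    (fun _ => hArrow_ext ((congrArg Y.s (F.src_f2 _)).trans (F.s_f1 _)) rfl)

theorem hMul_naturality (F : X ⟶ Y) : hMap (hMap F) ≫ hMul Y = hMul X ≫ hMap F :=
  hom_ext (fun _ => rfl)
    (fun _ => Str.ext rfl (by simp [List.flatMap_map, List.map_flatMap]))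
    (fun _ => hArrow_ext rfl (by simp [List.flatMap_map, List.map_flatMap]))

theorem hMul_assoc (X : Cat2Gph.{v, u}) : hMap (hMul X) ≫ hMul X = hMul (hObj X) ≫ hMul X :=
  hom_ext (fun _ => rfl)
    (fun _ => Str.ext rfl (by simp [List.flatMap_map, List.flatMap_assoc]))
    (fun _ => hArrow_ext rfl (by simp [List.flatMap_map, List.flatMap_assoc]))

theorem hMul_left_unit (X : Cat2Gph.{v, u}) : hUnit (hObj X) ≫ hMul X = 𝟙 (hObj X) :=
  hom_ext (fun _ => rfl) (fun _ => Str.ext rfl (by simp))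
    (fun _ => hArrow_ext rfl (by simp))

theorem hMul_right_unit (X : Cat2Gph.{v, u}) : hMap (hUnit X) ≫ hMul X = 𝟙 (hObj X) :=
  hom_ext (fun _ => rfl)
    (fun _ => Str.ext rfl (by simp [List.flatMap_map]))
    (fun _ => hArrow_ext rfl (by simp [List.flatMap_map]))

@[simp] theorem hMap₂_arr {F G : X ⟶ Y} (α : F ⟶ G) (p : (hObj X).C2) :
    hArr ((hMap₂ α).nat.app p) = p.list.map fun x => Arrow.mk (α.nat.app x) :=
  LHom.arrows_fam _ _

/-- The 2-monad for strict horizontal composition. -/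
def H : TwoMonad Cat2Gph.{v, u} where
  obj := hObj
  map := hMap
  map_id := hMap_id
  map_comp := hMap_comp
  η := { app := hUnit, naturality := fun _ _ => hUnit_naturality }
  μ := { app := hMul, naturality := fun _ _ => hMul_naturality }
  assoc := hMul_assoc
  left_unit := hMul_left_unit
  right_unit := hMul_right_unit
  map₂ := hMap₂
  map₂_id _ := hom₂_ext fun _ => Str.hom_ext (LHom.fam_id _ _)
  map₂_comp _ _ := hom₂_ext fun _ => Str.hom_ext (LHom.fam_comp _ _ _).symm
  map₂_whiskerLeft F g h α := conj_of_heq _ _ <|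
    hom₂_heq (hMap_comp F g) (hMap_comp F h) fun p => hArrow_ext rfl (by
      refine (hMap₂_arr _ _).trans (Eq.trans ?_ (hMap₂_arr α ((hMap F).f2.obj p)).symm)
      simp only [hMap_obj_list, List.map_map]; rfl)
  map₂_whiskerRight {_ _ _ f g} α h := conj_of_heq _ _ <|
    hom₂_heq (hMap_comp f h) (hMap_comp g h) fun p => hArrow_ext rfl (by
      refine (hMap₂_arr _ _).trans (Eq.trans ?_ (hMap_arr h ((hMap₂ α).nat.app p)).symm)
      simp only [hMap₂_arr, List.map_map]; rfl)
  η_naturality₂ {_ B f g} _ := conj_of_heq _ _ <|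
    hom₂_heq (hUnit_naturality f) (hUnit_naturality g) fun _ =>
      hArrow_ext ((congrArg B.s (f.src_f2 _)).trans (f.s_f1 _)) rfl
  μ_naturality₂ {_ _ f g} α := conj_of_heq _ _ <|
    hom₂_heq (hMul_naturality f) (hMul_naturality g) fun p => hArrow_ext rfl (by
      refine (hMul_arr ((hMap₂ (hMap₂ α)).nat.app p)).trans
        (Eq.trans ?_ (hMap₂_arr α ((hMul _).f2.obj p)).symm)
      simp only [hMap₂_arr, hMul_obj_list, List.flatMap_map, List.map_flatMap]
      congr 1
      funext a
      exact hMap₂_arr α a)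

end Cat2Gph

/-! ### Vertical composition: formal binary and nullary composites along 1-cells -/

/-- Formal composites of elements of `B`, built from units (at elements of `A`) and binary
composition. -/
inductive Raw (A B : Type u) : Type u
  | one (a : A) : Raw A B
  | leaf (b : B) : Raw A B
  | comp (s t : Raw A B) : Raw A B

namespace Raw

variable {A A' A'' B B' B'' : Type u}

def map (f : A → A') (g : B → B') : Raw A B → Raw A' B'
  | one a => one (f a)
  | leaf b => leaf (g b)
  | comp s t => comp (s.map f g) (t.map f g)

def bind (g : B → Raw A B') : Raw A B → Raw A B'
  | one a => one a
  | leaf b => g b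
  | comp s t => comp (s.bind g) (t.bind g)

def leaves : Raw A B → List B
  | one _ => []
  | leaf b => [b]
  | comp s t => s.leaves ++ t.leaves

/-- The boundary at the start of a formal composite. -/
def src (σ : B → A) : Raw A B → A
  | one a => a
  | leaf b => σ b
  | comp s _ => s.src σ

/-- The boundary at the end of a formal composite. -/
def tgt (τ : B → A) : Raw A B → A
  | one a => a
  | leaf b => τ b
  | comp _ t => t.tgt τ

/-- The formal composite is well formed: adjacent boundaries match. -/
def Ok (σ τ : B → A) : Raw A B → Prop
  | one _ => True
  | leaf _ => True
  | comp s t => s.Ok σ τ ∧ t.Ok σ τ ∧ s.tgt τ = t.src σ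

theorem leaves_map (f : A → A') (g : B → B') (t : Raw A B) :
    (t.map f g).leaves = t.leaves.map g := by
  induction t with
  | one => rfl
  | leaf => rfl
  | comp s t ih ih' => simp [map, leaves, ih, ih']

theorem leaves_bind (g : B → Raw A B') (t : Raw A B) :
    (t.bind g).leaves = t.leaves.flatMap fun b => (g b).leaves := by
  induction t with
  | one => rfl
  | leaf => simp [bind, leaves]
  | comp s t ih ih' => simp [bind, leaves, ih, ih']

theorem src_map {σ : B → A} {σ' : B' → A'} {f : A → A'} {g : B → B'}
    (h : ∀ b, σ' (g b) = f (σ b)) (t : Raw A B) : (t.map f g).src σ' = f (t.src σ) := by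
  induction t with
  | one => rfl
  | leaf b => exact h b
  | comp s t ih ih' => exact ih

theorem tgt_map {τ : B → A} {τ' : B' → A'} {f : A → A'} {g : B → B'}
    (h : ∀ b, τ' (g b) = f (τ b)) (t : Raw A B) : (t.map f g).tgt τ' = f (t.tgt τ) := by
  induction t with
  | one => rfl
  | leaf b => exact h b
  | comp s t ih ih' => exact ih'

theorem Ok.map {σ τ : B → A} {σ' τ' : B' → A'} {f : A → A'} {g : B → B'}
    (hs : ∀ b, σ' (g b) = f (σ b)) (ht : ∀ b, τ' (g b) = f (τ b)) {t : Raw A B}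
    (h : t.Ok σ τ) : (t.map f g).Ok σ' τ' := by
  induction t with
  | one => trivial
  | leaf b => trivial
  | comp s t ih ih' =>
    exact ⟨ih h.1, ih' h.2.1, by rw [tgt_map ht, src_map hs, h.2.2]⟩

theorem src_bind {σ : B → A} {σ' : B' → A} {g : B → Raw A B'}
    (h : ∀ b, σ b = (g b).src σ') (t : Raw A B) : (t.bind g).src σ' = t.src σ := by
  induction t with
  | one => rfl
  | leaf b => exact (h b).symm
  | comp s t ih ih' => exact ih

theorem tgt_bind {τ : B → A} {τ' : B' → A} {g : B → Raw A B'}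
    (h : ∀ b, τ b = (g b).tgt τ') (t : Raw A B) : (t.bind g).tgt τ' = t.tgt τ := by
  induction t with
  | one => rfl
  | leaf b => exact (h b).symm
  | comp s t ih ih' => exact ih'

theorem Ok.bind {σ τ : B → A} {σ' τ' : B' → A} {g : B → Raw A B'}
    (hs : ∀ b, σ b = (g b).src σ') (ht : ∀ b, τ b = (g b).tgt τ') (hg : ∀ b, (g b).Ok σ' τ')
    {t : Raw A B} (h : t.Ok σ τ) : (t.bind g).Ok σ' τ' := by
  induction t with
  | one => trivial
  | leaf b => exact hg b
  | comp s t ih ih' =>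
    exact ⟨ih h.1, ih' h.2.1, by rw [tgt_bind ht, src_bind hs, h.2.2]⟩

theorem map_id (t : Raw A B) : t.map (fun a => a) (fun b => b) = t := by
  induction t with
  | one => rfl
  | leaf => rfl
  | comp s t ih ih' => simp [map, ih, ih']

theorem map_map (f : A → A') (g : B → B') (f' : A' → A'') (g' : B' → B'') (t : Raw A B) :
    (t.map f g).map f' g' = t.map (fun a => f' (f a)) (fun b => g' (g b)) := by
  induction t with
  | one => rfl
  | leaf => rfl
  | comp s t ih ih' => simp [map, ih, ih']

theorem bind_map (f : A → A') (g : B → B') (k : B' → Raw A' B'') (t : Raw A B) :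
    (t.map f g).bind k = (t.map f (fun b => b)).bind (fun b => k (g b)) := by
  induction t with
  | one => rfl
  | leaf => rfl
  | comp s t ih ih' => simp [map, bind, ih, ih']

theorem map_bind (f : A → A') (g : B' → B'') (k : B → Raw A B') (t : Raw A B) :
    (t.bind k).map f g = (t.map f (fun b => b)).bind (fun b => (k b).map f g) := by
  induction t with
  | one => rfl
  | leaf => rfl
  | comp s t ih ih' => simp [map, bind, ih, ih']

theorem bind_bind (k : B → Raw A B') (k' : B' → Raw A B'') (t : Raw A B) :
    (t.bind k).bind k' = t.bind fun b => (k b).bind k' := by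
  induction t with
  | one => rfl
  | leaf => rfl
  | comp s t ih ih' => simp [bind, ih, ih']

theorem bind_leaf (t : Raw A B) : t.bind leaf = t := by
  induction t with
  | one => rfl
  | leaf => rfl
  | comp s t ih ih' => simp [bind, ih, ih']

end Raw

/-- Well-formed formal vertical composites. -/
@[ext] structure VTree {A B : Type u} (σ τ : B → A) where
  tree : Raw A B
  ok : tree.Ok σ τ

section treeCat
variable {A A' : Type u} {C C' : Type u} [Category.{v} C] [Category.{v} C']
  {σ τ : C → A} {σ' τ' : C' → A'}

/-- Morphisms of formal composites: two formal composites with the same boundary and the same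
number of leaves are uniquely isomorphic as formal composites, so a morphism consists of a
morphism for each leaf. -/
@[ext] structure VTree.Hom (p q : VTree σ τ) : Type v where
  src_eq : p.tree.src σ = q.tree.src σ
  tgt_eq : p.tree.tgt τ = q.tree.tgt τ
  hom : LHom p.tree.leaves q.tree.leaves

instance VTree.category : Category.{v} (VTree σ τ) where
  Hom := VTree.Hom
  id _ := ⟨rfl, rfl, LHom.id _⟩
  comp f g := ⟨f.src_eq.trans g.src_eq, f.tgt_eq.trans g.tgt_eq, LHom.comp f.hom g.hom⟩
  id_comp _ := VTree.Hom.ext (LHom.id_comp _)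
  comp_id _ := VTree.Hom.ext (LHom.comp_id _)
  assoc _ _ _ := VTree.Hom.ext (LHom.assoc _ _ _)

theorem VTree.hom_ext {p q : VTree σ τ} {f g : p ⟶ q} (h : f.hom = g.hom) : f = g :=
  VTree.Hom.ext h

theorem VTree.arrow_ext {p q p' q' : VTree σ τ} {f : p ⟶ q} {g : p' ⟶ q'}
    (hs : p.tree = p'.tree) (ht : q.tree = q'.tree) (h : f.hom.arrows = g.hom.arrows) :
    Arrow.mk f = Arrow.mk g := by
  have hp : p = p' := VTree.ext hs
  have hq : q = q' := VTree.ext ht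
  subst hp hq
  exact congrArg Arrow.mk (VTree.hom_ext (LHom.ext_arrows h))

def VTree.mapFunctor (f : A → A') (F : C ⥤ C') (hs : ∀ e, σ' (F.obj e) = f (σ e))
    (ht : ∀ e, τ' (F.obj e) = f (τ e)) : VTree σ τ ⥤ VTree σ' τ' where
  obj p := ⟨p.tree.map f F.obj, p.ok.map hs ht⟩
  map a := ⟨by rw [Raw.src_map hs, Raw.src_map hs, a.src_eq],
    by rw [Raw.tgt_map ht, Raw.tgt_map ht, a.tgt_eq],
    LHom.cast (Raw.leaves_map ..).symm (Raw.leaves_map ..).symm (LHom.map F a.hom)⟩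
  map_id p := VTree.hom_ext (by
    refine (congrArg _ (LHom.map_id F p.tree.leaves)).trans (LHom.cast_id _))
  map_comp a b := VTree.hom_ext ((congrArg _ (LHom.map_comp F a.hom b.hom)).trans
    (LHom.cast_comp ..))

def VTree.joinFunctor {σ' τ' : C' → A} (g : C' ⥤ VTree σ τ)
    (hs : ∀ e, σ' e = (g.obj e).tree.src σ) (ht : ∀ e, τ' e = (g.obj e).tree.tgt τ) :
    VTree σ' τ' ⥤ VTree σ τ where
  obj p := ⟨p.tree.bind fun e => (g.obj e).tree, p.ok.bind hs ht (fun e => (g.obj e).ok)⟩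
  map f := ⟨by rw [Raw.src_bind hs, Raw.src_bind hs, f.src_eq],
    by rw [Raw.tgt_bind ht, Raw.tgt_bind ht, f.tgt_eq],
    LHom.cast (Raw.leaves_bind ..).symm (Raw.leaves_bind ..).symm
      (LHom.flatMap (fun e => (g.obj e).tree.leaves) (fun a => (g.map a).hom) f.hom)⟩
  map_id p := VTree.hom_ext (by
    refine (congrArg _ (LHom.flatMap_id _ _ (fun x => ?_) p.tree.leaves)).trans (LHom.cast_id _)
    rw [g.map_id]; rfl)
  map_comp a b := VTree.hom_ext (by
    refine (congrArg _ (LHom.flatMap_comp _ _ (fun a b => ?_) a.hom b.hom)).trans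
      (LHom.cast_comp ..)
    rw [g.map_comp]; rfl)

/-- Formal composites of a single cell. -/
def VTree.leafFunctor (σ τ : C → A) (hs : ∀ {x y : C}, (x ⟶ y) → σ x = σ y)
    (ht : ∀ {x y : C}, (x ⟶ y) → τ x = τ y) : C ⥤ VTree σ τ where
  obj x := ⟨.leaf x, trivial⟩
  map f := ⟨hs f, ht f, .cons f .nil⟩

end treeCat

namespace Cat2Gph

theorem raw_src_tgt {A B O : Type u} {σ τ : B → A} {k : A → O} (h : ∀ b, k (σ b) = k (τ b))
    {t : Raw A B} (ht : t.Ok σ τ) : k (t.src σ) = k (t.tgt τ) := by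
  induction t with
  | one => rfl
  | leaf b => exact h b
  | comp s t ih ih' => exact (ih ht.1).trans ((congrArg k ht.2.2).trans (ih' ht.2.1))

/-- Free vertical composites: 0-cells and 1-cells are unchanged, 2-cells are formal composites
of 2-cells. -/
abbrev vObj (X : Cat2Gph.{v, u}) : Cat2Gph.{v, u} where
  C0 := X.C0
  C1 := X.C1
  C2 := VTree X.src X.tgt
  cat := VTree.category
  s := X.s
  t := X.t
  src p := p.tree.src X.src
  tgt p := p.tree.tgt X.tgt
  s_eq p := raw_src_tgt X.s_eq p.ok
  t_eq p := raw_src_tgt X.t_eq p.ok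
  src_eq f := VTree.Hom.src_eq f
  tgt_eq f := VTree.Hom.tgt_eq f

variable {X Y Z : Cat2Gph.{v, u}}

def vMap (F : X ⟶ Y) : vObj X ⟶ vObj Y where
  f0 := F.f0
  f1 := F.f1
  f2 := VTree.mapFunctor F.f1 F.f2 F.src_f2 F.tgt_f2
  s_f1 := F.s_f1
  t_f1 := F.t_f1
  src_f2 _ := Raw.src_map F.src_f2 _
  tgt_f2 _ := Raw.tgt_map F.tgt_f2 _

def vMap₂ {F G : X ⟶ Y} (α : F ⟶ G) : vMap F ⟶ vMap G where
  e0 := α.e0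
  e1 := α.e1
  nat :=
    { app := fun p =>
        ⟨(Raw.src_map F.src_f2 _).trans ((congrFun α.e1 _).trans (Raw.src_map G.src_f2 _).symm),
          (Raw.tgt_map F.tgt_f2 _).trans ((congrFun α.e1 _).trans (Raw.tgt_map G.tgt_f2 _).symm),
          LHom.cast (Raw.leaves_map ..).symm (Raw.leaves_map ..).symm
            (LHom.fam α.nat.app p.tree.leaves)⟩
      naturality := fun _ _ f => VTree.hom_ext
        ((LHom.cast_comp ..).symm.trans ((congrArg _ (LHom.fam_naturality α.nat f.hom)).trans
          (LHom.cast_comp ..))) }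

def vUnit (X : Cat2Gph.{v, u}) : X ⟶ vObj X where
  f0 a := a
  f1 f := f
  f2 := VTree.leafFunctor _ _ X.src_eq X.tgt_eq
  s_f1 _ := rfl
  t_f1 _ := rfl
  src_f2 _ := rfl
  tgt_f2 _ := rfl

def vMul (X : Cat2Gph.{v, u}) : vObj (vObj X) ⟶ vObj X where
  f0 a := a
  f1 f := f
  f2 := VTree.joinFunctor (C' := (vObj X).C2) (𝟭 (vObj X).C2) (fun _ => rfl) (fun _ => rfl)
  s_f1 _ := rfl
  t_f1 _ := rfl
  src_f2 p := Raw.src_bind (g := fun q : (vObj X).C2 => q.tree) (fun _ => rfl) p.tree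
  tgt_f2 p := Raw.tgt_bind (g := fun q : (vObj X).C2 => q.tree) (fun _ => rfl) p.tree

/-- The list of components of a morphism of formal composites. -/
def vArr {p q : (vObj X).C2} (f : p ⟶ q) : List (Arrow X.C2) := LHom.arrows (VTree.Hom.hom f)

theorem vArrow_ext {p q p' q' : (vObj X).C2} {f : p ⟶ q} {g : p' ⟶ q'}
    (hs : p.tree = p'.tree) (ht : q.tree = q'.tree) (h : vArr f = vArr g) :
    Arrow.mk f = Arrow.mk g := VTree.arrow_ext hs ht h

section
variable (F : X ⟶ Y) {p q : (vObj X).C2} (f : p ⟶ q) (r : X.C1) (o : X.C0)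
@[simp] theorem vMap_arr :
    vArr ((vMap F).f2.map f) = (vArr f).map fun a => Arrow.mk (F.f2.map a.hom) :=
  (LHom.arrows_cast ..).trans (LHom.arrows_map _ _)
@[simp] theorem vMap_f0 : (vMap F).f0 o = F.f0 o := rfl
@[simp] theorem vMap_f1 : (vMap F).f1 r = F.f1 r := rfl
@[simp] theorem vMap_tree : ((vMap F).f2.obj p).tree = p.tree.map F.f1 F.f2.obj := rfl
@[simp] theorem vUnit_arr {x y : X.C2} (m : x ⟶ y) :
    vArr ((vUnit X).f2.map m) = [Arrow.mk m] := rfl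
@[simp] theorem vUnit_f0 : (vUnit X).f0 o = o := rfl
@[simp] theorem vUnit_f1 : (vUnit X).f1 r = r := rfl
@[simp] theorem vUnit_tree (x : X.C2) : ((vUnit X).f2.obj x).tree = .leaf x := rfl
end

section
variable {p q : (vObj (vObj X)).C2} (f : p ⟶ q) (r : X.C1) (o : X.C0)
@[simp] theorem vMul_arr :
    vArr ((vMul X).f2.map f) = (vArr f).flatMap fun a => vArr a.hom :=
  (LHom.arrows_cast ..).trans (LHom.arrows_flatMap _ _ _)
@[simp] theorem vMul_f0 : (vMul X).f0 o = o := rfl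
@[simp] theorem vMul_f1 : (vMul X).f1 r = r := rfl
@[simp] theorem vMul_tree : ((vMul X).f2.obj p).tree = p.tree.bind fun t => t.tree := rfl
end

theorem vMap_id (X : Cat2Gph.{v, u}) : vMap (𝟙 X) = 𝟙 (vObj X) :=
  hom_ext (fun _ => rfl) (fun _ => rfl)
    (fun _ => vArrow_ext (Raw.map_id _) (Raw.map_id _) ((vMap_arr ..).trans (List.map_id _)))

theorem vMap_comp_tree (F : X ⟶ Y) (G : Y ⟶ Z) (p : (vObj X).C2) :
    ((vMap (F ≫ G)).f2.obj p).tree = ((vMap F ≫ vMap G).f2.obj p).tree :=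
  (Raw.map_map F.f1 F.f2.obj G.f1 G.f2.obj p.tree).symm

theorem vMap_comp (F : X ⟶ Y) (G : Y ⟶ Z) : vMap (F ≫ G) = vMap F ≫ vMap G :=
  hom_ext (fun _ => rfl) (fun _ => rfl)
    (fun _ => vArrow_ext (vMap_comp_tree ..) (vMap_comp_tree ..) (by simp [Function.comp_def]))

theorem vUnit_naturality (F : X ⟶ Y) : F ≫ vUnit Y = vUnit X ≫ vMap F :=
  hom_ext (fun _ => rfl) (fun _ => rfl) (fun _ => vArrow_ext rfl rfl rfl)

theorem vMul_naturality_tree (F : X ⟶ Y) (p : (vObj (vObj X)).C2) :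
    (p.tree.map F.f1 (vMap F).f2.obj).bind (fun t => t.tree) =
      (p.tree.bind fun t => t.tree).map F.f1 F.f2.obj :=
  (Raw.bind_map ..).trans (Raw.map_bind ..).symm

theorem vMul_naturality (F : X ⟶ Y) : vMap (vMap F) ≫ vMul Y = vMul X ≫ vMap F :=
  hom_ext (fun _ => rfl) (fun _ => rfl)
    (fun _ => vArrow_ext (vMul_naturality_tree ..) (vMul_naturality_tree ..)
      (by simp [List.flatMap_map, List.map_flatMap]))

theorem vMul_assoc_tree (p : (vObj (vObj (vObj X))).C2) :
    (p.tree.map (fun f => f) (vMul X).f2.obj).bind (fun t => t.tree) =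
      (p.tree.bind fun t => t.tree).bind fun t => t.tree := by
  refine (Raw.bind_map _ _ _ p.tree).trans ?_
  rw [Raw.map_id]
  exact (Raw.bind_bind _ _ p.tree).symm

theorem vMul_assoc (X : Cat2Gph.{v, u}) : vMap (vMul X) ≫ vMul X = vMul (vObj X) ≫ vMul X :=
  hom_ext (fun _ => rfl) (fun _ => rfl)
    (fun _ => vArrow_ext (vMul_assoc_tree _) (vMul_assoc_tree _)
      (by simp [List.flatMap_map, List.flatMap_assoc]))

theorem vMul_left_unit (X : Cat2Gph.{v, u}) : vUnit (vObj X) ≫ vMul X = 𝟙 (vObj X) :=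
  hom_ext (fun _ => rfl) (fun _ => rfl) (fun _ => vArrow_ext rfl rfl (by simp))

theorem vMul_right_unit_tree (p : (vObj X).C2) :
    (p.tree.map (fun f => f) (vUnit X).f2.obj).bind (fun t => t.tree) = p.tree := by
  rw [Raw.bind_map, Raw.map_id]; exact Raw.bind_leaf _

theorem vMul_right_unit (X : Cat2Gph.{v, u}) : vMap (vUnit X) ≫ vMul X = 𝟙 (vObj X) :=
  hom_ext (fun _ => rfl) (fun _ => rfl)
    (fun _ => vArrow_ext (vMul_right_unit_tree _) (vMul_right_unit_tree _)
      (by simp [List.flatMap_map]))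

@[simp] theorem vMap₂_arr {F G : X ⟶ Y} (α : F ⟶ G) (p : (vObj X).C2) :
    vArr ((vMap₂ α).nat.app p) = p.tree.leaves.map fun x => Arrow.mk (α.nat.app x) :=
  (LHom.arrows_cast ..).trans (LHom.arrows_fam _ _)

/-- The 2-monad for weak vertical composition, given by the free contractible operad on one binary
and one nullary operation. -/
def V : TwoMonad Cat2Gph.{v, u} where
  obj := vObj
  map := vMap
  map_id := vMap_id
  map_comp := vMap_comp
  η := { app := vUnit, naturality := fun _ _ => vUnit_naturality }
  μ := { app := vMul, naturality := fun _ _ => vMul_naturality }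
  assoc := vMul_assoc
  left_unit := vMul_left_unit
  right_unit := vMul_right_unit
  map₂ := vMap₂
  map₂_id F := hom₂_ext fun p => VTree.hom_ext <| LHom.ext_arrows <|
    (vMap₂_arr (𝟙 F) p).trans <| by
      refine Eq.trans ?_ (LHom.arrows_id (p.tree.map F.f1 F.f2.obj).leaves).symm
      rw [Raw.leaves_map, List.map_map]
      rfl
  map₂_comp _ _ := hom₂_ext fun _ => VTree.hom_ext
    ((congrArg _ (LHom.fam_comp _ _ _).symm).trans (LHom.cast_comp ..))
  map₂_whiskerLeft F g h α := conj_of_heq _ _ <|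
    hom₂_heq (vMap_comp F g) (vMap_comp F h) fun p =>
      vArrow_ext (vMap_comp_tree ..) (vMap_comp_tree ..) (by
      refine (vMap₂_arr _ _).trans (Eq.trans ?_ (vMap₂_arr α ((vMap F).f2.obj p)).symm)
      simp only [vMap_tree, Raw.leaves_map, List.map_map]; rfl)
  map₂_whiskerRight {_ _ _ f g} α h := conj_of_heq _ _ <|
    hom₂_heq (vMap_comp f h) (vMap_comp g h) fun p =>
      vArrow_ext (vMap_comp_tree ..) (vMap_comp_tree ..) (by
      refine (vMap₂_arr _ _).trans (Eq.trans ?_ (vMap_arr h ((vMap₂ α).nat.app p)).symm)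
      simp only [vMap₂_arr, List.map_map]; rfl)
  η_naturality₂ {_ B f g} _ := conj_of_heq _ _ <|
    hom₂_heq (vUnit_naturality f) (vUnit_naturality g) fun _ => vArrow_ext rfl rfl rfl
  μ_naturality₂ {_ _ f g} α := conj_of_heq _ _ <|
    hom₂_heq (vMul_naturality f) (vMul_naturality g) fun p =>
      vArrow_ext (vMul_naturality_tree ..) (vMul_naturality_tree ..) (by
      refine (vMul_arr ((vMap₂ (vMap₂ α)).nat.app p)).trans
        (Eq.trans ?_ (vMap₂_arr α ((vMul _).f2.obj p)).symm)
      rw [vMap₂_arr, vMul_tree, List.flatMap_map]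
      refine Eq.trans ?_ (congrArg _ (Raw.leaves_bind _ p.tree).symm)
      rw [List.map_flatMap]
      congr 1
      funext a
      exact vMap₂_arr α a)

end Cat2Gph

/-! ### The distributive law -/

namespace LHom
variable {C : Type u} [Category.{v} C]

/-- A morphism of lists given by its components. -/
def ofIdx : {l m : List C} → (h : l.length = m.length) →
    (∀ i (h : i < l.length) (h' : i < m.length), l[i] ⟶ m[i]) → LHom l m
  | [], [], _, _ => nil
  | _ :: _, _ :: _, h, α => cons (α 0 (Nat.succ_pos _) (Nat.succ_pos _))
      (ofIdx (Nat.succ.inj h) fun i h h' => α (i + 1) (Nat.succ_lt_succ h) (Nat.succ_lt_succ h'))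
  | [], _ :: _, h, _ => nomatch h
  | _ :: _, [], h, _ => nomatch h

theorem ofIdx_arrows : ∀ {l m : List C} (h : l.length = m.length)
    (α : ∀ i (h : i < l.length) (h' : i < m.length), l[i] ⟶ m[i]),
    (ofIdx h α).arrows = List.ofFn fun i : Fin l.length => Arrow.mk (α i i.2 (h ▸ i.2))
  | [], [], _, _ => rfl
  | _ :: _, _ :: _, h, α => by
    refine Eq.trans ?_ (List.ofFn_succ (f := fun i : Fin (_ + 1) => Arrow.mk (α i i.2 (h ▸ i.2)))).symm
    exact congrArg (_ :: ·) (ofIdx_arrows (Nat.succ.inj h) _)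
  | [], _ :: _, h, _ => nomatch h
  | _ :: _, [], h, _ => nomatch h

theorem ofIdx_comp : ∀ {l m n : List C} (h : l.length = m.length) (h' : m.length = n.length)
    (α : ∀ i (h : i < l.length) (h' : i < m.length), l[i] ⟶ m[i])
    (β : ∀ i (h : i < m.length) (h' : i < n.length), m[i] ⟶ n[i])
    (γ : ∀ i (h : i < l.length) (h' : i < n.length), l[i] ⟶ n[i])
    (_ : ∀ i h1 h2 h3, γ i h1 h3 = α i h1 h2 ≫ β i h2 h3),
    ofIdx (h.trans h') γ = comp (ofIdx h α) (ofIdx h' β)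
  | [], [], [], _, _, _, _, _, _ => rfl
  | _ :: _, _ :: _, _ :: _, _, _, _, _, _, e =>
    congrArg₂ cons (e 0 _ (Nat.succ_pos _) _) (ofIdx_comp _ _ _ _ _ fun i _ h2 _ =>
      e (i + 1) _ (Nat.succ_lt_succ h2) _)
  | [], _ :: _, _, h, _, _, _, _, _ => nomatch h
  | _ :: _, [], _, h, _, _, _, _, _ => nomatch h
  | [], [], _ :: _, _, h, _, _, _, _ => nomatch h
  | _ :: _, _ :: _, [], _, h, _, _, _, _ => nomatch h

theorem ofIdx_id (l : List C) (α : ∀ i (h : i < l.length) (h' : i < l.length), l[i] ⟶ l[i])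
    (hα : ∀ i h h', α i h h' = 𝟙 _) : ofIdx rfl α = id l := by
  apply ext_arrows
  rw [ofIdx_arrows, arrows_id]
  apply List.ext_getElem <;> simp [hα]

end LHom

namespace Raw
variable {A A' A'' B B' B'' : Type u}

/-- A formal composite of strings, read as a string of formal composites. -/
def strs (k : A → List A') (l : B → List B') : Raw A B → List (Raw A' B')
  | one a => (k a).map one
  | leaf b => (l b).map leaf
  | comp s t => List.zipWith comp (s.strs k l) (t.strs k l)

variable {k : A → List A'} {l : B → List B'}

theorem leaves_strs (t : Raw A B) (i : ℕ) (h : i < (t.strs k l).length) :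
    (t.strs k l)[i].leaves = t.leaves.flatMap fun b => (l b)[i]?.toList := by
  induction t with
  | one a => simp [strs, leaves]
  | leaf b =>
    simp only [strs, List.length_map] at h
    simp [strs, leaves, h]
  | comp s t ih ih' =>
    simp only [strs, List.length_zipWith, lt_inf_iff] at h
    simp [strs, leaves, ih h.1, ih' h.2]

theorem strs_bdry {σ τ : B → A} {σ' τ' : B' → A'} (hs : ∀ b, k (σ b) = (l b).map σ')
    (ht : ∀ b, k (τ b) = (l b).map τ') {t : Raw A B} (h : t.Ok σ τ) :
    (t.strs k l).map (src σ') = k (t.src σ) ∧ (t.strs k l).map (tgt τ') = k (t.tgt τ) := by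
  induction t with
  | one a => constructor <;> simp [strs, src, tgt, Function.comp_def]
  | leaf b => constructor <;> simp [strs, src, tgt, hs, ht, Function.comp_def]
  | comp s t ih ih' =>
    have e1 := ih h.1
    have e2 := ih' h.2.1
    have hl : (s.strs k l).length = (t.strs k l).length := by
      have := congrArg List.length (e1.2.trans ((congrArg k h.2.2).trans e2.1.symm))
      simpa using this
    refine ⟨Eq.trans ?_ e1.1, Eq.trans ?_ e2.2⟩
    · apply List.ext_getElem <;> simp [strs, hl, src]
    · apply List.ext_getElem <;> simp [strs, hl, tgt]

theorem strs_ok {σ τ : B → A} {σ' τ' : B' → A'} (hs : ∀ b, k (σ b) = (l b).map σ')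
    (ht : ∀ b, k (τ b) = (l b).map τ') {t : Raw A B} (h : t.Ok σ τ) (r : Raw A' B')
    (hr : r ∈ t.strs k l) : r.Ok σ' τ' := by
  induction t generalizing r with
  | one a =>
    obtain ⟨a, _, rfl⟩ := List.mem_map.1 hr
    trivial
  | leaf a =>
    obtain ⟨a, _, rfl⟩ := List.mem_map.1 hr
    trivial
  | comp s t ih ih' =>
    obtain ⟨i, hi, rfl⟩ := List.getElem_of_mem hr
    have hi' := hi
    simp only [strs, List.length_zipWith, lt_inf_iff] at hi'
    simp only [strs, List.getElem_zipWith]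
    refine ⟨ih h.1 _ (List.getElem_mem _), ih' h.2.1 _ (List.getElem_mem _), ?_⟩
    have e := (strs_bdry hs ht h.1).2.trans
      ((congrArg k h.2.2).trans (strs_bdry hs ht h.2.1).1.symm)
    have := List.getElem_of_eq e (i := i) (by simpa using hi'.1)
    simpa using this

theorem leaf_bdry {T : Type u} {σ τ : B → A} {n : A → T} (hn : ∀ b, n (σ b) = n (τ b)) {t : Raw A B}
    (h : t.Ok σ τ) : n (t.src σ) = n (t.tgt τ) ∧ ∀ b ∈ t.leaves, n (σ b) = n (t.src σ) := by
  induction t with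
  | one a => simp [leaves, src, tgt]
  | leaf b => simp [leaves, src, tgt, hn]
  | comp s t ih ih' =>
    have e := (ih h.1).1.trans (congrArg n h.2.2)
    refine ⟨e.trans (ih' h.2.1).1, fun b hb => ?_⟩
    rcases List.mem_append.1 hb with hb | hb
    · exact (ih h.1).2 b hb
    · exact ((ih' h.2.1).2 b hb).trans e.symm

theorem strs_map {A₁ B₁ A₁' B₁' : Type u} {k' : A₁ → List A₁'} {l' : B₁ → List B₁'} {f : A → A₁}
    {g : B → B₁} {f' : A' → A₁'} {g' : B' → B₁'} (hk : ∀ a, k' (f a) = (k a).map f')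
    (hl : ∀ b, l' (g b) = (l b).map g') (t : Raw A B) :
    (t.map f g).strs k' l' = (t.strs k l).map (map f' g') := by
  induction t with
  | one a => simp [strs, map, hk, Function.comp_def]
  | leaf b => simp [strs, map, hl, Function.comp_def]
  | comp s t ih ih' =>
    simp only [map, strs, ih, ih']
    apply List.ext_getElem <;> simp [map]

theorem strs_single (t : Raw A B) : t.strs (fun a => [a]) (fun b => [b]) = [t] := by
  induction t with
  | one a => rfl
  | leaf b => rfl
  | comp s t ih ih' => simp [strs, ih, ih']

theorem strs_bind {l₁ : B'' → List (Raw A' B')} {g : B'' → Raw A B}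
    (hl : ∀ b, (g b).strs k l = l₁ b) (t : Raw A B'') :
    (t.bind g).strs k l = (t.strs k l₁).map (bind fun r => r) := by
  induction t with
  | one a => simp [strs, bind, Function.comp_def]
  | leaf b => simp [strs, bind, hl, Function.comp_def]
  | comp s t ih ih' =>
    simp only [bind, strs, ih, ih']
    apply List.ext_getElem <;> simp [bind]

theorem zipWith_flatMap {α β γ δ κ : Type u} (f : γ → δ → κ) (g : α → List γ) (h : β → List δ) :
    ∀ (l : List α) (m : List β), l.map (fun a => (g a).length) = m.map (fun b => (h b).length) →
      List.zipWith f (l.flatMap g) (m.flatMap h) =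
        (List.zipWith (fun a b => List.zipWith f (g a) (h b)) l m).flatten
  | [], [], _ => rfl
  | a :: l, b :: m, e => by
    simp only [List.map_cons, List.cons.injEq] at e
    simp [List.zipWith_append, e.1, zipWith_flatMap f g h l m e.2]
  | [], _ :: _, e => nomatch e
  | _ :: _, [], e => nomatch e

end Raw

/-- The list of the first `n` columns of a list of rows. -/
def cols {α : Type u} (n : ℕ) (M : List (List α)) : List (List α) :=
  (List.range n).map fun i => M.flatMap fun r => r[i]?.toList

section
variable {α : Type u} {β : Type w}

@[simp] theorem length_cols (n : ℕ) (M : List (List α)) : (cols n M).length = n := by simp [cols]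

theorem getElem_cols (n : ℕ) (M : List (List α)) (i : ℕ) (h : i < (cols n M).length) :
    (cols n M)[i] = M.flatMap fun r => r[i]?.toList := by simp [cols]

theorem getElem?_cols (n : ℕ) (M : List (List α)) (i : ℕ) (h : i < n) :
    (cols n M)[i]? = some (M.flatMap fun r => r[i]?.toList) := by simp [cols, h]

theorem cols_map (f : α → β) (n : ℕ) (M : List (List α)) :
    cols n (M.map (List.map f)) = (cols n M).map (List.map f) := by
  apply List.ext_getElem
  · simp
  · intro i h h'
    rw [getElem_cols, List.getElem_map, getElem_cols, List.flatMap_map, List.map_flatMap]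
    congr 1
    funext r
    simp only [List.getElem?_map]
    cases r[i]? <;> rfl

theorem cols_single (r : List α) : cols r.length [r] = r.map fun a => [a] := by
  apply List.ext_getElem
  · simp
  · intro i h h'
    simp only [length_cols] at h
    rw [getElem_cols]
    simp [h]

theorem cols_one (r : List α) : cols 1 (r.map fun a => [a]) = [r] := by
  simp [cols, List.flatMap_map]

theorem cols_flatten (n : ℕ) (N : List (List (List α))) :
    cols n N.flatten = (cols n (N.map (cols n))).map List.flatten := by
  apply List.ext_getElem
  · simp
  · intro i h h'
    simp only [length_cols] at h
    rw [getElem_cols, List.getElem_map, getElem_cols, List.flatMap_map]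
    simp only [getElem?_cols _ _ _ h, Option.toList_some]
    clear * -
    induction N with
    | nil => rfl
    | cons M N ih => simp [ih]

theorem cols_append (n k : ℕ) (N : List (List α × List α)) (hN : ∀ r ∈ N, r.1.length = n) :
    cols (n + k) (N.map fun r => r.1 ++ r.2) =
      cols n (N.map fun r => r.1) ++ cols k (N.map fun r => r.2) := by
  unfold cols
  rw [List.range_add, List.map_append, List.map_map]
  congr 1
  · refine List.map_congr_left fun i hi => ?_
    rw [List.flatMap_map, List.flatMap_map]
    refine List.flatMap_congr fun r hr => ?_
    rw [List.getElem?_append_left (by rw [hN r hr]; exact List.mem_range.1 hi)]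
  · refine List.map_congr_left fun i hi => ?_
    simp only [Function.comp_apply]
    rw [List.flatMap_map, List.flatMap_map]
    refine List.flatMap_congr fun r hr => ?_
    rw [List.getElem?_append_right (by rw [hN r hr]; exact Nat.le_add_right _ _), hN r hr,
      Nat.add_sub_cancel_left]

theorem cols_sum (ns : List ℕ) : ∀ (N : List (List (List α)))
    (_ : ∀ r ∈ N, r.map List.length = ns) (L : List (List (List α))) (_ : L.length = ns.length)
    (_ : ∀ i (h : i < L.length) (h' : i < ns.length),
      L[i] = cols ns[i] (N.flatMap fun r => r[i]?.toList)),
    cols ns.sum (N.map List.flatten) = L.flatten := by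
  induction ns with
  | nil =>
    intro N _ L hL _
    obtain rfl : L = [] := List.length_eq_zero_iff.1 hL
    rfl
  | cons n ns ih =>
    intro N hN L hL h
    cases L with
    | nil => exact nomatch hL
    | cons K L =>
      have h0 := h 0 (Nat.succ_pos _) (Nat.succ_pos _)
      simp only [List.getElem_cons_zero] at h0
      have hr : ∀ r ∈ N, ∃ a r', r = a :: r' ∧ a.length = n ∧ r'.map List.length = ns := by
        intro r hr
        have := hN r hr
        cases r with
        | nil => exact nomatch this
        | cons a r' =>
          simp only [List.map_cons, List.cons.injEq] at this
          exact ⟨a, r', rfl, this⟩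
      have e1 : N.map List.flatten =
          (N.map fun r => (r.headD [], r.tail.flatten)).map fun r => r.1 ++ r.2 := by
        rw [List.map_map]
        refine List.map_congr_left fun r h => ?_
        obtain ⟨a, r', rfl, _⟩ := hr r h
        rfl
      rw [List.sum_cons, e1, cols_append, List.flatten_cons]
      · congr 1
        · rw [h0, List.map_map]
          congr 1
          rw [List.map_eq_flatMap]
          refine (List.flatMap_congr fun r h => ?_).symm
          obtain ⟨a, r', rfl, _⟩ := hr r h
          rfl
        · rw [List.map_map]
          have := ih (N.map List.tail) (fun r h => by
            obtain ⟨s, hs, rfl⟩ := List.mem_map.1 h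
            obtain ⟨a, r', rfl, _, e⟩ := hr s hs
            exact e) L (Nat.succ.inj hL) (fun i hi hi' => by
            have := h (i + 1) (Nat.succ_lt_succ hi) (Nat.succ_lt_succ hi')
            simp only [List.getElem_cons_succ] at this
            rw [this, List.flatMap_map]
            congr 1
            refine List.flatMap_congr fun r h => ?_
            obtain ⟨a, r', rfl, _⟩ := hr r h
            rfl)
          rw [← this, List.map_map]
          rfl
      · intro p hp
        obtain ⟨s, hs, rfl⟩ := List.mem_map.1 hp
        obtain ⟨a, r', rfl, e, _⟩ := hr s hs
        exact e

end

section
variable {O E : Type u} {s t : E → O}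

theorem isChain_map {E' : Type u} (g : E' → E) (a : O) (l : List E') :
    IsChain (fun e => s (g e)) (fun e => t (g e)) a l ↔ IsChain s t a (l.map g) := by
  induction l generalizing a with
  | nil => rfl
  | cons e l ih => exact and_congr Iff.rfl (ih _)

theorem map_tree_inj {A B : Type u} {σ τ : B → A} {l m : List (VTree σ τ)}
    (h : l.map VTree.tree = m.map VTree.tree) : l = m :=
  List.map_injective_iff.2 (fun _ _ => VTree.ext) h

end

namespace Raw
variable {A A' A'' B B' B'' : Type u}

theorem strs_flatMap {k : A → List A'} {l : B → List B'} {k' : A' → List A''}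
    {l' : B' → List B''} {σ τ : B → A} {σ' τ' : B' → A'} {σ'' τ'' : B'' → A''}
    (hs : ∀ b, k (σ b) = (l b).map σ') (ht : ∀ b, k (τ b) = (l b).map τ')
    (hs' : ∀ b, k' (σ' b) = (l' b).map σ'') (ht' : ∀ b, k' (τ' b) = (l' b).map τ'')
    {t : Raw A B} (h : t.Ok σ τ) :
    t.strs (fun a => (k a).flatMap k') (fun b => (l b).flatMap l') =
      (t.strs k l).flatMap (strs k' l') := by
  induction t with
  | one a => simp [strs, List.map_flatMap, List.flatMap_map]
  | leaf b => simp [strs, List.map_flatMap, List.flatMap_map]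
  | comp s t ih ih' =>
    simp only [strs]
    rw [ih h.1, ih' h.2.1, zipWith_flatMap]
    · rw [List.flatMap_def, List.map_zipWith]
      congr 1
    · have e := (strs_bdry hs ht h.1).2.trans
        ((congrArg k h.2.2).trans (strs_bdry hs ht h.2.1).1.symm)
      have e' := congrArg (List.map fun a => (k' a).length) e
      rw [List.map_map, List.map_map] at e'
      refine Eq.trans (List.map_congr_left fun r hr => ?_)
        (e'.trans (List.map_congr_left fun r hr => ?_))
      · have := congrArg List.length (strs_bdry hs' ht' (strs_ok hs ht h.1 r hr)).2
        simpa using this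
      · have := congrArg List.length (strs_bdry hs' ht' (strs_ok hs ht h.2.1 r hr)).1
        simpa using this.symm

end Raw

namespace Cat2Gph

variable {X Y Z : Cat2Gph.{v, u}}

/-- The string of formal composites corresponding to a formal composite of strings. -/
def lstrs (p : (vObj (hObj X)).C2) : List (Raw X.C1 X.C2) :=
  p.tree.strs (fun a : (hObj X).C1 => a.list) (fun b : (hObj X).C2 => b.list)

theorem lstrs_src (p : (vObj (hObj X)).C2) :
    (lstrs p).map (Raw.src X.src) = ((vObj (hObj X)).src p).list :=
  (Raw.strs_bdry (k := fun a : (hObj X).C1 => a.list) (l := fun b : (hObj X).C2 => b.list)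
    (σ := (hObj X).src) (τ := (hObj X).tgt) (fun _ => rfl) (fun _ => rfl) p.ok).1

theorem lstrs_tgt (p : (vObj (hObj X)).C2) :
    (lstrs p).map (Raw.tgt X.tgt) = ((vObj (hObj X)).tgt p).list :=
  (Raw.strs_bdry (k := fun a : (hObj X).C1 => a.list) (l := fun b : (hObj X).C2 => b.list)
    (σ := (hObj X).src) (τ := (hObj X).tgt) (fun _ => rfl) (fun _ => rfl) p.ok).2

theorem lstrs_ok (p : (vObj (hObj X)).C2) : ∀ r ∈ lstrs p, r.Ok X.src X.tgt :=
  Raw.strs_ok (k := fun a : (hObj X).C1 => a.list) (l := fun b : (hObj X).C2 => b.list)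
    (σ := (hObj X).src) (τ := (hObj X).tgt) (fun _ => rfl) (fun _ => rfl) p.ok

def lList (p : (vObj (hObj X)).C2) : List (vObj X).C2 :=
  (lstrs p).attach.map fun r => ⟨r.1, lstrs_ok p r.1 r.2⟩

theorem lList_tree (p : (vObj (hObj X)).C2) : (lList p).map VTree.tree = lstrs p := by
  rw [lList, List.map_map]
  exact List.attach_map_subtype_val _

theorem lList_length (p : (vObj (hObj X)).C2) : (lList p).length = (lstrs p).length :=
  List.length_map _ |>.trans List.length_attach

theorem lstrs_length (p : (vObj (hObj X)).C2) :
    (lstrs p).length = ((vObj (hObj X)).src p).list.length :=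
  (List.length_map _).symm.trans (congrArg List.length (lstrs_src p))

theorem lList_getElem (p : (vObj (hObj X)).C2) (i : ℕ) (h : i < (lList p).length) :
    (lList p)[i].tree = (lstrs p)[i]'((lList_length p).symm ▸ h) := by
  rw [← List.getElem_map VTree.tree (h := by simpa using h)]
  exact List.getElem_of_eq (lList_tree p) _

theorem lList_src (p : (vObj (hObj X)).C2) :
    (lList p).map (vObj X).src = ((vObj (hObj X)).src p).list := by
  rw [← lstrs_src, ← lList_tree, List.map_map]; rfl

theorem lList_tgt (p : (vObj (hObj X)).C2) :
    (lList p).map (vObj X).tgt = ((vObj (hObj X)).tgt p).list := by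
  rw [← lstrs_tgt, ← lList_tree, List.map_map]; rfl

theorem lList_leaves (p : (vObj (hObj X)).C2) (i : ℕ) (h : i < (lList p).length) :
    (lList p)[i].tree.leaves =
      p.tree.leaves.flatMap fun b : (hObj X).C2 => b.list[i]?.toList := by
  rw [lList_getElem]
  exact Raw.leaves_strs _ _ _

def lObj (p : (vObj (hObj X)).C2) : (hObj (vObj X)).C2 where
  start := ((vObj (hObj X)).src p).start
  list := lList p
  ok := (isChain_map (vObj X).src _ _).2 (by rw [lList_src]; exact Str.ok _)

theorem lList_length_eq {p q : (vObj (hObj X)).C2} (f : p ⟶ q) :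
    (lList p).length = (lList q).length := by
  rw [lList_length, lList_length, lstrs_length, lstrs_length]
  exact congrArg (fun r : (hObj X).C1 => r.list.length) ((vObj (hObj X)).src_eq f)

theorem lList_src_eq {p q : (vObj (hObj X)).C2} (f : p ⟶ q) (i : ℕ) (h : i < (lList p).length)
    (h' : i < (lList q).length) : (vObj X).src (lList p)[i] = (vObj X).src (lList q)[i] := by
  have e : (lList p).map (vObj X).src = (lList q).map (vObj X).src := by
    rw [lList_src, lList_src, (vObj (hObj X)).src_eq f]
  have := List.getElem_of_eq e (i := i) (by simpa using h)
  simpa using this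

theorem lList_tgt_eq {p q : (vObj (hObj X)).C2} (f : p ⟶ q) (i : ℕ) (h : i < (lList p).length)
    (h' : i < (lList q).length) : (vObj X).tgt (lList p)[i] = (vObj X).tgt (lList q)[i] := by
  have e : (lList p).map (vObj X).tgt = (lList q).map (vObj X).tgt := by
    rw [lList_tgt, lList_tgt, (vObj (hObj X)).tgt_eq f]
  have := List.getElem_of_eq e (i := i) (by simpa using h)
  simpa using this

/-- The components of `lFun`. -/
def lComp {p q : (vObj (hObj X)).C2} (f : p ⟶ q) (i : ℕ) (h : i < (lList p).length)
    (h' : i < (lList q).length) : (lList p)[i] ⟶ (lList q)[i] :=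
  VTree.Hom.mk (lList_src_eq f i h h') (lList_tgt_eq f i h h')
    (LHom.cast (lList_leaves p i h).symm (lList_leaves q i h').symm
      (LHom.flatMap (fun b : (hObj X).C2 => b.list[i]?.toList)
        (fun a => LHom.get (Str.Hom.hom a) i) (VTree.Hom.hom f)))

/-- The distributive law on hom-categories: a formal vertical composite of horizontal strings is
sent to the horizontal string of the formal vertical composites of its columns. -/
def lFun (X : Cat2Gph.{v, u}) : (vObj (hObj X)).C2 ⥤ (hObj (vObj X)).C2 where
  obj := lObj
  map {p q} f := Str.Hom.mk (p := lObj p) (q := lObj q)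
    (congrArg (fun r : (hObj X).C1 => r.start) ((vObj (hObj X)).src_eq f))
    (LHom.ofIdx (lList_length_eq f) (lComp f))
  map_id p := Str.hom_ext (LHom.ofIdx_id _ _ fun i h h' => VTree.hom_ext (by
    refine (congrArg (LHom.cast _ _) ?_).trans (LHom.cast_id _)
    exact LHom.flatMap_id _ _ (fun x => LHom.get_id _ _) _))
  map_comp f g := Str.hom_ext (LHom.ofIdx_comp _ _ _ _ _ fun i h h' h'' => VTree.hom_ext (by
    refine (congrArg (LHom.cast _ _) ?_).trans (LHom.cast_comp _ (lList_leaves _ i h').symm _ _ _)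
    exact LHom.flatMap_comp _ _ (fun a b => LHom.get_comp _ _ _) _ _))

def lLaw (X : Cat2Gph.{v, u}) : vObj (hObj X) ⟶ hObj (vObj X) where
  f0 a := a
  f1 f := f
  f2 := lFun X
  s_f1 _ := rfl
  t_f1 _ := rfl
  src_f2 p := Str.ext rfl (lList_src p)
  tgt_f2 p := Str.ext ((vObj (hObj X)).s_eq p) (lList_tgt p)

/-- The list of lists of components. -/
def hvArr {p q : (hObj (vObj X)).C2} (f : p ⟶ q) : List (List (Arrow X.C2)) :=
  (hArr f).map fun a => vArr a.hom

/-- The list of lists of components. -/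
def vhArr {p q : (vObj (hObj X)).C2} (f : p ⟶ q) : List (List (Arrow X.C2)) :=
  (vArr f).map fun a => hArr a.hom

theorem arrow_list_ext : ∀ {L M : List (Arrow (vObj X).C2)}
    (_ : L.map (fun a => a.left.tree) = M.map fun a => a.left.tree)
    (_ : L.map (fun a => a.right.tree) = M.map fun a => a.right.tree)
    (_ : L.map (fun a => vArr a.hom) = M.map fun a => vArr a.hom), L = M
  | [], [], _, _, _ => rfl
  | a :: L, b :: M, h1, h2, h3 => by
    simp only [List.map_cons, List.cons.injEq] at h1 h2 h3
    rw [arrow_list_ext h1.2 h2.2 h3.2]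
    exact congrArg (· :: M) (vArrow_ext (f := a.hom) (g := b.hom) h1.1 h2.1 h3.1)
  | [], _ :: _, h, _, _ => nomatch h
  | _ :: _, [], h, _, _ => nomatch h

theorem hvArrow_ext {p q p' q' : (hObj (vObj X)).C2} {f : p ⟶ q} {g : p' ⟶ q'}
    (hs : p.start = p'.start) (hp : p.list.map VTree.tree = p'.list.map VTree.tree)
    (hq : q.list.map VTree.tree = q'.list.map VTree.tree) (h : hvArr f = hvArr g) :
    Arrow.mk f = Arrow.mk g := by
  refine hArrow_ext hs (arrow_list_ext ?_ ?_ h)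
  · have e1 := congrArg (List.map VTree.tree) (LHom.arrows_left (Str.Hom.hom f))
    have e2 := congrArg (List.map VTree.tree) (LHom.arrows_left (Str.Hom.hom g))
    rw [List.map_map] at e1 e2
    exact e1.trans (hp.trans e2.symm)
  · have e1 := congrArg (List.map VTree.tree) (LHom.arrows_right (Str.Hom.hom f))
    have e2 := congrArg (List.map VTree.tree) (LHom.arrows_right (Str.Hom.hom g))
    rw [List.map_map] at e1 e2
    exact e1.trans (hq.trans e2.symm)

theorem lComp_arr {p q : (vObj (hObj X)).C2} (f : p ⟶ q) (i : ℕ) (h : i < (lList p).length)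
    (h' : i < (lList q).length) :
    vArr (lComp f i h h') = (vArr f).flatMap fun a => (hArr a.hom)[i]?.toList := by
  refine (LHom.arrows_cast ..).trans ((LHom.arrows_flatMap _ _ _).trans ?_)
  refine List.flatMap_congr fun a _ => ?_
  exact LHom.arrows_get _ _

theorem lFun_hArr {p q : (vObj (hObj X)).C2} (f : p ⟶ q) :
    hArr ((lFun X).map f) = List.ofFn fun i : Fin (lList p).length =>
      Arrow.mk (lComp f i i.2 (lList_length_eq f ▸ i.2)) :=
  LHom.ofIdx_arrows _ _

theorem lFun_arr {p q : (vObj (hObj X)).C2} (f : p ⟶ q) :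
    hvArr ((lFun X).map f) = cols (lstrs p).length (vhArr f) := by
  rw [hvArr, lFun_hArr]
  apply List.ext_getElem
  · rw [List.length_map, List.length_ofFn, length_cols, lList_length]
  · intro i h h'
    rw [getElem_cols, vhArr, List.flatMap_map, List.getElem_map]
    have hi : i < (lList p).length := by simpa using h
    refine Eq.trans ?_ (lComp_arr f i hi (lList_length_eq f ▸ hi))
    erw [List.getElem_ofFn]
    rfl

end Cat2Gph
namespace Cat2Gph

variable {X Y Z : Cat2Gph.{v, u}}

theorem hvArr_map (F : X ⟶ Y) {p q : (hObj (vObj X)).C2} (f : p ⟶ q) :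
    hvArr ((hMap (vMap F)).f2.map f) =
      (hvArr f).map (List.map fun a => Arrow.mk (F.f2.map a.hom)) := by
  rw [hvArr, hMap_arr, hvArr, List.map_map, List.map_map]
  refine List.map_congr_left fun a _ => ?_
  exact vMap_arr F a.hom

theorem vhArr_map (F : X ⟶ Y) {p q : (vObj (hObj X)).C2} (f : p ⟶ q) :
    vhArr ((vMap (hMap F)).f2.map f) =
      (vhArr f).map (List.map fun a => Arrow.mk (F.f2.map a.hom)) := by
  rw [vhArr, vMap_arr, vhArr, List.map_map, List.map_map]
  refine List.map_congr_left fun a _ => ?_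
  exact hMap_arr F a.hom

theorem lLaw_naturality_tree (F : X ⟶ Y) (p : (vObj (hObj X)).C2) :
    lstrs ((vMap (hMap F)).f2.obj p) = (lstrs p).map (Raw.map F.f1 F.f2.obj) :=
  Raw.strs_map (k := fun a : (hObj X).C1 => a.list) (l := fun b : (hObj X).C2 => b.list)
    (k' := fun a : (hObj Y).C1 => a.list) (l' := fun b : (hObj Y).C2 => b.list)
    (f := (hMap F).f1) (g := (hMap F).f2.obj) (fun _ => rfl) (fun _ => rfl) p.tree

theorem lLaw_naturality_start (F : X ⟶ Y) (p : (vObj (hObj X)).C2) :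
    (((vMap (hMap F)) ≫ lLaw Y).f2.obj p).start = ((lLaw X ≫ hMap (vMap F)).f2.obj p).start :=
  congrArg (fun r : (hObj Y).C1 => r.start) ((vMap (hMap F)).src_f2 p)

theorem lLaw_naturality_list (F : X ⟶ Y) (p : (vObj (hObj X)).C2) :
    (((vMap (hMap F)) ≫ lLaw Y).f2.obj p).list.map VTree.tree =
      ((lLaw X ≫ hMap (vMap F)).f2.obj p).list.map VTree.tree := by
  refine (lList_tree _).trans ((lLaw_naturality_tree F p).trans ?_)
  rw [← lList_tree, List.map_map]
  exact (List.map_map (l := lList p) (f := (vMap F).f2.obj) (g := VTree.tree)).symm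

theorem lLaw_naturality (F : X ⟶ Y) : vMap (hMap F) ≫ lLaw Y = lLaw X ≫ hMap (vMap F) :=
  hom_ext (fun _ => rfl) (fun _ => rfl) fun {p q} f =>
    hvArrow_ext (lLaw_naturality_start F p) (lLaw_naturality_list F p) (lLaw_naturality_list F q)
      (by
        refine (lFun_arr ((vMap (hMap F)).f2.map f)).trans (Eq.trans ?_ (hvArr_map F _).symm)
        rw [lLaw_naturality_tree, List.length_map, vhArr_map, cols_map]
        exact congrArg _ (lFun_arr f).symm)

theorem lLaw_naturality₂ {F G : X ⟶ Y} (α : F ⟶ G) :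
    HEq (vMap₂ (hMap₂ α) ▷ lLaw Y) (lLaw X ◁ hMap₂ (vMap₂ α)) :=
  hom₂_heq (lLaw_naturality F) (lLaw_naturality G) fun p =>
    hvArrow_ext (lLaw_naturality_start F p) (lLaw_naturality_list F p) (lLaw_naturality_list G p)
      (by
        refine (lFun_arr ((vMap₂ (hMap₂ α)).nat.app p)).trans ?_
        rw [lLaw_naturality_tree, List.length_map]
        have e1 : vhArr ((vMap₂ (hMap₂ α)).nat.app p) = (p.tree.leaves.map fun x : (hObj X).C2 =>
            x.list).map (List.map fun x => Arrow.mk (α.nat.app x)) := by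
          rw [vhArr, vMap₂_arr, List.map_map, List.map_map]
          refine List.map_congr_left fun x _ => ?_
          exact hMap₂_arr α x
        have e2 : hvArr ((hMap₂ (vMap₂ α)).nat.app ((lFun X).obj p)) =
            ((lstrs p).map Raw.leaves).map (List.map fun x => Arrow.mk (α.nat.app x)) := by
          rw [hvArr, hMap₂_arr, ← lList_tree, List.map_map, List.map_map, List.map_map]
          refine List.map_congr_left fun x _ => ?_
          exact vMap₂_arr α x
        refine Eq.trans ?_ e2.symm
        rw [e1, cols_map]
        congr 1
        apply List.ext_getElem
        · simp
        · intro i h h'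
          rw [getElem_cols, List.getElem_map, List.flatMap_map]
          exact (Raw.leaves_strs _ _ _).symm)

theorem lLaw_unit_left (X : Cat2Gph.{v, u}) : vUnit (hObj X) ≫ lLaw X = hMap (vUnit X) :=
  hom_ext (fun _ => rfl) (fun p => Str.ext rfl (List.map_id _).symm) fun {p q} f => by
    have e (p : (hObj X).C2) : ((vUnit (hObj X) ≫ lLaw X).f2.obj p).list.map VTree.tree =
        ((hMap (vUnit X)).f2.obj p).list.map VTree.tree := by
      refine (lList_tree _).trans ?_
      rw [hMap_obj_list, List.map_map]
      rfl
    refine hvArrow_ext rfl (e p) (e q) ?_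
    refine (lFun_arr ((vUnit (hObj X)).f2.map f)).trans ?_
    have e1 : hvArr ((hMap (vUnit X)).f2.map f) = (hArr f).map fun a => [a] := by
      rw [hvArr, hMap_arr, List.map_map]; rfl
    have e2 : (lstrs ((vUnit (hObj X)).f2.obj p)).length = (hArr f).length := by
      refine List.length_map _ |>.trans ?_
      rw [hArr, ← List.length_map (fun a : Arrow X.C2 => a.left), LHom.arrows_left]
    rw [e1, e2, ← cols_single]
    rfl

theorem lLaw_unit_right (X : Cat2Gph.{v, u}) : vMap (hUnit X) ≫ lLaw X = hUnit (vObj X) :=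
  hom_ext (fun _ => rfl) (fun p => rfl) fun {p q} f => by
    have e0 (p : (vObj X).C2) : lstrs ((vMap (hUnit X)).f2.obj p) = [p.tree] := by
      refine (Raw.strs_map (k := fun a => [a]) (l := fun a => [a])
        (k' := fun a : (hObj X).C1 => a.list) (l' := fun b : (hObj X).C2 => b.list)
        (f := (hUnit X).f1) (g := (hUnit X).f2.obj) (f' := fun a => a)
        (g' := fun a => a) (fun _ => rfl) (fun _ => rfl) p.tree).trans ?_
      rw [Raw.strs_single, List.map_singleton, Raw.map_id]
    have e (p : (vObj X).C2) : ((vMap (hUnit X) ≫ lLaw X).f2.obj p).list.map VTree.tree =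
        ((hUnit (vObj X)).f2.obj p).list.map VTree.tree := (lList_tree _).trans (e0 p)
    refine hvArrow_ext ?_ (e p) (e q) ?_
    · exact congrArg (fun r : (hObj X).C1 => r.start) ((vMap (hUnit X)).src_f2 p)
    · refine (lFun_arr ((vMap (hUnit X)).f2.map f)).trans ?_
      have e1 : vhArr ((vMap (hUnit X)).f2.map f) = (vArr f).map fun a => [a] := by
        rw [vhArr, vMap_arr, List.map_map]; rfl
      rw [e0, e1]
      exact cols_one _

theorem lstrs_mul (p : (vObj (vObj (hObj X))).C2) : lstrs ((vMul (hObj X)).f2.obj p) =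
    (lstrs ((vMap (lLaw X)).f2.obj p)).map (Raw.bind fun r => r.tree) := by
  have e1 : lstrs ((vMul (hObj X)).f2.obj p) =
      (p.tree.strs (fun a : (hObj X).C1 => a.list) lstrs).map (Raw.bind fun r => r) :=
    Raw.strs_bind (k := fun a : (hObj X).C1 => a.list) (l := fun b : (hObj X).C2 => b.list)
      (g := fun r : (vObj (hObj X)).C2 => r.tree) (fun _ => rfl) p.tree
  have e2 : lstrs ((vMap (lLaw X)).f2.obj p) =
      (p.tree.strs (fun a : (hObj X).C1 => a.list) lList).map
        (Raw.map (fun a => a) (fun b => b)) :=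
    Raw.strs_map (k := fun a : (hObj X).C1 => a.list) (l := lList)
      (k' := fun a : (hObj X).C1 => a.list) (l' := fun b : (hObj (vObj X)).C2 => b.list)
      (f := (lLaw X).f1) (g := (lLaw X).f2.obj) (f' := fun a => a) (g' := fun b => b)
      (fun _ => (List.map_id _).symm) (fun _ => (List.map_id _).symm) p.tree
  have e3 := Raw.strs_map (k := fun a : (hObj X).C1 => a.list) (l := lList)
    (k' := fun a : (hObj X).C1 => a.list) (l' := lstrs) (f := fun a => a)
    (g := fun b => b) (f' := fun a => a) (g' := VTree.tree)
    (fun _ => (List.map_id _).symm) (fun b => (lList_tree b).symm) p.tree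
  rw [Raw.map_id] at e3
  rw [e1, e2, e3, List.map_map, List.map_map]
  refine List.map_congr_left fun r _ => ?_
  simp only [Function.comp_apply]
  rw [Raw.bind_map, Raw.map_id]

theorem vhMul_arr {p q : (vObj (vObj (hObj X))).C2} (f : p ⟶ q) :
    vhArr ((vMul (hObj X)).f2.map f) = ((vArr f).map fun a => vhArr a.hom).flatten := by
  rw [vhArr, vMul_arr, List.map_flatMap]
  exact List.flatMap_def ..

theorem mem_vArr_left {p q : (vObj X).C2} (f : p ⟶ q) {a : Arrow X.C2} (h : a ∈ vArr f) :
    a.left ∈ p.tree.leaves := by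
  rw [← LHom.arrows_left (VTree.Hom.hom f)]
  exact List.mem_map_of_mem h

theorem lstrs_length_leaf {p : (vObj (vObj (hObj X))).C2} {q : (vObj (hObj X)).C2}
    (h : q ∈ p.tree.leaves) : (lstrs q).length = ((vObj (vObj (hObj X))).src p).list.length := by
  rw [lstrs_length]
  refine (Raw.leaf_bdry (n := fun r : (hObj X).C1 => ULift.up.{u} r.list.length) ?_ p.ok).2 q h |>
    congrArg ULift.down
  intro b
  rw [← lstrs_length, ← List.length_map (Raw.tgt X.tgt), lstrs_tgt]

theorem lLaw_mul_left (X : Cat2Gph.{v, u}) :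
    vMul (hObj X) ≫ lLaw X = vMap (lLaw X) ≫ lLaw (vObj X) ≫ hMap (vMul X) :=
  hom_ext (fun _ => rfl) (fun p => Str.ext rfl (List.map_id _).symm) fun {p q} f => by
    have e (p : (vObj (vObj (hObj X))).C2) :
        ((vMul (hObj X) ≫ lLaw X).f2.obj p).list.map VTree.tree =
        ((vMap (lLaw X) ≫ lLaw (vObj X) ≫ hMap (vMul X)).f2.obj p).list.map VTree.tree := by
      refine (lList_tree _).trans ((lstrs_mul p).trans ?_)
      rw [← lList_tree, List.map_map]
      exact (List.map_map (l := lList ((vMap (lLaw X)).f2.obj p)) (f := (vMul X).f2.obj)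
        (g := VTree.tree)).symm
    refine hvArrow_ext ?_ (e p) (e q) ?_
    · exact congrArg (fun r : (hObj X).C1 => r.start)
        (((vMul (hObj X)).src_f2 p).trans ((vMap (lLaw X)).src_f2 p).symm)
    · refine (lFun_arr ((vMul (hObj X)).f2.map f)).trans ?_
      have r1 : hvArr ((vMap (lLaw X) ≫ lLaw (vObj X) ≫ hMap (vMul X)).f2.map f) =
          (hvArr ((lFun (vObj X)).map ((vMap (lLaw X)).f2.map f))).map
            fun r => (r.map fun b => vArr b.hom).flatten := by
        refine (congrArg (List.map _) (hMap_arr (vMul X) _)).trans ?_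
        rw [hvArr, List.map_map, List.map_map]
        refine List.map_congr_left fun a _ => ?_
        exact (vMul_arr a.hom).trans (List.flatMap_def ..)
      have r2 : (vhArr ((vMap (lLaw X)).f2.map f)).map (List.map fun b => vArr b.hom) =
          ((vArr f).map fun a => vhArr a.hom).map
            (cols (lstrs ((vMul (hObj X)).f2.obj p)).length) := by
        rw [vhArr, vMap_arr, List.map_map, List.map_map, List.map_map]
        refine List.map_congr_left fun a ha => ?_
        refine (lFun_arr a.hom).trans ?_
        rw [lstrs_length_leaf (mem_vArr_left f ha), lstrs_length, (vMul (hObj X)).src_f2]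
        rfl
      rw [r1, lFun_arr, vhMul_arr, cols_flatten, ← r2, cols_map, List.map_map, lstrs_mul,
        List.length_map]
      rfl

theorem lstrs_hMul (p : (vObj (hObj (hObj X))).C2) :
    lstrs ((vMap (hMul X)).f2.obj p) = (lList p).flatMap lstrs := by
  have e1 := Raw.strs_map
    (k := fun a : (hObj (hObj X)).C1 => a.list.flatMap fun r : (hObj X).C1 => r.list)
    (l := fun a : (hObj (hObj X)).C2 => a.list.flatMap fun r : (hObj X).C2 => r.list)
    (k' := fun a : (hObj X).C1 => a.list) (l' := fun b : (hObj X).C2 => b.list)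
    (f := (hMul X).f1) (g := (hMul X).f2.obj) (f' := fun a => a) (g' := fun b => b)
    (fun _ => (List.map_id _).symm) (fun _ => (List.map_id _).symm) p.tree
  have e2 := Raw.strs_flatMap
    (k := fun a : (hObj (hObj X)).C1 => a.list) (l := fun a : (hObj (hObj X)).C2 => a.list)
    (k' := fun a : (hObj X).C1 => a.list) (l' := fun b : (hObj X).C2 => b.list)
    (σ := (hObj (hObj X)).src) (τ := (hObj (hObj X)).tgt)
    (σ' := (hObj X).src) (τ' := (hObj X).tgt) (σ'' := X.src) (τ'' := X.tgt)
    (fun _ => rfl) (fun _ => rfl) (fun _ => rfl) (fun _ => rfl) p.ok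
  refine e1.trans ?_
  rw [e2]
  refine (List.map_congr_left fun r _ => Raw.map_id r).trans ((List.map_id' _).trans ?_)
  have e3 := lList_tree p
  rw [lstrs] at e3
  rw [← e3, List.flatMap_map]
  rfl

theorem length_hArr {p q : (hObj X).C2} (f : p ⟶ q) : (hArr f).length = p.list.length := by
  rw [hArr, ← List.length_map (fun a : Arrow X.C2 => a.left), LHom.arrows_left]

theorem lLaw_mul_right (X : Cat2Gph.{v, u}) :
    vMap (hMul X) ≫ lLaw X = lLaw (hObj X) ≫ hMap (lLaw X) ≫ hMul (vObj X) :=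
  hom_ext (fun _ => rfl)
    (fun p => Str.ext rfl (congrArg (List.flatMap _) (List.map_id _)).symm) fun {p q} f => by
    have e (p : (vObj (hObj (hObj X))).C2) :
        ((vMap (hMul X) ≫ lLaw X).f2.obj p).list.map VTree.tree =
        ((lLaw (hObj X) ≫ hMap (lLaw X) ≫ hMul (vObj X)).f2.obj p).list.map VTree.tree := by
      refine (lList_tree _).trans ((lstrs_hMul p).trans ?_)
      have e1 : ((lLaw (hObj X) ≫ hMap (lLaw X) ≫ hMul (vObj X)).f2.obj p).list =
        ((lList p).map lObj).flatMap fun q => q.list := rfl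
      rw [e1, List.map_flatMap, List.flatMap_map]
      refine List.flatMap_congr fun a _ => ?_
      exact (lList_tree a).symm
    refine hvArrow_ext ?_ (e p) (e q) ?_
    · exact congrArg (fun r : (hObj X).C1 => r.start) ((vMap (hMul X)).src_f2 p)
    · refine (lFun_arr ((vMap (hMul X)).f2.map f)).trans ?_
      have r1 : hvArr ((lLaw (hObj X) ≫ hMap (lLaw X) ≫ hMul (vObj X)).f2.map f) =
          ((hArr ((lFun (hObj X)).map f)).map fun a => hvArr ((lFun X).map a.hom)).flatten := by
        refine (congrArg (List.map _) (hMul_arr ((hMap (lLaw X)).f2.map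
          ((lFun (hObj X)).map f)))).trans ?_
        rw [hMap_arr, List.flatMap_map, List.map_flatMap]
        exact List.flatMap_def ..
      have r2 : vhArr ((vMap (hMul X)).f2.map f) = ((vArr f).map fun a =>
          (hArr a.hom).map fun b => hArr b.hom).map List.flatten := by
        rw [vhArr, vMap_arr, List.map_map, List.map_map]
        refine List.map_congr_left fun a _ => ?_
        exact (hMul_arr a.hom).trans (List.flatMap_def ..)
      rw [r1, r2, lstrs_hMul, List.length_flatMap]
      refine cols_sum _ _ ?_ _ ?_ ?_
      · intro r hr
        obtain ⟨a, ha, rfl⟩ := List.mem_map.1 hr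
        have w := (Raw.leaf_bdry
          (n := fun r : (hObj (hObj X)).C1 => ULift.up.{u} (r.list.map fun s => s.list.length))
          (σ := (hObj (hObj X)).src) (τ := (hObj (hObj X)).tgt) (fun b => ?_) p.ok).2 a.left
          (mem_vArr_left f ha)
        · have w' := congrArg ULift.down w
          refine Eq.trans ?_ (w'.trans ?_)
          · refine Eq.trans ?_ List.map_map.symm
            rw [List.map_map, ← LHom.arrows_left (Str.Hom.hom a.hom), List.map_map]
            refine List.map_congr_left fun b _ => ?_
            exact (length_hArr b.hom).trans (List.length_map _).symm
          · refine Eq.trans (congrArg (List.map fun s : (hObj X).C1 => s.list.length) (lList_src p).symm) ?_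
            rw [List.map_map]
            refine List.map_congr_left fun b _ => ?_
            exact (lstrs_length b).symm
        · refine congrArg ULift.up ?_
          refine List.map_map.trans (Eq.trans ?_ List.map_map.symm)
          refine List.map_congr_left fun c _ => ?_
          exact (List.length_map _).trans (List.length_map _).symm
      · rw [List.length_map, List.length_map]
        exact length_hArr ((lFun (hObj X)).map f)
      · intro i h h'
        have hi : i < (lList p).length := by simpa using h'
        have e1 : (hArr ((lFun (hObj X)).map f))[i]'(by simpa using h) =
            Arrow.mk (lComp f i hi (lList_length_eq f ▸ hi)) :=
          (List.getElem_of_eq (lFun_hArr f) _).trans (List.getElem_ofFn ..)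
        rw [List.getElem_map, e1]
        refine (lFun_arr (lComp f i hi (lList_length_eq f ▸ hi))).trans ?_
        rw [vhArr, lComp_arr, List.map_flatMap, List.flatMap_map, List.getElem_map]
        congr 1
        refine List.flatMap_congr fun a _ => ?_
        rw [List.getElem?_map]
        cases (hArr a.hom)[i]? <;> rfl

/-- The distributive law of vertical composition over horizontal composition. -/
def interchangeLaw : DistribLaw V.{v, u} H.{v, u} where
  law := { app := lLaw, naturality := fun _ _ => lLaw_naturality }
  law_naturality₂ {_ _ f g} α :=
    conj_of_heq (lLaw_naturality f) (lLaw_naturality g).symm (lLaw_naturality₂ α)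
  unit_left := lLaw_unit_left
  unit_right := lLaw_unit_right
  mul_left := lLaw_mul_left
  mul_right := lLaw_mul_right

end Cat2Gph

/-- The composite 2-monad whose algebras are `HV`-algebras. -/
def HV : TwoMonad Cat2Gph.{v, u} := Cat2Gph.interchangeLaw.composite

/-! ### Doubly-degenerate `Bicat_s`-categories -/

/-- A doubly-degenerate `Bicat_s`-category: an `HV`-algebra with exactly one 0-cell and exactly
one 1-cell. -/
structure DDBicatSCat : Type (max (u + 1) (v + 1)) where
  alg : HV.{v, u}.toMonad.Algebra
  [unique0 : Unique alg.A.C0]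
  [unique1 : Unique alg.A.C1]

namespace DDBicatSCat

attribute [instance] unique0 unique1

variable (X Y : DDBicatSCat.{v, u})

/-- The category of 2-cells and 3-cells. -/
abbrev Carrier : Type u := X.alg.A.C2

/-- Formal vertical composites of 2-cells. -/
abbrev Formal : Type u := Raw X.alg.A.C1 X.Carrier

/-- The action of the 2-monad on hom-categories: evaluation of formal composites. -/
def ev : (HV.obj X.alg.A).C2 ⥤ X.Carrier := X.alg.a.f2

variable {X Y}

theorem isChain {E : Type u} (s t : E → X.alg.A.C0) (a : X.alg.A.C0) (l : List E) :
    IsChain s t a l := by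
  induction l generalizing a with
  | nil => trivial
  | cons e l ih => exact ⟨Subsingleton.elim _ _, ih _⟩

theorem ok {E : Type u} (s t : E → X.alg.A.C1) (r : Raw X.alg.A.C1 E) : r.Ok s t := by
  induction r with
  | one => trivial
  | leaf => trivial
  | comp r r' ih ih' => exact ⟨ih, ih', Subsingleton.elim _ _⟩

/-- A formal vertical composite; well-formedness is automatic. -/
def tree (r : X.Formal) : (Cat2Gph.vObj X.alg.A).C2 := ⟨r, ok _ _ r⟩

/-- A horizontal string of formal vertical composites; well-formedness is automatic. -/
def cell (l : List X.Formal) : (HV.obj X.alg.A).C2 :=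
  Str.mk (default : X.alg.A.C0) (l.map tree) (isChain _ _ _ _)

def treeHom {r r' : X.Formal} (f : LHom r.leaves r'.leaves) : tree r ⟶ tree r' :=
  VTree.Hom.mk (Subsingleton.elim (α := X.alg.A.C1) _ _)
    (Subsingleton.elim (α := X.alg.A.C1) _ _) f

def cellHom {l m : List X.Formal} (f : LHom (l.map tree) (m.map tree)) : cell l ⟶ cell m :=
  Str.Hom.mk (p := cell l) (q := cell m) rfl f

/-- The unique coherence isomorphism between formal vertical composites of the same list of
2-cells. -/
def coh {r r' : X.Formal} (h : r.leaves = r'.leaves) : cell [r] ≅ cell [r'] where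
  hom := cellHom (.cons (treeHom (LHom.cast rfl h (LHom.id _))) .nil)
  inv := cellHom (.cons (treeHom (LHom.cast rfl h.symm (LHom.id _))) .nil)
  hom_inv_id := Str.hom_ext (congrArg (LHom.cons · LHom.nil) (VTree.hom_ext (by
    change LHom.comp (LHom.cast rfl h (LHom.id r.leaves)) (LHom.cast rfl h.symm (LHom.id r'.leaves))
      = LHom.id r.leaves
    generalize r'.leaves = l at h
    subst h
    exact LHom.id_comp _)))
  inv_hom_id := Str.hom_ext (congrArg (LHom.cons · LHom.nil) (VTree.hom_ext (by
    change LHom.comp (LHom.cast rfl h.symm (LHom.id r'.leaves)) (LHom.cast rfl h (LHom.id r.leaves))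
      = LHom.id r'.leaves
    generalize r'.leaves = l at h
    subst h
    exact LHom.id_comp _)))

/-- Vertical composite `a / b`, with `a` on top. -/
def vten (a b : X.Carrier) : X.Carrier := X.ev.obj (cell [.comp (.leaf a) (.leaf b)])

/-- Horizontal composite `a | b`. -/
def hten (a b : X.Carrier) : X.Carrier := X.ev.obj (cell [.leaf a, .leaf b])

variable (X) in
/-- The identity 2-cell, as the empty horizontal composite. -/
def one : X.Carrier := X.ev.obj (cell [])

variable (X) in
/-- The identity 2-cell, as the nullary vertical composite. -/
def vone : X.Carrier := X.ev.obj (cell [.one default])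

def vtenMap {a a' b b' : X.Carrier} (f : a ⟶ a') (g : b ⟶ b') : vten a b ⟶ vten a' b' :=
  X.ev.map (cellHom (.cons (treeHom (.cons f (.cons g .nil))) .nil))

def htenMap {a a' b b' : X.Carrier} (f : a ⟶ a') (g : b ⟶ b') : hten a b ⟶ hten a' b' :=
  X.ev.map (cellHom (.cons (treeHom (.cons f .nil)) (.cons (treeHom (.cons g .nil)) .nil)))

/-! Evaluation of iterated composites -/

theorem str_eq {E : Type u} {s t : E → X.alg.A.C0} {p q : Str s t} (h : p.list = q.list) : p = q :=
  Str.ext (Subsingleton.elim _ _) h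

theorem ev_leaf (a : X.Carrier) : X.ev.obj (cell [.leaf a]) = a := by
  have h := congrArg (fun F : X.alg.A ⟶ X.alg.A => F.f2.obj a) X.alg.unit
  refine Eq.trans (congrArg X.ev.obj ?_) h
  exact str_eq (X := X) rfl

theorem ev_mul (P : (HV.obj (HV.obj X.alg.A)).C2) :
    X.ev.obj ((HV.μ.app X.alg.A).f2.obj P) = X.ev.obj ((HV.map X.alg.a).f2.obj P) :=
  congrArg (fun F : HV.obj (HV.obj X.alg.A) ⟶ X.alg.A => F.f2.obj P) X.alg.assoc

theorem tree_inj {l m : List (Cat2Gph.vObj X.alg.A).C2}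
    (h : l.map VTree.tree = m.map VTree.tree) : l = m := map_tree_inj h

theorem map_tree (l : List X.Formal) : (l.map tree).map VTree.tree = l := by
  rw [List.map_map]; exact List.map_id _

/-- The trees of the multiplication of the composite 2-monad. -/
theorem mul_list (P : (HV.obj (HV.obj X.alg.A)).C2) :
    (Str.list ((HV.μ.app X.alg.A).f2.obj P)).map VTree.tree =
      (Str.list P).flatMap fun q : (Cat2Gph.vObj (HV.obj X.alg.A)).C2 =>
        (Cat2Gph.lstrs (X := Cat2Gph.vObj X.alg.A) q).map (Raw.bind VTree.tree) := by
  have key (L : List (Cat2Gph.vObj (Cat2Gph.hObj (Cat2Gph.vObj X.alg.A))).C2) :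
      ((((L.map Cat2Gph.lObj).map (Cat2Gph.hMap (Cat2Gph.vMul X.alg.A)).f2.obj)).flatMap
        fun q => q.list).map VTree.tree =
      L.flatMap fun q => (Cat2Gph.lstrs q).map (Raw.bind VTree.tree) := by
    rw [List.map_flatMap, List.flatMap_map, List.flatMap_map]
    refine List.flatMap_congr fun q _ => ?_
    rw [← Cat2Gph.lList_tree, List.map_map]
    exact List.map_map
  exact key _

theorem map_list (P : (HV.obj (HV.obj X.alg.A)).C2) :
    (Str.list ((HV.map X.alg.a).f2.obj P)).map VTree.tree =
      (Str.list P).map fun q : (Cat2Gph.vObj (HV.obj X.alg.A)).C2 =>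
        q.tree.map X.alg.a.f1 X.ev.obj :=
  List.map_map

theorem ev_eq {p : (HV.obj X.alg.A).C2} {l : List X.Formal}
    (h : (Str.list p).map VTree.tree = l) : X.ev.obj p = X.ev.obj (cell l) :=
  congrArg X.ev.obj (str_eq (tree_inj (h.trans (map_tree l).symm)))

/-- Evaluation of a string of formal composites of evaluated strings. -/
theorem ev_ev (P : (HV.obj (HV.obj X.alg.A)).C2) {l m : List X.Formal}
    (h : ((Str.list P).map fun q : (Cat2Gph.vObj (HV.obj X.alg.A)).C2 =>
        q.tree.map X.alg.a.f1 X.ev.obj) = l)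
    (h' : ((Str.list P).flatMap fun q : (Cat2Gph.vObj (HV.obj X.alg.A)).C2 =>
        (Cat2Gph.lstrs (X := Cat2Gph.vObj X.alg.A) q).map (Raw.bind VTree.tree)) = m) :
    X.ev.obj (cell l) = X.ev.obj (cell m) :=
  (ev_eq ((map_list P).trans h)).symm.trans ((ev_mul P).symm.trans (ev_eq ((mul_list P).trans h')))

theorem bdry_eq {l m : List X.Formal} (h : l.length = m.length) :
    (HV.obj X.alg.A).tgt (cell l) = (HV.obj X.alg.A).src (cell m) := by
  refine Str.ext (Subsingleton.elim (α := X.alg.A.C0) _ _) ?_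
  refine List.ext_getElem ?_ fun _ _ _ => Subsingleton.elim (α := X.alg.A.C1) _ _
  change ((l.map tree).map _).length = ((m.map tree).map _).length
  exact (List.length_map _).trans ((List.length_map _).trans (h.trans
    ((List.length_map _).trans (List.length_map _)).symm))

/-- Vertical composites of evaluated strings. -/
theorem vten_ev (l m : List X.Formal) (h : l.length = m.length) :
    vten (X.ev.obj (cell l)) (X.ev.obj (cell m)) = X.ev.obj (cell (List.zipWith .comp l m)) := by
  have e (l : List X.Formal) : ((l.map tree).map Raw.leaf).map (Raw.bind VTree.tree) = l := by
    rw [List.map_map, List.map_map]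
    exact List.map_id _
  refine ev_ev (Str.mk (O := X.alg.A.C0) default
    [⟨.comp (.leaf (cell l)) (.leaf (cell m)), trivial, trivial, bdry_eq h⟩]
    (isChain _ _ _ _)) rfl ?_
  refine (List.flatMap_singleton _ _).trans ?_
  change (List.zipWith Raw.comp ((l.map tree).map Raw.leaf) ((m.map tree).map Raw.leaf)).map _ = _
  rw [List.map_zipWith]
  conv_rhs => rw [← e l, ← e m, List.zipWith_map]
  rfl

/-- Horizontal composites of evaluated strings. -/
theorem hten_ev (l m : List X.Formal) :
    hten (X.ev.obj (cell l)) (X.ev.obj (cell m)) = X.ev.obj (cell (l ++ m)) := by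
  have e (l : List X.Formal) : ((l.map tree).map Raw.leaf).map (Raw.bind VTree.tree) = l := by
    rw [List.map_map, List.map_map]
    exact List.map_id _
  refine ev_ev (Str.mk (O := X.alg.A.C0) default
    [⟨.leaf (cell l), trivial⟩, ⟨.leaf (cell m), trivial⟩] (isChain _ _ _ _)) rfl ?_
  change ((l.map tree).map Raw.leaf).map (Raw.bind VTree.tree) ++
    (((m.map tree).map Raw.leaf).map (Raw.bind VTree.tree) ++ []) = _
  rw [e, e, List.append_nil]

variable (X) in
theorem vone_eq : X.vone = X.one := by
  refine Eq.trans (congrArg (fun f => X.ev.obj (cell [.one f])) (Subsingleton.elim _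
    (X.alg.a.f1 (Str.mk (default : X.alg.A.C0) [] trivial)))) ?_
  exact ev_ev (Str.mk (O := X.alg.A.C0) default
    [⟨.one (Str.mk (default : X.alg.A.C0) [] trivial), trivial⟩] (isChain _ _ _ _)) rfl rfl

/-! Structure isomorphisms and equalities -/

section
variable (a b c d : X.Carrier)

theorem vten_left : vten (vten a b) c =
    X.ev.obj (cell [.comp (.comp (.leaf a) (.leaf b)) (.leaf c)]) :=
  (congrArg (vten _) (ev_leaf c).symm).trans (vten_ev _ [_] rfl)

theorem vten_right : vten a (vten b c) =
    X.ev.obj (cell [.comp (.leaf a) (.comp (.leaf b) (.leaf c))]) :=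
  (congrArg (vten · _) (ev_leaf a).symm).trans (vten_ev [_] _ rfl)

theorem vten_one_left : vten X.one a = X.ev.obj (cell [.comp (.one default) (.leaf a)]) :=
  (congrArg₂ vten X.vone_eq.symm (ev_leaf a).symm).trans (vten_ev [_] [_] rfl)

theorem vten_one_right : vten a X.one = X.ev.obj (cell [.comp (.leaf a) (.one default)]) :=
  (congrArg₂ vten (ev_leaf a).symm X.vone_eq.symm).trans (vten_ev [_] [_] rfl)

/-- Vertical associativity. -/
def vassoc : vten (vten a b) c ≅ vten a (vten b c) :=
  eqToIso (vten_left a b c) ≪≫ X.ev.mapIso (coh (r := .comp (.comp (.leaf a) (.leaf b)) (.leaf c))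
    (r' := .comp (.leaf a) (.comp (.leaf b) (.leaf c))) rfl) ≪≫ eqToIso (vten_right a b c).symm

/-- Vertical unit isomorphism, with the unit on top. -/
def vtop : vten X.one a ≅ a :=
  eqToIso (vten_one_left a) ≪≫
    X.ev.mapIso (coh (r := .comp (.one default) (.leaf a)) (r' := .leaf a) rfl) ≪≫ eqToIso (ev_leaf a)

/-- Vertical unit isomorphism, with the unit at the bottom. -/
def vbot : vten a X.one ≅ a :=
  eqToIso (vten_one_right a) ≪≫
    X.ev.mapIso (coh (r := .comp (.leaf a) (.one default)) (r' := .leaf a) rfl) ≪≫ eqToIso (ev_leaf a)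

theorem hten_assoc : hten (hten a b) c = hten a (hten b c) :=
  ((congrArg (hten _) (ev_leaf c).symm).trans (hten_ev [_, _] [_])).trans
    ((congrArg (hten · _) (ev_leaf a).symm).trans (hten_ev [_] [_, _])).symm

theorem hten_one_left : hten X.one a = a :=
  ((congrArg (hten _) (ev_leaf a).symm).trans (hten_ev [] [_])).trans (ev_leaf a)

theorem hten_one_right : hten a X.one = a :=
  ((congrArg (hten · _) (ev_leaf a).symm).trans (hten_ev [_] [])).trans (ev_leaf a)

/-- Strict interchange for a `2 × 2` grid with rows `a | b` and `c | d`. -/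
theorem interchange : vten (hten a b) (hten c d) = hten (vten a c) (vten b d) :=
  (vten_ev [.leaf a, .leaf b] [.leaf c, .leaf d] rfl).trans
    (hten_ev [.comp (.leaf a) (.leaf c)] [.comp (.leaf b) (.leaf d)]).symm

end

end DDBicatSCat

/-! ### Monoidal functors and weak maps -/

open DDBicatSCat

variable (X Y : DDBicatSCat.{v, u})

/-- A functor with vertical, horizontal and unit comparison isomorphisms. -/
@[ext] structure MapData where
  F : X.Carrier ⥤ Y.Carrier
  v (a b : X.Carrier) : vten (F.obj a) (F.obj b) ≅ F.obj (vten a b)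
  h (a b : X.Carrier) : hten (F.obj a) (F.obj b) ≅ F.obj (hten a b)
  η : Y.one ≅ F.obj X.one

variable {X Y}

/-- The axioms: naturality, the monoidal functor axioms for the vertical structure (with unit
constraint `η`), the monoidal functor axioms for the strict horizontal structure (with the same
unit constraint `η`), and the interaction axiom for `2 × 2` grids. -/
structure MapData.IsMonoidal (D : MapData X Y) : Prop where
  v_natural {a a' b b' : X.Carrier} (f : a ⟶ a') (g : b ⟶ b') :
    vtenMap (D.F.map f) (D.F.map g) ≫ (D.v a' b').hom = (D.v a b).hom ≫ D.F.map (vtenMap f g)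
  h_natural {a a' b b' : X.Carrier} (f : a ⟶ a') (g : b ⟶ b') :
    htenMap (D.F.map f) (D.F.map g) ≫ (D.h a' b').hom = (D.h a b).hom ≫ D.F.map (htenMap f g)
  v_assoc (a b c : X.Carrier) :
    vtenMap (D.v a b).hom (𝟙 (D.F.obj c)) ≫ (D.v (vten a b) c).hom ≫ D.F.map (vassoc a b c).hom =
      (vassoc _ _ _).hom ≫ vtenMap (𝟙 (D.F.obj a)) (D.v b c).hom ≫ (D.v a (vten b c)).hom
  v_top (a : X.Carrier) :
    vtenMap D.η.hom (𝟙 (D.F.obj a)) ≫ (D.v X.one a).hom ≫ D.F.map (vtop a).hom = (vtop _).hom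
  v_bot (a : X.Carrier) :
    vtenMap (𝟙 (D.F.obj a)) D.η.hom ≫ (D.v a X.one).hom ≫ D.F.map (vbot a).hom = (vbot _).hom
  h_assoc (a b c : X.Carrier) :
    htenMap (D.h a b).hom (𝟙 (D.F.obj c)) ≫ (D.h (hten a b) c).hom ≫
        D.F.map (eqToHom (hten_assoc a b c)) =
      eqToHom (hten_assoc _ _ _) ≫ htenMap (𝟙 (D.F.obj a)) (D.h b c).hom ≫ (D.h a (hten b c)).hom
  h_left (a : X.Carrier) :
    htenMap D.η.hom (𝟙 (D.F.obj a)) ≫ (D.h X.one a).hom ≫ D.F.map (eqToHom (hten_one_left a)) =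
      eqToHom (hten_one_left _)
  h_right (a : X.Carrier) :
    htenMap (𝟙 (D.F.obj a)) D.η.hom ≫ (D.h a X.one).hom ≫ D.F.map (eqToHom (hten_one_right a)) =
      eqToHom (hten_one_right _)
  interaction (a b c d : X.Carrier) :
    vtenMap (D.h a b).hom (D.h c d).hom ≫ (D.v (hten a b) (hten c d)).hom ≫
        D.F.map (eqToHom (interchange a b c d)) =
      eqToHom (interchange _ _ _ _) ≫ htenMap (D.v a c).hom (D.v b d).hom ≫
        (D.h (vten a c) (vten b d)).hom

/-- The natural isomorphism on hom-categories underlying an invertible iconic 2-cell. -/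
def Cat2Gph.natIso {A B : Cat2Gph.{v, u}} {F G : A ⟶ B} (e : F ≅ G) : F.f2 ≅ G.f2 where
  hom := e.hom.nat
  inv := e.inv.nat
  hom_inv_id := congrArg Cat2Gph.Hom₂.nat e.hom_inv_id
  inv_hom_id := congrArg Cat2Gph.Hom₂.nat e.inv_hom_id

namespace WeakMap

variable (w : WeakMap HV X.alg Y.alg)

/-- The underlying functor. -/
def functor : X.Carrier ⥤ Y.Carrier := w.f.f2

theorem map_cell (l : List X.Formal) :
    Y.ev.obj ((HV.map w.f).f2.obj (cell l)) =
      Y.ev.obj (cell (l.map (Raw.map w.f.f1 w.functor.obj))) :=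
  ev_eq (by
    refine (List.map_map.trans List.map_map).trans ?_
    rfl)

/-- The constraint of a weak map at a formal composite: the composite in `Y` of the images of the
constituents is isomorphic to the image of the composite in `X`. -/
def constraint (l : List X.Formal) :
    Y.ev.obj (cell (l.map (Raw.map w.f.f1 w.functor.obj))) ≅ w.functor.obj (X.ev.obj (cell l)) :=
  eqToIso (w.map_cell l).symm ≪≫ (Cat2Gph.natIso w.φ).app (cell l)

/-- The vertical binary, horizontal binary and horizontal nullary constraints of a weak map. -/
def toMapData : MapData X Y where
  F := w.functor
  v a b := w.constraint [.comp (.leaf a) (.leaf b)]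
  h a b := w.constraint [.leaf a, .leaf b]
  η := w.constraint []

/-- The vertical nullary constraint of a weak map. -/
def vunit : Y.vone ≅ w.functor.obj X.vone :=
  eqToIso (congrArg (fun f => Y.ev.obj (cell [.one f])) (Subsingleton.elim _ _)) ≪≫
    w.constraint [.one default]

end WeakMap

end BicatS

end

/-! A 2-cell of `HV X` is a horizontal string of formal vertical composites (trees), and a 3-cell
between two such strings lists one 3-cell of `X` for each leaf. A weak map is thus a functor with a
family of constraints, one for each string of trees, natural in these 3-cells and compatible with
the unit and multiplication of the monad. The binary and nullary constraints generate this family,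
and axioms 1–3 are what makes the generated family natural and multiplicative.

Given a weak map, the multiplication axiom says that the constraint at a flattened composite is the
composite of the constraints at the pieces, followed by the constraint at the composite of their
values. It is applied to two stacked strings of equal length (`constraint_comp`), to two strings
side by side (`constraint_append`), and to the nullary vertical composite over the empty string
(`constraint_one`). The last case identifies the two unit constraints. Together with the unit axiom
these formulas express every constraint through `v`, `h` and `η` (`constraint_list`), hence
uniqueness. The horizontal axioms arise by splitting one string in two ways, the interaction axiom
by splitting a 2 × 2 grid into rows or into columns, and the vertical axioms by naturality with
respect to the coherence 3-cells.

Conversely, `v`, `h` and `η` define a candidate constraint `listCon` at every string, and two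
properties need proof. The first is naturality. Besides leafwise 3-cells, `HV X` contains a
coherence 3-cell between any two trees with the same leaves. As in Mac Lane's coherence theorem,
each tree is connected to a right-bracketed normal form by associativity and unit cells, for which
naturality is axiom 1. Every 3-cell between trees factors through the normal forms (`natural`), and
strings follow by naturality of `h` (`strCon_natural`).

The second property is the multiplication axiom. Flattening a vertical composite of strings works
column by column, so the interaction axiom is needed for grids with two rows and any number of
columns (`listCon_zipWith`). The case of no columns is a nullary interaction law, which is not
assumed: it follows from the vertical unit axiom because the vertical unit isomorphism at `1` is an
identity (`vtop_one`, `unit_interaction`). Nullary vertical composites are handled by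
`listCon_replicate` and concatenation of strings by `listCon_append`; the result is
`listCon_flatMap`.

The strict laws are propositional equalities of objects, so most equations relate morphisms with
different endpoints. They are compared as objects of the arrow category by `Same`, for which every
`eqToHom` can be absorbed. -/

noncomputable section

namespace BicatS

/-! ### Equality of morphisms up to equality of their ends -/

/-- Morphisms which are equal up to equalities of their sources and targets. -/
def Same {C : Type u} [Category.{v} C] {a b a' b' : C} (f : a ⟶ b) (g : a' ⟶ b') : Prop :=
  Arrow.mk f = Arrow.mk g

local infix:50 " ≋ " => Same

namespace Same

variable {C : Type u} [Category.{v} C] {D : Type u} [Category.{v} D]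
  {a b c a' b' c' a'' b'' : C}

theorem refl (f : a ⟶ b) : f ≋ f := Eq.refl _

theorem of_eq {f g : a ⟶ b} (h : f = g) : f ≋ g := congrArg Arrow.mk h

theorem symm {f : a ⟶ b} {g : a' ⟶ b'} (h : f ≋ g) : g ≋ f := Eq.symm h

theorem trans {f : a ⟶ b} {g : a' ⟶ b'} {k : a'' ⟶ b''} (h : f ≋ g) (h' : g ≋ k) : f ≋ k :=
  Eq.trans h h'

theorem eq {f g : a ⟶ b} (h : f ≋ g) : f = g := Arrow.mk_injective _ _ h

theorem left {f : a ⟶ b} {g : a' ⟶ b'} (h : f ≋ g) : a = a' :=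
  congrArg (fun x : Arrow C => x.left) h

theorem right {f : a ⟶ b} {g : a' ⟶ b'} (h : f ≋ g) : b = b' :=
  congrArg (fun x : Arrow C => x.right) h

/-- The equalities of endpoints are contained in the hypotheses, so composites can be rewritten
factor by factor without tracking transports. -/
theorem comp {f : a ⟶ b} {g : b ⟶ c} {f' : a' ⟶ b'} {g' : b' ⟶ c'} (h : f ≋ f') (h' : g ≋ g') :
    f ≫ g ≋ f' ≫ g' := by
  obtain rfl := h.left
  obtain rfl := h.right
  obtain rfl := h'.right
  rw [h.eq, h'.eq]
  rfl

theorem map (F : C ⥤ D) {f : a ⟶ b} {g : a' ⟶ b'} (h : f ≋ g) : F.map f ≋ F.map g :=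
  congrArg (fun x : Arrow C => Arrow.mk (F.map x.hom)) h

theorem id_congr (h : a = a') : 𝟙 a ≋ 𝟙 a' := by subst h; exact refl _

theorem eqToHom (h : a = a') : eqToHom h ≋ 𝟙 a := by subst h; exact refl _

theorem eqToHom_comp (h : a = b) (f : b ⟶ c) : CategoryTheory.eqToHom h ≫ f ≋ f := by
  subst h; exact of_eq (Category.id_comp f)

theorem conj (h : a = b) (f : b ⟶ c) (h' : c = c') :
    CategoryTheory.eqToHom h ≫ f ≫ CategoryTheory.eqToHom h' ≋ f := by
  subst h h'; exact of_eq ((Category.id_comp _).trans (Category.comp_id f))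

/-- Cancellation of an identity on the left. -/
theorem id_comp {i : a ⟶ b} (h : i ≋ 𝟙 a') (f : b ⟶ c) : i ≫ f ≋ f := by
  obtain rfl := h.left
  obtain rfl := h.right
  rw [h.eq, Category.id_comp]
  exact refl _

/-- Cancellation of an identity on the right. -/
theorem comp_id (f : a ⟶ b) {i : b ⟶ c} (h : i ≋ 𝟙 c') : f ≫ i ≋ f := by
  obtain rfl := h.left
  obtain rfl := h.right
  rw [h.eq, Category.comp_id]
  exact refl _

end Same

/-! ### Evaluation of 3-cells -/

namespace DDBicatSCat

open Cat2Gph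

variable {X : DDBicatSCat.{v, u}}

/-- The list of formal vertical composites in a horizontal string. -/
def trees (p : (HV.obj X.alg.A).C2) : List X.Formal := (Str.list p).map VTree.tree

/-- The components of a 3-cell between horizontal strings of formal vertical composites. -/
def comps {p q : (HV.obj X.alg.A).C2} (f : p ⟶ q) : List (List (Arrow X.Carrier)) :=
  hvArr (X := X.alg.A) f

theorem trees_cell (l : List X.Formal) : trees (cell l) = l := map_tree l

theorem cell_trees (p : (HV.obj X.alg.A).C2) : cell (trees p) = p :=
  str_eq (tree_inj (map_tree _))

/-- The remaining data of a string is its starting 0-cell, which is unique, and boundary conditions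
are propositions. Equations between 3-cells of `HV X` thereby become equations between lists. -/
theorem same_of_comps {p q p' q' : (HV.obj X.alg.A).C2} {f : p ⟶ q} {g : p' ⟶ q'}
    (hp : trees p = trees p') (hq : trees q = trees q') (h : comps f = comps g) : f ≋ g :=
  hvArrow_ext (X := X.alg.A) (Subsingleton.elim (α := X.alg.A.C0) _ _) hp hq h

theorem comps_id (p : (HV.obj X.alg.A).C2) :
    comps (𝟙 p) = (trees p).map fun r => r.leaves.map fun a => Arrow.mk (𝟙 a) := by
  have key (p : (hObj (vObj X.alg.A)).C2) : hvArr (𝟙 p) =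
      (p.list.map VTree.tree).map fun r => r.leaves.map fun a => Arrow.mk (𝟙 a) := by
    refine (congrArg (List.map _) (LHom.arrows_id p.list)).trans ?_
    rw [List.map_map, List.map_map]
    refine List.map_congr_left fun r _ => ?_
    exact LHom.arrows_id _
  exact key p

theorem length_comps {p q : (HV.obj X.alg.A).C2} (f : p ⟶ q) :
    (comps f).length = (trees p).length := by
  have key {p q : (hObj (vObj X.alg.A)).C2} (f : p ⟶ q) :
      (hvArr f).length = (p.list.map VTree.tree).length := by
    rw [hvArr, List.length_map, List.length_map, length_hArr]
  exact key f

/-- A 3-cell preserves the source 1-cell, which is a string with one entry for each tree. -/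
theorem length_trees_eq {p q : (HV.obj X.alg.A).C2} (f : p ⟶ q) :
    (trees p).length = (trees q).length := by
  have key {p q : (hObj (vObj X.alg.A)).C2} (f : p ⟶ q) :
      (p.list.map VTree.tree).length = (q.list.map VTree.tree).length := by
    have := congrArg (fun r : Str _ _ => r.list.length) ((hObj (vObj X.alg.A)).src_eq f)
    simpa [Str.map] using this
  exact key f

/-- This is associativity of the algebra. It is an equality of 1-cells, so on 3-cells it also
changes the endpoints. -/
theorem ev_map_mul {P Q : (HV.obj (HV.obj X.alg.A)).C2} (f : P ⟶ Q) :
    X.ev.map ((HV.μ.app X.alg.A).f2.map f) ≋ X.ev.map ((HV.map X.alg.a).f2.map f) :=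
  congrArg (fun F : HV.obj (HV.obj X.alg.A) ⟶ X.alg.A => Arrow.mk (F.f2.map f)) X.alg.assoc

/-! ### Columns of vertical composites of strings, and evaluation of the corresponding 3-cells. -/

/-- Formal vertical composites of horizontal strings of formal vertical composites. -/
abbrev VCell (X : DDBicatSCat.{v, u}) := (vObj (HV.obj X.alg.A)).C2

/-- The columns of a vertical composite of horizontal strings of vertical composites. -/
def columns (q : Raw (HV.obj X.alg.A).C1 (HV.obj X.alg.A).C2) : List X.Formal :=
  (q.strs (fun a : (hObj (vObj X.alg.A)).C1 => a.list)
    (fun b : (hObj (vObj X.alg.A)).C2 => b.list)).map (Raw.bind VTree.tree)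

/-- The vertical composite of evaluated strings. -/
def evTree (q : Raw (HV.obj X.alg.A).C1 (HV.obj X.alg.A).C2) : X.Formal :=
  q.map X.alg.a.f1 X.ev.obj

theorem trees_mul (P : (HV.obj (HV.obj X.alg.A)).C2) :
    trees ((HV.μ.app X.alg.A).f2.obj P) =
      (Str.list P).flatMap fun q : VCell X => columns q.tree := mul_list P

theorem trees_map (P : (HV.obj (HV.obj X.alg.A)).C2) :
    trees ((HV.map X.alg.a).f2.obj P) = (Str.list P).map fun q : VCell X => evTree q.tree :=
  map_list P

/-- The multiplication of `HV` applies the interchange law and then flattens in both directions. On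
components the interchange law is the transposition `cols`, vertical flattening joins the lists
inside each column, and horizontal flattening is the outer `flatMap`. -/
theorem comps_mul {P Q : (HV.obj (HV.obj X.alg.A)).C2} (f : P ⟶ Q) :
    comps ((HV.μ.app X.alg.A).f2.map f) =
      (hArr (X := vObj (HV.obj X.alg.A)) f).flatMap fun b =>
        (cols (columns b.left.tree).length
          ((vArr (X := HV.obj X.alg.A) b.hom).map fun c => comps c.hom)).map List.flatten := by
  have key {P Q : (hObj (vObj (hObj (vObj X.alg.A)))).C2} (f : P ⟶ Q) :
      hvArr ((hMul (vObj X.alg.A)).f2.map ((hMap (hMap (vMul X.alg.A))).f2.map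
        ((hMap (lLaw (vObj X.alg.A))).f2.map f))) =
      (hArr f).flatMap fun b => (cols (lstrs (X := vObj X.alg.A) b.left).length
        ((vArr b.hom).map fun c => hvArr c.hom)).map List.flatten := by
    rw [hvArr, hMul_arr, hMap_arr, hMap_arr, List.map_flatMap, List.map_map, List.flatMap_map]
    refine List.flatMap_congr fun b _ => ?_
    refine (congrArg (List.map fun a => vArr a.hom) (hMap_arr (vMul X.alg.A)
      ((lFun (vObj X.alg.A)).map b.hom))).trans ?_
    have e : ((vArr b.hom).map fun c => hvArr c.hom) =
        (vhArr b.hom).map (List.map fun a => vArr a.hom) := by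
      rw [vhArr, List.map_map]; rfl
    rw [e, cols_map, ← lFun_arr b.hom, hvArr, List.map_map, List.map_map, List.map_map]
    refine List.map_congr_left fun a _ => ?_
    exact (vMul_arr a.hom).trans (List.flatMap_def ..)
  refine (key f).trans ?_
  refine List.flatMap_congr fun b _ => ?_
  rw [columns, List.length_map]
  rfl

theorem comps_map {P Q : (HV.obj (HV.obj X.alg.A)).C2} (f : P ⟶ Q) :
    comps ((HV.map X.alg.a).f2.map f) = (hArr (X := vObj (HV.obj X.alg.A)) f).map fun b =>
      (vArr (X := HV.obj X.alg.A) b.hom).map fun c => Arrow.mk (X.ev.map c.hom) := by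
  refine (hvArr_map (X := HV.obj X.alg.A) X.alg.a f).trans ?_
  exact List.map_map

/-- Evaluation of a 3-cell between strings of formal composites of evaluated strings. -/
theorem ev_same {P Q : (HV.obj (HV.obj X.alg.A)).C2} (f : P ⟶ Q)
    {p q p' q' : (HV.obj X.alg.A).C2} {k : p ⟶ q} {k' : p' ⟶ q'}
    (hp : ((Str.list P).flatMap fun q : VCell X => columns q.tree) = trees p)
    (hq : ((Str.list Q).flatMap fun q : VCell X => columns q.tree) = trees q)
    (hk : ((hArr (X := vObj (HV.obj X.alg.A)) f).flatMap fun b =>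
        (cols (columns b.left.tree).length
          ((vArr (X := HV.obj X.alg.A) b.hom).map fun c => comps c.hom)).map List.flatten) =
      comps k)
    (hp' : ((Str.list P).map fun q : VCell X => evTree q.tree) = trees p')
    (hq' : ((Str.list Q).map fun q : VCell X => evTree q.tree) = trees q')
    (hk' : ((hArr (X := vObj (HV.obj X.alg.A)) f).map fun b =>
      (vArr (X := HV.obj X.alg.A) b.hom).map fun c => Arrow.mk (X.ev.map c.hom)) = comps k') :
    X.ev.map k ≋ X.ev.map k' :=
  (Same.map X.ev (same_of_comps ((trees_mul P).trans hp) ((trees_mul Q).trans hq)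
      ((comps_mul f).trans hk))).symm.trans ((ev_map_mul f).trans
    (Same.map X.ev (same_of_comps ((trees_map P).trans hp') ((trees_map Q).trans hq')
      ((comps_map f).trans hk'))))

theorem columns_leaf (p : (HV.obj X.alg.A).C2) : columns (.leaf p) = trees p := by
  refine List.map_map.trans ?_
  rfl

theorem columns_comp (q q' : Raw (HV.obj X.alg.A).C1 (HV.obj X.alg.A).C2) :
    columns (.comp q q') = List.zipWith .comp (columns q) (columns q') := by
  refine (List.map_zipWith ..).trans ?_
  rw [columns, columns, List.zipWith_map]
  rfl

/-- The interchange law turns the unit on a string of 1-cells into a string of units, and all their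
labels coincide because there is one 1-cell. -/
theorem columns_one (f : (HV.obj X.alg.A).C1) :
    columns (.one f) = List.replicate (Str.list f).length (.one default) := by
  refine (List.map_map.trans ?_).trans (List.map_const' ..)
  refine List.map_congr_left fun r _ => ?_
  exact congrArg Raw.one (Subsingleton.elim (α := X.alg.A.C1) _ _)

/-- There is one column for each 1-cell in the boundary. Matching boundaries of vertically composed
strings thus become equal numbers of columns. -/
theorem length_columns_src (q : VCell X) :
    (columns q.tree).length = (Str.list ((vObj (HV.obj X.alg.A)).src q)).length := by
  rw [columns, List.length_map]
  exact lstrs_length (X := vObj X.alg.A) q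

theorem length_columns_tgt (q : VCell X) :
    (columns q.tree).length = (Str.list ((vObj (HV.obj X.alg.A)).tgt q)).length := by
  rw [columns, List.length_map]
  exact (List.length_map _).symm.trans (congrArg List.length (lstrs_tgt (X := vObj X.alg.A) q))

/-- With one 0-cell and one 1-cell, a string of 1-cells carries no information beyond its length. -/
theorem c1_ext {f g : (HV.obj X.alg.A).C1} (h : (Str.list f).length = (Str.list g).length) :
    f = g :=
  Str.ext (Subsingleton.elim (α := X.alg.A.C0) _ _)
    (List.ext_getElem h fun _ _ _ => Subsingleton.elim (α := X.alg.A.C1) _ _)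

theorem flatten_cols_single {α : Type w} (M : List (List α)) :
    (cols M.length [M]).map List.flatten = M := by
  rw [cols_single, List.map_map]
  exact (List.map_congr_left fun a _ => by simp).trans (List.map_id _)

theorem flatten_cols_pair {α : Type w} (M N : List (List α)) (h : N.length = M.length) :
    (cols M.length [M, N]).map List.flatten = List.zipWith (· ++ ·) M N := by
  apply List.ext_getElem
  · simp [h]
  · intro i h1 h2
    simp only [List.length_map, length_cols] at h1
    rw [List.getElem_map, getElem_cols]
    simp [h1, h]

theorem tgt_leaf_length (p : (HV.obj X.alg.A).C2) :
    (Str.list ((HV.obj X.alg.A).tgt p)).length = (trees p).length :=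
  (length_columns_tgt ⟨.leaf p, trivial⟩).symm.trans (congrArg List.length (columns_leaf p))

theorem src_leaf_length (p : (HV.obj X.alg.A).C2) :
    (Str.list ((HV.obj X.alg.A).src p)).length = (trees p).length :=
  (length_columns_src ⟨.leaf p, trivial⟩).symm.trans (congrArg List.length (columns_leaf p))

/-- Horizontal composites of evaluated 3-cells. -/
theorem htenMap_ev {p p' q q' r r' : (HV.obj X.alg.A).C2} (f : p ⟶ p') (g : q ⟶ q') (k : r ⟶ r')
    (hr : trees r = trees p ++ trees q) (hr' : trees r' = trees p' ++ trees q')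
    (hk : comps k = comps f ++ comps g) :
    htenMap (X.ev.map f) (X.ev.map g) ≋ X.ev.map k := by
  -- The 3-cell of `HVHV` used here is a string of two one-leaf composites. Flattening concatenates
  -- the two strings, evaluating the leaves first gives the horizontal product, and associativity of
  -- the algebra equates the results.
  let L (p : (HV.obj X.alg.A).C2) : VCell X := ⟨.leaf p, trivial⟩
  let M {p p' : (HV.obj X.alg.A).C2} (f : p ⟶ p') : L p ⟶ L p' :=
    VTree.Hom.mk ((HV.obj X.alg.A).src_eq f) ((HV.obj X.alg.A).tgt_eq f) (.cons f .nil)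
  let P (p q : (HV.obj X.alg.A).C2) : (HV.obj (HV.obj X.alg.A)).C2 :=
    Str.mk (O := X.alg.A.C0) default [L p, L q] (isChain _ _ _ _)
  let F : P p q ⟶ P p' q' := Str.Hom.mk (p := P p q) (q := P p' q') rfl
    (.cons (M f) (.cons (M g) .nil))
  have e (p q : (HV.obj X.alg.A).C2) : (Str.list (P p q)).flatMap
      (fun q : VCell X => columns q.tree) = trees p ++ trees q := by
    change columns (.leaf p) ++ (columns (.leaf q) ++ []) = _
    rw [columns_leaf, columns_leaf, List.append_nil]
  refine (ev_same F ((e _ _).trans hr.symm) ((e _ _).trans hr'.symm) ?_ rfl rfl rfl).symm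
  rw [hk]
  change (cols (columns (.leaf p)).length [comps f]).map List.flatten ++
    ((cols (columns (.leaf q)).length [comps g]).map List.flatten ++ []) = _
  rw [columns_leaf, columns_leaf, ← length_comps f, ← length_comps g, flatten_cols_single,
    flatten_cols_single, List.append_nil]

/-- Vertical composites of evaluated 3-cells. -/
theorem vtenMap_ev {p p' q q' r r' : (HV.obj X.alg.A).C2} (f : p ⟶ p') (g : q ⟶ q') (k : r ⟶ r')
    (hpq : (trees p).length = (trees q).length)
    (hr : trees r = List.zipWith .comp (trees p) (trees q))
    (hr' : trees r' = List.zipWith .comp (trees p') (trees q'))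
    (hk : comps k = List.zipWith (· ++ ·) (comps f) (comps g)) :
    vtenMap (X.ev.map f) (X.ev.map g) ≋ X.ev.map k := by
  have hpq' : (trees p').length = (trees q').length :=
    (length_trees_eq f).symm.trans (hpq.trans (length_trees_eq g))
  -- Now a single binary vertical composite is used. It is well formed when the target of `p` is the
  -- source of `q`, which by `c1_ext` is the equality of lengths.
  let L (p q : (HV.obj X.alg.A).C2) (h : (trees p).length = (trees q).length) : VCell X :=
    ⟨.comp (.leaf p) (.leaf q), trivial, trivial,
      c1_ext ((tgt_leaf_length p).trans (h.trans (src_leaf_length q).symm))⟩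
  let M : L p q hpq ⟶ L p' q' hpq' :=
    VTree.Hom.mk ((HV.obj X.alg.A).src_eq f) ((HV.obj X.alg.A).tgt_eq g)
      (.cons f (.cons g .nil))
  let P (l : VCell X) : (HV.obj (HV.obj X.alg.A)).C2 :=
    Str.mk (O := X.alg.A.C0) default [l] (isChain _ _ _ _)
  let F : P (L p q hpq) ⟶ P (L p' q' hpq') :=
    Str.Hom.mk (p := P (L p q hpq)) (q := P (L p' q' hpq')) rfl (.cons M .nil)
  have e (p q : (HV.obj X.alg.A).C2) (h : (trees p).length = (trees q).length) :
      (Str.list (P (L p q h))).flatMap (fun q : VCell X => columns q.tree) =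
        List.zipWith .comp (trees p) (trees q) := by
    change columns (.comp (.leaf p) (.leaf q)) ++ [] = _
    rw [columns_comp, columns_leaf, columns_leaf, List.append_nil]
  refine (ev_same F ((e p q hpq).trans hr.symm) ((e p' q' hpq').trans hr'.symm) ?_
    rfl rfl rfl).symm
  rw [hk]
  change (cols (columns (.comp (.leaf p) (.leaf q))).length [comps f, comps g]).map List.flatten ++
    [] = _
  rw [columns_comp, columns_leaf, columns_leaf, List.length_zipWith, ← hpq, min_self,
    ← length_comps f, flatten_cols_pair, List.append_nil]
  rw [length_comps, length_comps, hpq]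

/-- The `i`-th column is obtained by grafting the `i`-th tree of every leaf of `q`, so its leaves
are those of the grafted trees in order. This is how the components of flattened coherence cells are
computed. -/
theorem leaves_columns (q : VCell X) (i : ℕ) (h : i < (columns q.tree).length) :
    (columns q.tree)[i].leaves =
      q.tree.leaves.flatMap fun c => ((trees c)[i]?.toList).flatMap Raw.leaves := by
  have key (q : (vObj (hObj (vObj X.alg.A))).C2)
      (h : i < ((lstrs q).map (Raw.bind VTree.tree)).length) :
      ((lstrs q).map (Raw.bind VTree.tree))[i].leaves =
      q.tree.leaves.flatMap fun c : (hObj (vObj X.alg.A)).C2 =>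
        (((c.list.map VTree.tree))[i]?.toList).flatMap Raw.leaves := by
    rw [List.getElem_map, Raw.leaves_bind]
    refine (congrArg (List.flatMap _) (Raw.leaves_strs _ _ _)).trans ?_
    rw [List.flatMap_assoc]
    refine List.flatMap_congr fun c _ => ?_
    rw [List.getElem?_map]
    cases c.list[i]? <;> simp
  exact key q h

/-- Evaluation of a coherence 3-cell between formal composites of evaluated strings. -/
theorem coh_ev {q q' : VCell X} (hl : q.tree.leaves = q'.tree.leaves)
    (hn : (columns q.tree).length = (columns q'.tree).length) {p p' s s' : (HV.obj X.alg.A).C2}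
    {k : p ⟶ p'} {k' : s ⟶ s'} (hp : trees p = columns q.tree) (hp' : trees p' = columns q'.tree)
    (hk : comps k = comps (𝟙 p)) (hs : trees s = [evTree q.tree]) (hs' : trees s' = [evTree q'.tree])
    (hk' : comps k' = comps (𝟙 s)) : X.ev.map k ≋ X.ev.map k' := by
  let P (l : VCell X) : (HV.obj (HV.obj X.alg.A)).C2 :=
    Str.mk (O := X.alg.A.C0) default [l] (isChain _ _ _ _)
  -- The coherence cell with an identity at each leaf exists once the boundaries agree, and these
  -- are determined by the numbers of columns. Its components remain identities both after
  -- flattening and after evaluating the leaves.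
  let M : q ⟶ q' := VTree.Hom.mk
    (c1_ext ((length_columns_src q).symm.trans (hn.trans (length_columns_src q'))))
    (c1_ext ((length_columns_tgt q).symm.trans (hn.trans (length_columns_tgt q'))))
    (LHom.cast rfl hl (LHom.id _))
  let F : P q ⟶ P q' := Str.Hom.mk (p := P q) (q := P q') rfl (.cons M .nil)
  have e (q : VCell X) : (Str.list (P q)).flatMap (fun q : VCell X => columns q.tree) =
      columns q.tree := List.append_nil _
  have eM : vArr (X := HV.obj X.alg.A) M = q.tree.leaves.map fun c => Arrow.mk (𝟙 c) :=
    (LHom.arrows_cast rfl hl (LHom.id _)).trans (LHom.arrows_id q.tree.leaves)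
  refine ev_same F ((e q).trans hp.symm) ((e q').trans hp'.symm) ?_ hs.symm hs'.symm ?_
  · change (cols (columns q.tree).length ((vArr (X := HV.obj X.alg.A) M).map
      fun c => comps c.hom)).map List.flatten ++ [] = _
    rw [eM, hk, comps_id, List.append_nil, List.map_map, hp]
    apply List.ext_getElem
    · simp
    · intro i h1 h2
      -- Column by column, the transposed list of identities is read off in the order of
      -- `leaves_columns`.
      rw [List.getElem_map, getElem_cols, List.getElem_map, leaves_columns, List.flatMap_map,
        List.map_flatMap, List.flatten_eq_flatMap, List.flatMap_assoc]
      refine List.flatMap_congr fun c _ => ?_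
      change List.flatMap _root_.id (comps (𝟙 c))[i]?.toList = _
      rw [comps_id, List.getElem?_map]
      cases (trees c)[i]? <;> simp
  · change [(vArr (X := HV.obj X.alg.A) M).map fun c => Arrow.mk (X.ev.map c.hom)] = _
    rw [hk', comps_id, hs, eM, List.map_map, List.map_singleton, evTree, Raw.leaves_map,
      List.map_map]
    congr 1
    refine List.map_congr_left fun c _ => ?_
    exact congrArg Arrow.mk (X.ev.map_id c)

/-! ### Laws for the tensor products of 3-cells -/

/-- The 3-cell between formal vertical composites with given components. -/
def treeCell {r r' : X.Formal} (f : LHom r.leaves r'.leaves) : cell [r] ⟶ cell [r'] :=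
  cellHom (.cons (treeHom f) .nil)

theorem comps_treeCell {r r' : X.Formal} (f : LHom r.leaves r'.leaves) :
    comps (treeCell f) = [f.arrows] := rfl

theorem treeCell_comp {r r' r'' : X.Formal} (f : LHom r.leaves r'.leaves)
    (g : LHom r'.leaves r''.leaves) : treeCell f ≫ treeCell g = treeCell (LHom.comp f g) := rfl

/-- Commutative squares of evaluated 3-cells. -/
theorem treeCell_square {r r' s s' : X.Formal} {f : LHom r.leaves s.leaves}
    {i : LHom s.leaves s'.leaves} {j : LHom r.leaves r'.leaves} {g : LHom r'.leaves s'.leaves}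
    (h : LHom.comp f i = LHom.comp j g) :
    X.ev.map (treeCell f) ≫ X.ev.map (treeCell i) =
      X.ev.map (treeCell j) ≫ X.ev.map (treeCell g) :=
  (X.ev.map_comp _ _).symm.trans ((congrArg (fun f => X.ev.map (treeCell f)) h).trans
    (X.ev.map_comp (treeCell j) (treeCell g)))

theorem treeCell_same {r r' s s' : X.Formal} {f : LHom r.leaves r'.leaves}
    {g : LHom s.leaves s'.leaves} (h : r = s) (h' : r' = s') (e : f.arrows = g.arrows) :
    treeCell f ≋ treeCell g := by
  subst h h'
  rw [LHom.ext_arrows e]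
  exact Same.refl _

theorem comps_treeCell_id {r r' : X.Formal} {f : LHom r.leaves r'.leaves}
    (h : f.arrows = r.leaves.map fun a => Arrow.mk (𝟙 a)) :
    comps (treeCell f) = comps (𝟙 (cell [r])) := by
  rw [comps_treeCell, comps_id, trees_cell, h]; rfl

/-- This is the unit law of the algebra on 3-cells. It allows any 3-cell to be treated as an
evaluated one. -/
theorem ev_treeCell_leaf {a b : X.Carrier} (f : a ⟶ b) :
    X.ev.map (treeCell (r := .leaf a) (r' := .leaf b) (.cons f .nil)) ≋ f := by
  have h : X.ev.map ((HV.η.app X.alg.A).f2.map f) ≋ f :=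
    congrArg (fun F : X.alg.A ⟶ X.alg.A => Arrow.mk (F.f2.map f)) X.alg.unit
  refine Same.trans (Same.map X.ev (same_of_comps ?_ ?_ ?_)) h <;> rfl

theorem vtenMap_treeCell {r r' s s' : X.Formal} (f : LHom r.leaves r'.leaves)
    (g : LHom s.leaves s'.leaves) : vtenMap (X.ev.map (treeCell f)) (X.ev.map (treeCell g)) ≋
      X.ev.map (treeCell (r := .comp r s) (r' := .comp r' s') (f.append g)) :=
  vtenMap_ev _ _ _ rfl rfl rfl (congrArg (fun L => [L]) (LHom.arrows_append f g))

theorem vten_same {a b c d a' b' c' d' : X.Carrier} {f : a ⟶ b} {g : c ⟶ d} {f' : a' ⟶ b'}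
    {g' : c' ⟶ d'} (h : f ≋ f') (h' : g ≋ g') : vtenMap f g ≋ vtenMap f' g' := by
  obtain rfl := h.left
  obtain rfl := h.right
  obtain rfl := h'.left
  obtain rfl := h'.right
  rw [h.eq, h'.eq]
  exact Same.refl _

theorem hten_same {a b c d a' b' c' d' : X.Carrier} {f : a ⟶ b} {g : c ⟶ d} {f' : a' ⟶ b'}
    {g' : c' ⟶ d'} (h : f ≋ f') (h' : g ≋ g') : htenMap f g ≋ htenMap f' g' := by
  obtain rfl := h.left
  obtain rfl := h.right
  obtain rfl := h'.left
  obtain rfl := h'.right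
  rw [h.eq, h'.eq]
  exact Same.refl _

section
variable {a b c d a' b' c' d' a'' b'' : X.Carrier}

/-- A 3-cell between strings of length two of 2-cells. -/
def pairCell (f : a ⟶ a') (g : b ⟶ b') :
    (cell [.leaf a, .leaf b] : (HV.obj X.alg.A).C2) ⟶ cell [.leaf a', .leaf b'] :=
  cellHom (.cons (treeHom (.cons f .nil)) (.cons (treeHom (.cons g .nil)) .nil))

/-- A 3-cell between binary vertical composites. -/
def compCell (f : a ⟶ a') (g : b ⟶ b') :
    (cell [.comp (.leaf a) (.leaf b)] : (HV.obj X.alg.A).C2) ⟶ cell [.comp (.leaf a') (.leaf b')] :=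
  treeCell (r := .comp (.leaf a) (.leaf b)) (r' := .comp (.leaf a') (.leaf b'))
    (.cons f (.cons g .nil))

theorem vtenMap_id (a b : X.Carrier) : vtenMap (𝟙 a) (𝟙 b) = 𝟙 (vten a b) := X.ev.map_id _

theorem htenMap_id (a b : X.Carrier) : htenMap (𝟙 a) (𝟙 b) = 𝟙 (hten a b) := X.ev.map_id _

theorem vtenMap_comp (f : a ⟶ a') (f' : a' ⟶ a'') (g : b ⟶ b') (g' : b' ⟶ b'') :
    vtenMap (f ≫ f') (g ≫ g') = vtenMap f g ≫ vtenMap f' g' :=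
  X.ev.map_comp (compCell f g) (compCell f' g')

theorem htenMap_comp (f : a ⟶ a') (f' : a' ⟶ a'') (g : b ⟶ b') (g' : b' ⟶ b'') :
    htenMap (f ≫ f') (g ≫ g') = htenMap f g ≫ htenMap f' g' :=
  X.ev.map_comp (pairCell f g) (pairCell f' g')

instance vtenMap_isIso (f : a ⟶ a') (g : b ⟶ b') [IsIso f] [IsIso g] : IsIso (vtenMap f g) :=
  ⟨vtenMap (inv f) (inv g), by
    rw [← vtenMap_comp, IsIso.hom_inv_id, IsIso.hom_inv_id, vtenMap_id], by
    rw [← vtenMap_comp, IsIso.inv_hom_id, IsIso.inv_hom_id, vtenMap_id]⟩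

instance htenMap_isIso (f : a ⟶ a') (g : b ⟶ b') [IsIso f] [IsIso g] : IsIso (htenMap f g) :=
  ⟨htenMap (inv f) (inv g), by
    rw [← htenMap_comp, IsIso.hom_inv_id, IsIso.hom_inv_id, htenMap_id], by
    rw [← htenMap_comp, IsIso.inv_hom_id, IsIso.inv_hom_id, htenMap_id]⟩

/-- Both bracketings are evaluations of the same 3-cell `T` between strings of length three. -/
theorem htenMap_assoc (f : a ⟶ a') (g : b ⟶ b') (k : c ⟶ c') :
    htenMap (htenMap f g) k ≋ htenMap f (htenMap g k) := by
  let T : cell [.leaf a, .leaf b, .leaf c] ⟶ cell [.leaf a', .leaf b', .leaf c'] :=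
    cellHom (.cons (treeHom (.cons f .nil)) (.cons (treeHom (.cons g .nil))
      (.cons (treeHom (.cons k .nil)) .nil)))
  have h1 : htenMap (htenMap f g) k ≋ X.ev.map T :=
    (hten_same (Same.refl (X.ev.map (pairCell f g))) (ev_treeCell_leaf k).symm).trans
      (htenMap_ev _ _ _ rfl rfl rfl)
  have h2 : htenMap f (htenMap g k) ≋ X.ev.map T :=
    (hten_same (ev_treeCell_leaf f).symm (Same.refl (X.ev.map (pairCell g k)))).trans
      (htenMap_ev _ _ _ rfl rfl rfl)
  exact h1.trans h2.symm

/-- The unit is the value of the empty string, and concatenating with the empty string changes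
nothing. -/
theorem htenMap_one_left (f : a ⟶ a') : htenMap (𝟙 X.one) f ≋ f :=
  (hten_same (Same.of_eq (X.ev.map_id (cell [])).symm) (ev_treeCell_leaf f).symm).trans
    ((htenMap_ev _ _ (treeCell (r := .leaf a) (r' := .leaf a') (.cons f .nil)) rfl rfl rfl).trans
      (ev_treeCell_leaf f))

theorem htenMap_one_right (f : a ⟶ a') : htenMap f (𝟙 X.one) ≋ f :=
  (hten_same (ev_treeCell_leaf f).symm (Same.of_eq (X.ev.map_id (cell [])).symm)).trans
    ((htenMap_ev _ _ (treeCell (r := .leaf a) (r' := .leaf a') (.cons f .nil)) rfl rfl rfl).trans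
      (ev_treeCell_leaf f))

/-- Strict interchange for 3-cells. -/
theorem vtenMap_htenMap (f : a ⟶ a') (g : b ⟶ b') (h : c ⟶ c') (k : d ⟶ d') :
    vtenMap (htenMap f g) (htenMap h k) ≋ htenMap (vtenMap f h) (vtenMap g k) := by
  let T : cell [.comp (.leaf a) (.leaf c), .comp (.leaf b) (.leaf d)] ⟶
      cell [.comp (.leaf a') (.leaf c'), .comp (.leaf b') (.leaf d')] :=
    cellHom (.cons (treeHom (.cons f (.cons h .nil)))
      (.cons (treeHom (.cons g (.cons k .nil))) .nil))
  have h1 : vtenMap (htenMap f g) (htenMap h k) ≋ X.ev.map T :=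
    vtenMap_ev (pairCell f g) (pairCell h k) T rfl rfl rfl rfl
  have h2 : htenMap (vtenMap f h) (vtenMap g k) ≋ X.ev.map T :=
    htenMap_ev (treeCell (r := .comp (.leaf a) (.leaf c)) (r' := .comp (.leaf a') (.leaf c'))
        (.cons f (.cons h .nil)))
      (treeCell (r := .comp (.leaf b) (.leaf d)) (r' := .comp (.leaf b') (.leaf d'))
        (.cons g (.cons k .nil))) T rfl rfl rfl
  exact h1.trans h2.symm

theorem vassoc_same (a b c : X.Carrier) : (vassoc a b c).hom ≋
    X.ev.map (treeCell (r := .comp (.comp (.leaf a) (.leaf b)) (.leaf c))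
      (r' := .comp (.leaf a) (.comp (.leaf b) (.leaf c))) (LHom.id [a, b, c])) :=
  Same.conj (vten_left a b c) _ (vten_right a b c).symm

theorem vtop_same (a : X.Carrier) : (vtop a).hom ≋
    X.ev.map (treeCell (r := .comp (.one default) (.leaf a)) (r' := .leaf a) (LHom.id [a])) :=
  Same.conj (vten_one_left a) _ (ev_leaf a)

theorem vbot_same (a : X.Carrier) : (vbot a).hom ≋
    X.ev.map (treeCell (r := .comp (.leaf a) (.one default)) (r' := .leaf a) (LHom.id [a])) :=
  Same.conj (vten_one_right a) _ (ev_leaf a)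

/-- The nullary vertical composite and the empty string have the same value, so the identity on the
former is the identity of `X.one`. -/
theorem ev_treeCell_one :
    X.ev.map (treeCell (r := .one default) (r' := .one default) .nil) ≋ 𝟙 X.one :=
  (Same.of_eq (X.ev.map_id (cell [.one default]))).trans (Same.id_congr X.vone_eq)

theorem vtenMap_left (f : a ⟶ a') (g : b ⟶ b') (k : c ⟶ c') : vtenMap (vtenMap f g) k ≋
    X.ev.map (treeCell (r := .comp (.comp (.leaf a) (.leaf b)) (.leaf c))
      (r' := .comp (.comp (.leaf a') (.leaf b')) (.leaf c'))
      (.cons f (.cons g (.cons k .nil)))) :=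
  (vten_same (Same.refl _) (ev_treeCell_leaf k).symm).trans (vtenMap_treeCell
    (r := .comp (.leaf a) (.leaf b)) (r' := .comp (.leaf a') (.leaf b'))
    (s := .leaf c) (s' := .leaf c') (.cons f (.cons g .nil)) (.cons k .nil))

theorem vtenMap_right (f : a ⟶ a') (g : b ⟶ b') (k : c ⟶ c') : vtenMap f (vtenMap g k) ≋
    X.ev.map (treeCell (r := .comp (.leaf a) (.comp (.leaf b) (.leaf c)))
      (r' := .comp (.leaf a') (.comp (.leaf b') (.leaf c')))
      (.cons f (.cons g (.cons k .nil)))) :=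
  (vten_same (ev_treeCell_leaf f).symm (Same.refl _)).trans (vtenMap_treeCell
    (r := .leaf a) (r' := .leaf a') (s := .comp (.leaf b) (.leaf c))
    (s' := .comp (.leaf b') (.leaf c')) (.cons f .nil) (.cons g (.cons k .nil)))

/-- Before evaluation, the associativity cell has identity components and both tensor products have
components `f`, `g`, `k`; the square therefore commutes already in the free structure. -/
theorem vassoc_naturality (f : a ⟶ a') (g : b ⟶ b') (k : c ⟶ c') :
    vtenMap (vtenMap f g) k ≫ (vassoc a' b' c').hom =
      (vassoc a b c).hom ≫ vtenMap f (vtenMap g k) := by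
  refine Same.eq (((vtenMap_left f g k).comp (vassoc_same _ _ _)).trans
    (Same.trans ?_ ((vassoc_same _ _ _).comp (vtenMap_right f g k)).symm))
  refine Same.of_eq (treeCell_square ?_)
  exact (LHom.comp_id _).trans (LHom.id_comp (l := [a, b, c]) (m := [a', b', c']) _).symm

theorem vtop_naturality (f : a ⟶ a') :
    vtenMap (𝟙 X.one) f ≫ (vtop a').hom = (vtop a).hom ≫ f := by
  refine Same.eq ((((vten_same ev_treeCell_one.symm (ev_treeCell_leaf f).symm).trans
    (vtenMap_treeCell _ _)).comp (vtop_same _)).trans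
    (Same.trans ?_ ((vtop_same _).comp (ev_treeCell_leaf f).symm).symm))
  refine Same.of_eq (treeCell_square ?_)
  exact (LHom.comp_id _).trans (LHom.id_comp (l := [a]) (m := [a']) _).symm

theorem vbot_naturality (f : a ⟶ a') :
    vtenMap f (𝟙 X.one) ≫ (vbot a').hom = (vbot a).hom ≫ f := by
  refine Same.eq ((((vten_same (ev_treeCell_leaf f).symm ev_treeCell_one.symm).trans
    (vtenMap_treeCell _ _)).comp (vbot_same _)).trans
    (Same.trans ?_ ((vbot_same _).comp (ev_treeCell_leaf f).symm).symm))
  refine Same.of_eq (treeCell_square ?_)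
  exact (LHom.comp_id _).trans (LHom.id_comp (l := [a]) (m := [a']) _).symm

end

/-! ### Structure isomorphisms at values of formal composites. -/

/-- Associativity of evaluated formal composites. -/
theorem vassoc_ev (r s t : X.Formal)
    {f : LHom (Raw.comp (.comp r s) t).leaves (Raw.comp r (.comp s t)).leaves}
    (hf : f.arrows = (Raw.comp (.comp r s) t).leaves.map fun a => Arrow.mk (𝟙 a)) :
    (vassoc (X.ev.obj (cell [r])) (X.ev.obj (cell [s])) (X.ev.obj (cell [t]))).hom ≋
      X.ev.map (treeCell f) := by
  let q : VCell X := ⟨.comp (.comp (.leaf (cell [r])) (.leaf (cell [s]))) (.leaf (cell [t])),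
    ⟨trivial, trivial, bdry_eq rfl⟩, trivial, bdry_eq rfl⟩
  let q' : VCell X := ⟨.comp (.leaf (cell [r])) (.comp (.leaf (cell [s])) (.leaf (cell [t]))),
    trivial, ⟨trivial, trivial, bdry_eq rfl⟩, bdry_eq rfl⟩
  -- The coherence cell between bracketings of the three values and the one between the grafted
  -- trees come from the same cell of `HVHV`, evaluated at the leaves or flattened.
  refine (vassoc_same _ _ _).trans (coh_ev (k' := treeCell (r := evTree q.tree) (r' := evTree q'.tree) (LHom.id _))
    (q := q) (q' := q') rfl rfl rfl rfl
    (comps_treeCell_id hf) rfl rfl (comps_treeCell_id (LHom.arrows_id _))).symm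

/-- The upper vertical unit isomorphism of an evaluated formal composite. -/
theorem vtop_ev (r : X.Formal) {f : LHom (Raw.comp (.one default) r).leaves r.leaves}
    (hf : f.arrows = r.leaves.map fun a => Arrow.mk (𝟙 a)) :
    (vtop (X.ev.obj (cell [r]))).hom ≋ X.ev.map (treeCell f) := by
  -- The formal unit is labelled by the source of `cell [r]`. This is a string of length one, so
  -- flattening produces a single unit above `r`.
  let q : VCell X := ⟨.comp (.one ((HV.obj X.alg.A).src (cell [r]))) (.leaf (cell [r])),
    trivial, trivial, rfl⟩
  let q' : VCell X := ⟨.leaf (cell [r]), trivial⟩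
  refine (vtop_same _).trans (coh_ev (k' := treeCell (r := .comp (.one default) (.leaf (X.ev.obj (cell [r]))))
    (r' := .leaf (X.ev.obj (cell [r]))) (LHom.id _))
    (q := q) (q' := q') rfl rfl ?_ rfl
    (comps_treeCell_id hf) ?_ rfl (comps_treeCell_id (LHom.arrows_id _))).symm
  · exact congrArg (fun a => [Raw.comp (.one a) r]) (Subsingleton.elim (α := X.alg.A.C1) _ _)
  · exact congrArg (fun a => [Raw.comp (.one a) (.leaf (X.ev.obj (cell [r])))])
      (Subsingleton.elim (α := X.alg.A.C1) _ _)

/-- The lower vertical unit isomorphism of an evaluated formal composite. -/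
theorem vbot_ev (r : X.Formal) {f : LHom (Raw.comp r (.one default)).leaves r.leaves}
    (hf : f.arrows = r.leaves.map fun a => Arrow.mk (𝟙 a)) :
    (vbot (X.ev.obj (cell [r]))).hom ≋ X.ev.map (treeCell f) := by
  let q : VCell X := ⟨.comp (.leaf (cell [r])) (.one ((HV.obj X.alg.A).tgt (cell [r]))),
    trivial, trivial, rfl⟩
  let q' : VCell X := ⟨.leaf (cell [r]), trivial⟩
  refine (vbot_same _).trans (coh_ev (k' := treeCell (r := .comp (.leaf (X.ev.obj (cell [r]))) (.one default))
    (r' := .leaf (X.ev.obj (cell [r]))) (LHom.id _))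
    (q := q) (q' := q') rfl rfl ?_ rfl
    (comps_treeCell_id (hf.trans ?_)) ?_ rfl (comps_treeCell_id (LHom.arrows_id _))).symm
  · exact congrArg (fun a => [Raw.comp r (.one a)]) (Subsingleton.elim (α := X.alg.A.C1) _ _)
  · exact congrArg (List.map _) (List.append_nil _).symm
  · exact congrArg (fun a => [Raw.comp (.leaf (X.ev.obj (cell [r]))) (.one a)])
      (Subsingleton.elim (α := X.alg.A.C1) _ _)

/-- The vertical unit isomorphism of the unit is an identity. -/
theorem vtop_one : (vtop X.one).hom ≋ 𝟙 X.one := by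
  -- Here the unit is labelled by an empty string, so neither composite has any columns. Flattened,
  -- the coherence cell is the identity of the empty string; evaluated at its leaves, it is the unit
  -- isomorphism at `X.one`.
  let q : VCell X := ⟨.comp (.one ((HV.obj X.alg.A).src (cell []))) (.leaf (cell [])),
    trivial, trivial, rfl⟩
  let q' : VCell X := ⟨.leaf (cell []), trivial⟩
  refine (vtop_same _).trans ((coh_ev (k' := treeCell (r := .comp (.one default) (.leaf X.one))
    (r' := .leaf X.one) (LHom.id _))
    (q := q) (q' := q') (k := 𝟙 (cell [])) rfl rfl rfl rfl
    rfl ?_ rfl (comps_treeCell_id (LHom.arrows_id _))).symm.trans (Same.of_eq (X.ev.map_id _)))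
  exact congrArg (fun a => [Raw.comp (.one a) (.leaf X.one)])
    (Subsingleton.elim (α := X.alg.A.C1) _ _)

end DDBicatSCat

/-! ### The weak map axioms in terms of components. -/

open Cat2Gph DDBicatSCat

theorem Same.map_eqToHom {C D : Type u} [Category.{v} C] [Category.{v} D] (F : C ⥤ D) {a b : C}
    (h : a = b) : F.map (CategoryTheory.eqToHom h) ≋ 𝟙 (F.obj a) := by
  subst h; exact Same.of_eq (F.map_id a)

namespace Cat2Gph

theorem eqToHom_nat {A B : Cat2Gph.{v, u}} {F G : A ⟶ B} (h : F = G) (x : A.C2) :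
    (eqToHom h).nat.app x ≋ 𝟙 (F.f2.obj x) := by
  subst h; exact Same.refl _

theorem nat_app_congr {A B : Cat2Gph.{v, u}} {F G : A ⟶ B} (φ : F ⟶ G) {x y : A.C2}
    (h : x = y) : φ.nat.app x ≋ φ.nat.app y := by
  subst h; exact Same.refl _

end Cat2Gph

variable {X Y : DDBicatSCat.{v, u}}

namespace DDBicatSCat

theorem trees_HVmap {B : Cat2Gph.{v, u}} (F : B ⟶ Y.alg.A) (P : (HV.obj B).C2) :
    trees ((HV.map F).f2.obj P) =
      (Str.list P).map fun q : (vObj B).C2 => q.tree.map F.f1 F.f2.obj :=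
  List.map_map

theorem comps_HVmap (F : X.alg.A ⟶ Y.alg.A) {p q : (HV.obj X.alg.A).C2} (f : p ⟶ q) :
    comps ((HV.map F).f2.map f) = (comps f).map (List.map fun a => Arrow.mk (F.f2.map a.hom)) :=
  hvArr_map (X := X.alg.A) F f

theorem comps_map₂ {B : Cat2Gph.{v, u}} {F G : B ⟶ Y.alg.A} (θ : F ⟶ G) (P : (HV.obj B).C2) :
    comps ((HV.map₂ θ).nat.app P) = (Str.list P).map fun q : (vObj B).C2 =>
      q.tree.leaves.map fun c => Arrow.mk (θ.nat.app c) := by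
  have key (P : (hObj (vObj B)).C2) : hvArr ((hMap₂ (vMap₂ θ)).nat.app P) =
      P.list.map fun q => q.tree.leaves.map fun c => Arrow.mk (θ.nat.app c) := by
    rw [hvArr, hMap₂_arr, List.map_map]
    refine List.map_congr_left fun q _ => ?_
    exact vMap₂_arr θ q
  exact key P

/-- The two factors in the multiplication axiom meet at objects that agree by functoriality of `HV`;
this is the transport between them. -/
theorem middle_eq (f : X.alg.A ⟶ Y.alg.A) (P : (HV.obj (HV.obj X.alg.A)).C2) :
    Y.ev.obj ((HV.map (X.alg.a ≫ f)).f2.obj P) =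
      Y.ev.obj ((HV.map f).f2.obj ((HV.map X.alg.a).f2.obj P)) :=
  congrArg (fun F : HV.obj (HV.obj X.alg.A) ⟶ HV.obj Y.alg.A => Y.ev.obj (F.f2.obj P))
    (HV.map_comp X.alg.a f)

/-- The multiplication axiom of weak maps in terms of components. -/
theorem mul_iff {f : X.alg.A ⟶ Y.alg.A} (φ : HV.map f ≫ Y.alg.a ⟶ X.alg.a ≫ f) (h₁ h₂ h₃) :
    HV.μ.app X.alg.A ◁ φ = eqToHom h₁ ≫ HV.map₂ φ ▷ Y.alg.a ≫ eqToHom h₂ ≫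
        HV.map X.alg.a ◁ φ ≫ eqToHom h₃ ↔
      ∀ P : (HV.obj (HV.obj X.alg.A)).C2, φ.nat.app ((HV.μ.app X.alg.A).f2.obj P) ≋
        Y.ev.map ((HV.map₂ φ).nat.app P) ≫ eqToHom (middle_eq f P) ≫
          φ.nat.app ((HV.map X.alg.a).f2.obj P) := by
  have key (P : (HV.obj (HV.obj X.alg.A)).C2) : (eqToHom h₁ ≫ HV.map₂ φ ▷ Y.alg.a ≫ eqToHom h₂ ≫
      HV.map X.alg.a ◁ φ ≫ eqToHom h₃).nat.app P ≋
      Y.ev.map ((HV.map₂ φ).nat.app P) ≫ eqToHom (middle_eq f P) ≫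
        φ.nat.app ((HV.map X.alg.a).f2.obj P) := by
    -- The components of an `eqToHom` 2-cell are identities up to transport: the outer two disappear
    -- and the middle one becomes the transport along `middle_eq`.
    refine (Same.id_comp (eqToHom_nat _ _) _).trans (Same.comp (Same.refl _) ?_)
    refine Same.comp ?_ ((Same.comp_id _ (eqToHom_nat _ _)))
    exact (eqToHom_nat _ _).trans (Same.eqToHom _).symm
  constructor
  · intro h P
    exact (Same.of_eq (congrArg (fun θ => Hom₂.nat θ |>.app P) h)).trans (key P)
  · intro h
    exact hom₂_ext fun P => Same.eq ((h P).trans (key P).symm)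

/-- The unit axiom of weak maps in terms of components. -/
theorem unit_iff {f : X.alg.A ⟶ Y.alg.A} (φ : HV.map f ≫ Y.alg.a ⟶ X.alg.a ≫ f) (h) :
    HV.η.app X.alg.A ◁ φ = eqToHom h ↔
      ∀ a : X.Carrier, φ.nat.app (cell [.leaf a]) ≋ 𝟙 (f.f2.obj a) := by
  -- The two strings may differ only in the name of their starting 0-cell, which is unique.
  have e (a : X.Carrier) : φ.nat.app (cell [.leaf a]) ≋ φ.nat.app ((HV.η.app X.alg.A).f2.obj a) :=
    nat_app_congr φ (str_eq rfl)
  have e' (a : X.Carrier) : (eqToHom h).nat.app a ≋ 𝟙 (f.f2.obj a) :=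
    (eqToHom_nat h a).trans (Same.id_congr (by
      refine (congrArg (fun F => F.f2.obj a) h).trans ?_
      exact congrArg (fun F : X.alg.A ⟶ X.alg.A => f.f2.obj (F.f2.obj a)) X.alg.unit))
  constructor
  · intro h' a
    exact (e a).trans ((Same.of_eq (congrArg (fun θ => Hom₂.nat θ |>.app a) h')).trans (e' a))
  · intro h'
    exact hom₂_ext fun a => Same.eq ((e a).symm.trans ((h' a).trans (e' a).symm))

/-! ### Values and constraints generated by the binary and nullary operations. -/

/-- Evaluation of a formal vertical composite by iterated binary composition. -/
def tval : X.Formal → X.Carrier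
  | .one _ => X.one
  | .leaf a => a
  | .comp r s => vten (tval r) (tval s)

/-- Evaluation of a string of formal vertical composites by iterated binary composition. -/
def lval : List X.Formal → X.Carrier
  | [] => X.one
  | r :: l => hten (tval r) (lval l)

/-- A binary node is `vten_ev` for strings of length one, and a nullary node is the agreement of the
two units. -/
theorem ev_tree (r : X.Formal) : X.ev.obj (cell [r]) = tval r := by
  induction r with
  | one a => exact (congrArg (fun a => X.ev.obj (cell [.one a]))
      (Subsingleton.elim (α := X.alg.A.C1) _ _)).trans X.vone_eq
  | leaf a => exact ev_leaf a
  | comp r s ih ih' => exact (vten_ev [r] [s] rfl).symm.trans (congrArg₂ vten ih ih')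

/-- The first column is split off by `hten_ev`. The recursion stops at the empty string, so `lval`
carries a final unit factor that strictness makes harmless. -/
theorem ev_cell (l : List X.Formal) : X.ev.obj (cell l) = lval l := by
  induction l with
  | nil => rfl
  | cons r l ih => exact (hten_ev [r] l).symm.trans (congrArg₂ hten (ev_tree r) ih)

end DDBicatSCat

namespace MapData

variable (D : MapData X Y)

/-- The image of a formal composite. -/
abbrev img (r : X.Formal) : Y.Formal := r.map (fun _ => default) D.F.obj

/-- The constraint at a formal vertical composite. -/
def treeCon : (r : X.Formal) → (tval (D.img r) ⟶ D.F.obj (tval r))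
  | .one _ => D.η.hom
  | .leaf a => 𝟙 (D.F.obj a)
  | .comp r s => vtenMap (treeCon r) (treeCon s) ≫ (D.v (tval r) (tval s)).hom

/-- The constraint at a string of formal vertical composites. -/
def listCon : (l : List X.Formal) → (lval (l.map D.img) ⟶ D.F.obj (lval l))
  | [] => D.η.hom
  | r :: l => htenMap (D.treeCon r) (listCon l) ≫ (D.h (tval r) (lval l)).hom

theorem v_same {a a' b b' : X.Carrier} (h : a = a') (h' : b = b') :
    (D.v a b).hom ≋ (D.v a' b').hom := by subst h h'; exact Same.refl _

theorem h_same {a a' b b' : X.Carrier} (h : a = a') (h' : b = b') :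
    (D.h a b).hom ≋ (D.h a' b').hom := by subst h h'; exact Same.refl _

end MapData

/-! ### A weak map is determined by its binary and nullary constraints. -/

namespace WeakMap

variable (w : WeakMap HV X.alg Y.alg)

theorem constraint_same (l : List X.Formal) :
    (w.constraint l).hom ≋ w.φ.hom.nat.app (cell l) :=
  Same.eqToHom_comp (w.map_cell l).symm _

theorem constraint_leaf (a : X.Carrier) : (w.constraint [.leaf a]).hom ≋ 𝟙 (w.functor.obj a) :=
  (w.constraint_same _).trans ((unit_iff _ _).1 w.unit a)

/-- This is the multiplication axiom with the flattening `m` of `P` and the string `n` with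
evaluated leaves left as parameters. Each application then only has to compute these two lists. -/
theorem mul_app (P : (HV.obj (HV.obj X.alg.A)).C2) {m : List X.Formal}
    (hm : ((Str.list P).flatMap fun q : VCell X => columns q.tree) = m) {n : List X.Formal}
    (hn : ((Str.list P).map fun q : VCell X => evTree q.tree) = n) :
    (w.constraint m).hom ≋ Y.ev.map ((HV.map₂ w.φ.hom).nat.app P) ≫
      eqToHom ((middle_eq w.f P).trans (by
        rw [← cell_trees ((HV.map X.alg.a).f2.obj P), trees_map, hn, w.map_cell])) ≫
      (w.constraint n).hom := by
  refine (w.constraint_same m).trans (((nat_app_congr w.φ.hom ?_).trans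
    ((mul_iff w.φ.hom _ _ _).1 w.mul P)).trans (Same.comp (Same.refl _) ?_))
  · rw [← hm, ← trees_mul, cell_trees]
  · refine (Same.eqToHom_comp _ _).trans (((nat_app_congr w.φ.hom ?_).trans
      (w.constraint_same n).symm).trans (Same.eqToHom_comp _ _).symm)
    rw [← hn, ← trees_map, cell_trees]

/-- The multiplication axiom is applied to one binary vertical composite with the two strings as
leaves. Flattening pairs their columns; evaluating first leaves a binary composite of two values,
whose constraint is `v`. -/
theorem constraint_comp (l m : List X.Formal) (h : l.length = m.length) :
    (w.constraint (List.zipWith .comp l m)).hom ≋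
      vtenMap (w.constraint l).hom (w.constraint m).hom ≫
        (w.toMapData.v (X.ev.obj (cell l)) (X.ev.obj (cell m))).hom := by
  let q : VCell X := ⟨.comp (.leaf (cell l)) (.leaf (cell m)), trivial, trivial, bdry_eq h⟩
  let P : (HV.obj (HV.obj X.alg.A)).C2 :=
    Str.mk (O := X.alg.A.C0) default [q] (isChain _ _ _ _)
  refine (w.mul_app P (m := List.zipWith .comp l m) (n := [.comp (.leaf _) (.leaf _)]) ?_
    rfl).trans (Same.comp ?_ (Same.eqToHom_comp _ _))
  · change columns (.comp (.leaf (cell l)) (.leaf (cell m))) ++ [] = _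
    rw [columns_comp, columns_leaf, columns_leaf, List.append_nil, trees_cell, trees_cell]
  · refine Same.trans (Same.map Y.ev (same_of_comps (g := compCell (w.φ.hom.nat.app (cell l))
      (w.φ.hom.nat.app (cell m))) (trees_HVmap _ _) (trees_HVmap _ _) (comps_map₂ _ _))) ?_
    exact vten_same (w.constraint_same l).symm (w.constraint_same m).symm

/-- The multiplication axiom is applied to a string of two one-leaf composites, which flattens to
the concatenation. -/
theorem constraint_append (l m : List X.Formal) :
    (w.constraint (l ++ m)).hom ≋
      htenMap (w.constraint l).hom (w.constraint m).hom ≫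
        (w.toMapData.h (X.ev.obj (cell l)) (X.ev.obj (cell m))).hom := by
  let q (l : List X.Formal) : VCell X := ⟨.leaf (cell l), trivial⟩
  let P : (HV.obj (HV.obj X.alg.A)).C2 :=
    Str.mk (O := X.alg.A.C0) default [q l, q m] (isChain _ _ _ _)
  refine (w.mul_app P (m := l ++ m) (n := [.leaf _, .leaf _]) ?_
    rfl).trans (Same.comp ?_ (Same.eqToHom_comp _ _))
  · change columns (.leaf (cell l)) ++ (columns (.leaf (cell m)) ++ []) = _
    rw [columns_leaf, columns_leaf, List.append_nil, trees_cell, trees_cell]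
  · refine Same.trans (Same.map Y.ev (same_of_comps (g := pairCell (w.φ.hom.nat.app (cell l))
      (w.φ.hom.nat.app (cell m))) (trees_HVmap _ _) (trees_HVmap _ _) (comps_map₂ _ _))) ?_
    exact hten_same (w.constraint_same l).symm (w.constraint_same m).symm

/-- The nullary vertical composite over the empty string of 1-cells flattens to the empty string but
evaluates to the formal unit. The multiplication axiom compares the constraints at these two, and
this forces the vertical and horizontal unit constraints to agree. -/
theorem constraint_one (a : X.alg.A.C1) :
    (w.constraint [.one a]).hom ≋ w.toMapData.η.hom := by
  let q : VCell X := ⟨.one (Str.mk (default : X.alg.A.C0) [] trivial), trivial⟩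
  let P : (HV.obj (HV.obj X.alg.A)).C2 :=
    Str.mk (O := X.alg.A.C0) default [q] (isChain _ _ _ _)
  refine ((w.mul_app P (m := []) (n := [.one a]) rfl
    (congrArg (fun a => [Raw.one a]) (Subsingleton.elim (α := X.alg.A.C1) _ _))).trans ?_).symm
  -- A nullary composite has no leaves, so the factor formed from the constraints at the leaves is
  -- an identity.
  refine (Same.id_comp (a' := Y.ev.obj ((HV.map (HV.map w.f ≫ Y.alg.a)).f2.obj P)) ?_ _).trans
    (Same.eqToHom_comp _ _)
  refine Same.trans (Same.map Y.ev (same_of_comps (g := 𝟙 _) rfl ?_ ?_))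
    (Same.of_eq (Y.ev.map_id _))
  · refine (trees_HVmap _ _).trans (Eq.trans ?_ (trees_HVmap _ _).symm)
    exact congrArg (fun a => [Raw.one a]) (Subsingleton.elim (α := Y.alg.A.C1) _ _)
  · rw [comps_id, comps_map₂, trees_HVmap]
    rfl

theorem constraint_tree (r : X.Formal) : (w.constraint [r]).hom ≋ w.toMapData.treeCon r := by
  induction r with
  | one a => exact w.constraint_one a
  | leaf a => exact w.constraint_leaf a
  | comp r s ih ih' =>
    exact (w.constraint_comp [r] [s] rfl).trans
      ((vten_same ih ih').comp (w.toMapData.v_same (ev_tree r) (ev_tree s)))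

theorem constraint_list (l : List X.Formal) : (w.constraint l).hom ≋ w.toMapData.listCon l := by
  induction l with
  | nil => exact Same.refl _
  | cons r l ih =>
    exact (w.constraint_append [r] l).trans
      ((hten_same (w.constraint_tree r) ih).comp (w.toMapData.h_same (ev_tree r) (ev_cell l)))

theorem app_same (p : (HV.obj X.alg.A).C2) :
    w.φ.hom.nat.app p ≋ w.toMapData.listCon (trees p) :=
  ((nat_app_congr w.φ.hom (cell_trees p).symm).trans (w.constraint_same _).symm).trans
    (w.constraint_list _)

/-- A weak map is determined by its functor and its constraints. -/
theorem toMapData_injective {w w' : WeakMap HV X.alg Y.alg} (h : w.toMapData = w'.toMapData) :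
    w = w' := by
  -- The target has one 0-cell and one 1-cell, so only the functor distinguishes underlying
  -- morphisms.
  have hf : w.f = w'.f := Cat2Gph.Hom.ext
    (funext fun _ => Subsingleton.elim (α := Y.alg.A.C0) _ _)
    (funext fun _ => Subsingleton.elim (α := Y.alg.A.C1) _ _) (congrArg MapData.F h)
  have hφ (p : (HV.obj X.alg.A).C2) : w.φ.hom.nat.app p ≋ w'.φ.hom.nat.app p :=
    (w.app_same p).trans (by rw [h]; exact (w'.app_same p).symm)
  clear h
  obtain ⟨f, φ, _, _⟩ := w
  obtain ⟨f', φ', _, _⟩ := w'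
  obtain rfl : f = f' := hf
  obtain rfl : φ = φ' := Iso.ext (hom₂_ext fun p => (hφ p).eq)
  rfl

/-! ### The constraints of a weak map are monoidal -/

theorem naturality {p q : (HV.obj X.alg.A).C2} (f : p ⟶ q) :
    Y.ev.map ((HV.map w.f).f2.map f) ≫ w.φ.hom.nat.app q =
      w.φ.hom.nat.app p ≫ w.functor.map (X.ev.map f) := w.φ.hom.nat.naturality f

/-- Naturality of the constraints. -/
theorem constraint_naturality {l m : List X.Formal} (f : cell l ⟶ cell m)
    (g : cell (l.map (Raw.map w.f.f1 w.functor.obj)) ⟶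
      cell (m.map (Raw.map w.f.f1 w.functor.obj)))
    (h : comps g = (comps f).map (List.map fun a => Arrow.mk (w.functor.map a.hom))) :
    Y.ev.map g ≫ (w.constraint m).hom = (w.constraint l).hom ≫ w.functor.map (X.ev.map f) := by
  have e (l : List X.Formal) : trees ((HV.map w.f).f2.obj (cell l)) =
      trees (cell (l.map (Raw.map w.f.f1 w.functor.obj))) := by
    rw [trees_cell]
    exact (trees_HVmap _ _).trans List.map_map
  refine Same.eq ((Same.comp (Same.map Y.ev (same_of_comps (e l).symm (e m).symm
    (h.trans (comps_HVmap w.f f).symm))) (w.constraint_same m)).trans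
    ((Same.of_eq (w.naturality f)).trans (Same.comp (w.constraint_same l).symm (Same.refl _))))

/-- A functor preserves identities, so the image of a coherence cell under `HV` of the map is again
a coherence cell; this is naturality of the constraints at such a cell. -/
theorem cohCell_naturality {r r' : X.Formal} {f : LHom r.leaves r'.leaves}
    {g : LHom (r.map w.f.f1 w.functor.obj).leaves (r'.map w.f.f1 w.functor.obj).leaves}
    (hf : f.arrows = r.leaves.map fun a => Arrow.mk (𝟙 a))
    (hg : g.arrows = (r.map w.f.f1 w.functor.obj).leaves.map fun a => Arrow.mk (𝟙 a)) :
    (w.constraint [r]).hom ≫ w.functor.map (X.ev.map (treeCell f)) ≋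
      Y.ev.map (treeCell g) ≫ (w.constraint [r']).hom := by
  refine Same.of_eq (w.constraint_naturality (treeCell f) (treeCell g) ?_).symm
  rw [comps_treeCell, comps_treeCell, hf, hg, Raw.leaves_map]
  simp only [List.map_map, List.map_cons, List.map_nil]
  congr 1
  refine List.map_congr_left fun a _ => ?_
  exact congrArg Arrow.mk (w.functor.map_id a).symm

theorem constraint_vleft (a b c : X.Carrier) :
    (w.constraint [.comp (.comp (.leaf a) (.leaf b)) (.leaf c)]).hom ≋
      vtenMap (w.toMapData.v a b).hom (𝟙 (w.functor.obj c)) ≫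
        (w.toMapData.v (vten a b) c).hom :=
  (w.constraint_comp [.comp (.leaf a) (.leaf b)] [.leaf c] rfl).trans
    ((vten_same (Same.refl _) (w.constraint_leaf c)).comp (w.toMapData.v_same rfl (ev_leaf c)))

theorem constraint_vright (a b c : X.Carrier) :
    (w.constraint [.comp (.leaf a) (.comp (.leaf b) (.leaf c))]).hom ≋
      vtenMap (𝟙 (w.functor.obj a)) (w.toMapData.v b c).hom ≫
        (w.toMapData.v a (vten b c)).hom :=
  (w.constraint_comp [.leaf a] [.comp (.leaf b) (.leaf c)] rfl).trans
    ((vten_same (w.constraint_leaf a) (Same.refl _)).comp (w.toMapData.v_same (ev_leaf a) rfl))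

theorem constraint_vtop (a : X.Carrier) :
    (w.constraint [.comp (.one default) (.leaf a)]).hom ≋
      vtenMap w.toMapData.η.hom (𝟙 (w.functor.obj a)) ≫ (w.toMapData.v X.one a).hom :=
  (w.constraint_comp [.one default] [.leaf a] rfl).trans
    ((vten_same (w.constraint_one _) (w.constraint_leaf a)).comp
      (w.toMapData.v_same X.vone_eq (ev_leaf a)))

theorem constraint_vbot (a : X.Carrier) :
    (w.constraint [.comp (.leaf a) (.one default)]).hom ≋
      vtenMap (𝟙 (w.functor.obj a)) w.toMapData.η.hom ≫ (w.toMapData.v a X.one).hom :=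
  (w.constraint_comp [.leaf a] [.one default] rfl).trans
    ((vten_same (w.constraint_leaf a) (w.constraint_one _)).comp
      (w.toMapData.v_same (ev_leaf a) X.vone_eq))

/-- Each axiom computes one constraint in two ways, or expresses naturality at one 3-cell of `HV X`.
-/
theorem isMonoidal : w.toMapData.IsMonoidal where
  v_natural {a a' b b'} f g := w.constraint_naturality (l := [.comp (.leaf a) (.leaf b)])
    (m := [.comp (.leaf a') (.leaf b')]) (compCell f g)
    (compCell (w.functor.map f) (w.functor.map g)) rfl
  h_natural {a a' b b'} f g := w.constraint_naturality (l := [.leaf a, .leaf b])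
    (m := [.leaf a', .leaf b']) (pairCell f g) (pairCell (w.functor.map f) (w.functor.map g)) rfl
  -- Naturality at the coherence cell between the two bracketings of three leaves, with both
  -- constraints expanded by `constraint_comp`.
  v_assoc a b c := by
    rw [← Category.assoc]
    refine Same.eq (((w.constraint_vleft a b c).symm.comp
      (Same.map w.functor (vassoc_same a b c))).trans
      ((w.cohCell_naturality (r := .comp (.comp (.leaf a) (.leaf b)) (.leaf c))
        (r' := .comp (.leaf a) (.comp (.leaf b) (.leaf c)))
        (g := LHom.id [w.functor.obj a, w.functor.obj b, w.functor.obj c])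
        (LHom.arrows_id _) (LHom.arrows_id _)).trans
      ((vassoc_same _ _ _).symm.comp (w.constraint_vright a b c))))
  v_top a := by
    -- The map sends the label of the formal unit to some 1-cell of the target, which equals the
    -- default one by uniqueness.
    have e : Y.ev.map (treeCell
        (r := (.comp (.one default) (.leaf a) : X.Formal).map w.f.f1 w.functor.obj)
        (r' := .leaf (w.functor.obj a)) (LHom.id [w.functor.obj a])) ≋
        (vtop (w.functor.obj a)).hom :=
      (Same.map Y.ev (treeCell_same (congrArg (fun x => Raw.comp (.one x) (.leaf (w.functor.obj a)))
        (Subsingleton.elim (α := Y.alg.A.C1) (w.f.f1 default) default)) rfl rfl)).trans (vtop_same _).symm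
    rw [← Category.assoc]
    exact Same.eq (((w.constraint_vtop a).symm.comp (Same.map w.functor (vtop_same a))).trans
      ((w.cohCell_naturality (r := .comp (.one default) (.leaf a)) (r' := .leaf a)
        (g := LHom.id [w.functor.obj a]) (LHom.arrows_id _) (LHom.arrows_id _)).trans
      ((e.comp (w.constraint_leaf a)).trans (Same.of_eq (Category.comp_id _)))))
  v_bot a := by
    have e : Y.ev.map (treeCell
        (r := (.comp (.leaf a) (.one default) : X.Formal).map w.f.f1 w.functor.obj)
        (r' := .leaf (w.functor.obj a)) (LHom.id [w.functor.obj a])) ≋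
        (vbot (w.functor.obj a)).hom :=
      (Same.map Y.ev (treeCell_same (congrArg (fun x => Raw.comp (.leaf (w.functor.obj a)) (.one x))
        (Subsingleton.elim (α := Y.alg.A.C1) (w.f.f1 default) default)) rfl rfl)).trans (vbot_same _).symm
    rw [← Category.assoc]
    exact Same.eq (((w.constraint_vbot a).symm.comp (Same.map w.functor (vbot_same a))).trans
      ((w.cohCell_naturality (r := .comp (.leaf a) (.one default)) (r' := .leaf a)
        (g := LHom.id [w.functor.obj a]) (LHom.arrows_id _) (LHom.arrows_id _)).trans
      ((e.comp (w.constraint_leaf a)).trans (Same.of_eq (Category.comp_id _)))))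
  -- The string of three leaves is split after its second or after its first entry.
  h_assoc a b c := by
    have h₁ := (w.constraint_append [.leaf a, .leaf b] [.leaf c]).trans
      ((hten_same (Same.refl _) (w.constraint_leaf c)).comp
        (w.toMapData.h_same rfl (ev_leaf c)))
    have h₂ := (w.constraint_append [.leaf a] [.leaf b, .leaf c]).trans
      ((hten_same (w.constraint_leaf a) (Same.refl _)).comp
        (w.toMapData.h_same (ev_leaf a) rfl))
    rw [← Category.assoc]
    exact Same.eq ((Same.comp_id _ (Same.map_eqToHom _ _)).trans
      ((h₁.symm.trans h₂).trans (Same.eqToHom_comp _ _).symm))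
  -- Prefixing the empty string leaves a one-leaf string, whose constraint is an identity by the
  -- unit axiom.
  h_left a := by
    rw [← Category.assoc]
    have h₁ := (w.constraint_append [] [.leaf a]).trans
      ((hten_same (Same.refl _) (w.constraint_leaf a)).comp
        (w.toMapData.h_same rfl (ev_leaf a)))
    exact Same.eq ((Same.comp_id _ (Same.map_eqToHom _ _)).trans ((h₁.symm.trans
      ((w.constraint_leaf a).trans (Same.id_congr (hten_one_left _).symm))).trans
        (Same.eqToHom _).symm))
  h_right a := by
    rw [← Category.assoc]
    have h₁ := (w.constraint_append [.leaf a] []).trans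
      ((hten_same (w.constraint_leaf a) (Same.refl _)).comp
        (w.toMapData.h_same (ev_leaf a) rfl))
    exact Same.eq ((Same.comp_id _ (Same.map_eqToHom _ _)).trans ((h₁.symm.trans
      ((w.constraint_leaf a).trans (Same.id_congr (hten_one_right _).symm))).trans
        (Same.eqToHom _).symm))
  -- The grid is split into its two rows by `constraint_comp` and into its two columns by
  -- `constraint_append`.
  interaction a b c d := by
    rw [← Category.assoc]
    have h₁ := w.constraint_comp [.leaf a, .leaf b] [.leaf c, .leaf d] rfl
    have h₂ := w.constraint_append [.comp (.leaf a) (.leaf c)] [.comp (.leaf b) (.leaf d)]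
    exact Same.eq ((Same.comp_id _ (Same.map_eqToHom _ _)).trans
      ((h₁.symm.trans h₂).trans (Same.eqToHom_comp _ _).symm))

/-- The vertical and horizontal unit constraints coincide. -/
theorem vunit_eq : w.vunit.hom = eqToHom Y.vone_eq ≫ w.toMapData.η.hom ≫
    w.toMapData.F.map (eqToHom X.vone_eq.symm) := by
  have h : Y.vone = Y.ev.obj (cell ([.one default].map (Raw.map w.f.f1 w.functor.obj))) :=
    congrArg (fun f => Y.ev.obj (cell [.one f])) (Subsingleton.elim (α := Y.alg.A.C1) _ _)
  exact Same.eq (((Same.eqToHom_comp h _).trans (w.constraint_one default)).trans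
    ((Same.eqToHom_comp _ _).trans (Same.comp_id _ (Same.map_eqToHom _ _))).symm)

end WeakMap

/-! ### Morphisms of lists with identity components. -/

namespace LHom

variable {C : Type u} [Category.{v} C]

/-- All components are identities. -/
def IsId {l m : List C} (f : LHom l m) : Prop := f.arrows = l.map fun a => Arrow.mk (𝟙 a)

/-- The two morphisms have different source lists, equal only through `hlm`, so the cancellation is
stated for lists of components. -/
theorem IsId.comp_eq {l m n : List C} {f : LHom l m} (hf : f.IsId) (hlm : l = m)
    (g : LHom m n) : (comp f g).arrows = g.arrows := by
  subst hlm
  obtain rfl : f = id l := ext_arrows (hf.trans (arrows_id l).symm)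
  rw [id_comp]

theorem comp_isId_eq {l m n : List C} (f : LHom l m) {g : LHom m n} (hg : g.IsId) (hmn : m = n) :
    (comp f g).arrows = f.arrows := by
  subst hmn
  obtain rfl : g = id m := ext_arrows (hg.trans (arrows_id m).symm)
  rw [comp_id]

/-- The comparison between equal lists. -/
def ofEq {l m : List C} (h : l = m) : LHom l m := cast rfl h (id l)

theorem ofEq_isId {l m : List C} (h : l = m) : (ofEq h).IsId :=
  (arrows_cast _ _ _).trans (arrows_id l)

end LHom

namespace MapData

variable (D : MapData X Y)

theorem listCon_congr {l l' : List X.Formal} (h : l = l') : D.listCon l ≋ D.listCon l' := by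
  subst h; exact Same.refl _

/-- Tensor products preserve isomorphisms. With the analogous instance for strings, this makes the
structure 2-cell invertible. -/
instance treeCon_isIso (r : X.Formal) : IsIso (D.treeCon r) := by
  induction r with
  | one => exact inferInstanceAs (IsIso D.η.hom)
  | leaf a => exact inferInstanceAs (IsIso (𝟙 (D.F.obj a)))
  | comp r s ih ih' =>
    exact @IsIso.comp_isIso _ _ _ _ _ (vtenMap (D.treeCon r) (D.treeCon s)) _
      (vtenMap_isIso _ _) (Iso.isIso_hom _)

instance listCon_isIso (l : List X.Formal) : IsIso (D.listCon l) := by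
  induction l with
  | nil => exact inferInstanceAs (IsIso D.η.hom)
  | cons r l ih =>
    exact @IsIso.comp_isIso _ _ _ _ _ (htenMap (D.treeCon r) (D.listCon l)) _
      (htenMap_isIso _ _) (Iso.isIso_hom _)

/-! ### Naturality of the constraints at formal vertical composites -/

/-- The constraint at a formal vertical composite, for evaluation by the 2-monad. -/
def evCon (r : X.Formal) : Y.ev.obj (cell [D.img r]) ⟶ D.F.obj (X.ev.obj (cell [r])) :=
  eqToHom (ev_tree _) ≫ D.treeCon r ≫ eqToHom (congrArg D.F.obj (ev_tree r).symm)

theorem evCon_same (r : X.Formal) : D.evCon r ≋ D.treeCon r := Same.conj _ _ _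

theorem evCon_comp (r s : X.Formal) : D.evCon (.comp r s) ≋ vtenMap (D.evCon r) (D.evCon s) ≫
    (D.v (X.ev.obj (cell [r])) (X.ev.obj (cell [s]))).hom :=
  (D.evCon_same _).trans (Same.comp (vten_same (D.evCon_same r).symm (D.evCon_same s).symm)
    (D.v_same (ev_tree r).symm (ev_tree s).symm))

/-- The image of a morphism between the leaves of formal composites. -/
def imgHom {r s : X.Formal} (f : LHom r.leaves s.leaves) :
    LHom (D.img r).leaves (D.img s).leaves :=
  LHom.cast (Raw.leaves_map ..).symm (Raw.leaves_map ..).symm (LHom.map D.F f)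

theorem arrows_imgHom {r s : X.Formal} (f : LHom r.leaves s.leaves) :
    (D.imgHom f).arrows = f.arrows.map fun a => Arrow.mk (D.F.map a.hom) :=
  (LHom.arrows_cast ..).trans (LHom.arrows_map _ _)

theorem imgHom_comp {r s t : X.Formal} (f : LHom r.leaves s.leaves) (g : LHom s.leaves t.leaves) :
    D.imgHom (LHom.comp f g) = LHom.comp (D.imgHom f) (D.imgHom g) :=
  (congrArg _ (LHom.map_comp D.F f g)).trans (LHom.cast_comp ..)

theorem imgHom_isId {r s : X.Formal} {f : LHom r.leaves s.leaves} (h : f.IsId) :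
    (D.imgHom f).IsId := by
  rw [LHom.IsId, arrows_imgHom, h, Raw.leaves_map, List.map_map, List.map_map]
  refine List.map_congr_left fun a _ => ?_
  exact congrArg Arrow.mk (D.F.map_id a)

/-- Naturality of the constraints for a 3-cell between formal vertical composites. -/
def Natural {r s : X.Formal} (f : LHom r.leaves s.leaves) : Prop :=
  Y.ev.map (treeCell (D.imgHom f)) ≫ D.evCon s = D.evCon r ≫ D.F.map (X.ev.map (treeCell f))

variable {D}

theorem Natural.comp {r s t : X.Formal} {f : LHom r.leaves s.leaves} {g : LHom s.leaves t.leaves}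
    (hf : D.Natural f) (hg : D.Natural g) : D.Natural (LHom.comp f g) := by
  unfold Natural at *
  rw [imgHom_comp, ← treeCell_comp, ← treeCell_comp, Y.ev.map_comp, X.ev.map_comp, D.F.map_comp,
    Category.assoc, hg, reassoc_of% hf]

theorem evMap_treeCell_isId {r : X.Formal} {f : LHom r.leaves r.leaves} (h : f.IsId) :
    X.ev.map (treeCell f) = 𝟙 _ := by
  refine Same.eq ((Same.map X.ev (same_of_comps rfl rfl ?_)).trans (Same.of_eq (X.ev.map_id _)))
  exact comps_treeCell_id h

theorem Natural.of_isId {r : X.Formal} {f : LHom r.leaves r.leaves} (h : f.IsId) :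
    D.Natural f := by
  rw [Natural, evMap_treeCell_isId h, evMap_treeCell_isId (D.imgHom_isId h), D.F.map_id,
    Category.id_comp, Category.comp_id]

/-- The square for `g` is that for `f` with its two parallel sides inverted. Hence only one
direction of each coherence cell has to be treated. -/
theorem Natural.of_inverse {r s : X.Formal} {f : LHom r.leaves s.leaves}
    {g : LHom s.leaves r.leaves} (hf : D.Natural f) (h : (LHom.comp f g).IsId)
    (h' : (LHom.comp g f).IsId) : D.Natural g := by
  have e₁ : D.F.map (X.ev.map (treeCell f)) ≫ D.F.map (X.ev.map (treeCell g)) = 𝟙 _ := by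
    rw [← D.F.map_comp, ← X.ev.map_comp, treeCell_comp, evMap_treeCell_isId h, D.F.map_id]
  have e₂ : Y.ev.map (treeCell (D.imgHom g)) ≫ Y.ev.map (treeCell (D.imgHom f)) = 𝟙 _ := by
    rw [← Y.ev.map_comp, treeCell_comp, ← imgHom_comp,
      evMap_treeCell_isId (D.imgHom_isId h')]
  unfold Natural at *
  rw [← Category.id_comp (D.evCon s), ← e₂, Category.assoc, Category.assoc, reassoc_of% hf, e₁,
    Category.comp_id]

/-- The constraint at a binary node is a tensor product followed by `v`: the squares for `f` and `g`
take care of the first factor, naturality of `v` of the second. -/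
theorem Natural.append (hD : D.IsMonoidal) {r r' s s' : X.Formal} {f : LHom r.leaves r'.leaves}
    {g : LHom s.leaves s'.leaves} (hf : D.Natural f) (hg : D.Natural g)
    {k : LHom (Raw.comp r s).leaves (Raw.comp r' s').leaves} (hk : k.arrows = (f.append g).arrows) :
    D.Natural k := by
  obtain rfl : k = f.append g := LHom.ext_arrows hk
  have h₁ : Y.ev.map (treeCell (D.imgHom (r := .comp r s) (s := .comp r' s') (f.append g))) ≋
      vtenMap (Y.ev.map (treeCell (D.imgHom f))) (Y.ev.map (treeCell (D.imgHom g))) := by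
    refine (Same.map Y.ev (treeCell_same rfl rfl ?_)).trans (vtenMap_treeCell _ _).symm
    refine (D.arrows_imgHom _).trans ((congrArg _ (LHom.arrows_append f g)).trans
      (Eq.trans ?_ (LHom.arrows_append _ _).symm))
    rw [arrows_imgHom, arrows_imgHom, List.map_append]
  have h₂ : D.F.map (X.ev.map (treeCell (r := .comp r s) (r' := .comp r' s') (f.append g))) ≋
      D.F.map (vtenMap (X.ev.map (treeCell f)) (X.ev.map (treeCell g))) :=
    Same.map _ (vtenMap_treeCell f g).symm
  refine Same.eq ((h₁.comp (D.evCon_comp r' s')).trans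
    (Same.trans (Same.of_eq ?_) ((D.evCon_comp r s).comp h₂).symm))
  rw [← Category.assoc, ← vtenMap_comp, hf, hg, vtenMap_comp, Category.assoc, Category.assoc,
    hD.v_natural]

/-- Each of the two constraints factors as the tensor of the constraints at `r`, `s`, `t`, followed
by two instances of `v`. The associativity isomorphism passes the first factor by naturality and the
second by axiom 1. -/
theorem Natural.assoc (hD : D.IsMonoidal) (r s t : X.Formal)
    {f : LHom (Raw.comp (.comp r s) t).leaves (Raw.comp r (.comp s t)).leaves} (hf : f.IsId) :
    D.Natural f := by
  have e₁ : D.evCon (.comp (.comp r s) t) ≋ vtenMap (vtenMap (D.evCon r) (D.evCon s)) (D.evCon t) ≫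
      vtenMap (D.v (X.ev.obj (cell [r])) (X.ev.obj (cell [s]))).hom (𝟙 _) ≫ (D.v _ _).hom := by
    rw [← Category.assoc, ← vtenMap_comp, Category.comp_id]
    exact (D.evCon_comp _ _).trans (Same.comp (vten_same (D.evCon_comp r s) (Same.refl _))
      (D.v_same (vten_ev [r] [s] rfl).symm rfl))
  have e₂ : D.evCon (.comp r (.comp s t)) ≋ vtenMap (D.evCon r) (vtenMap (D.evCon s) (D.evCon t)) ≫
      vtenMap (𝟙 _) (D.v (X.ev.obj (cell [s])) (X.ev.obj (cell [t]))).hom ≫ (D.v _ _).hom := by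
    rw [← Category.assoc, ← vtenMap_comp, Category.comp_id]
    exact (D.evCon_comp _ _).trans (Same.comp (vten_same (Same.refl _) (D.evCon_comp s t))
      (D.v_same rfl (vten_ev [s] [t] rfl).symm))
  have e₃ := vassoc_ev r s t hf
  have e₄ : (vassoc (Y.ev.obj (cell [D.img r])) _ _).hom ≋ Y.ev.map (treeCell (D.imgHom f)) :=
    vassoc_ev (D.img r) (D.img s) (D.img t) (D.imgHom_isId hf)
  refine Same.eq ((e₄.symm.comp e₂).trans
    (Same.trans (Same.of_eq ?_) (e₁.comp (Same.map D.F e₃.symm)).symm))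
  rw [Category.assoc, Category.assoc, hD.v_assoc, ← Category.assoc, ← Category.assoc,
    ← Category.assoc (vtenMap _ (D.evCon t)), vassoc_naturality]
  simp only [Category.assoc]

theorem evCon_one : D.evCon (.one default) ≋ D.η.hom := D.evCon_same _

/-- The constraint at `r` can be applied before `η`. The unit axiom then collapses the part
involving `η`, and naturality of the unit isomorphism does the rest. -/
theorem Natural.top (hD : D.IsMonoidal) (r : X.Formal)
    {f : LHom (Raw.comp (.one default) r).leaves r.leaves} (hf : f.IsId) : D.Natural f := by
  have e₁ : D.evCon (.comp (.one default) r) ≋ vtenMap (𝟙 _) (D.evCon r) ≫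
      vtenMap D.η.hom (𝟙 _) ≫ (D.v X.one (X.ev.obj (cell [r]))).hom := by
    rw [← Category.assoc, ← vtenMap_comp, Category.comp_id, Category.id_comp]
    exact (D.evCon_comp _ _).trans (Same.comp (vten_same evCon_one (Same.refl _))
      (D.v_same X.vone_eq rfl))
  have e₃ := vtop_ev r hf
  have e₄ : (vtop (Y.ev.obj (cell [D.img r]))).hom ≋ Y.ev.map (treeCell (D.imgHom f)) :=
    vtop_ev (D.img r) (D.imgHom_isId hf)
  refine Same.eq ((e₄.symm.comp (Same.refl _)).trans
    (Same.trans (Same.of_eq ?_) (e₁.comp (Same.map D.F e₃.symm)).symm))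
  rw [Category.assoc, Category.assoc, hD.v_top, vtop_naturality]

/-- This mirrors `Natural.top`. The hypothesis is phrased with the leaves of `r` because the source
has leaves `r.leaves ++ []`. -/
theorem Natural.bot (hD : D.IsMonoidal) (r : X.Formal)
    {f : LHom (Raw.comp r (.one default)).leaves r.leaves}
    (hf : f.arrows = r.leaves.map fun a => Arrow.mk (𝟙 a)) : D.Natural f := by
  have e₁ : D.evCon (.comp r (.one default)) ≋ vtenMap (D.evCon r) (𝟙 _) ≫
      vtenMap (𝟙 _) D.η.hom ≫ (D.v (X.ev.obj (cell [r])) X.one).hom := by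
    rw [← Category.assoc, ← vtenMap_comp, Category.comp_id, Category.id_comp]
    exact (D.evCon_comp _ _).trans (Same.comp (vten_same (Same.refl _) evCon_one)
      (D.v_same rfl X.vone_eq))
  have e₃ := vbot_ev r hf
  have e₄ : (vbot (Y.ev.obj (cell [D.img r]))).hom ≋ Y.ev.map (treeCell (D.imgHom f)) := by
    refine vbot_ev (D.img r) ((D.arrows_imgHom f).trans ?_)
    rw [hf, Raw.leaves_map, List.map_map, List.map_map]
    refine List.map_congr_left fun a _ => ?_
    exact congrArg Arrow.mk (D.F.map_id a)
  refine Same.eq ((e₄.symm.comp (Same.refl _)).trans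
    (Same.trans (Same.of_eq ?_) (e₁.comp (Same.map D.F e₃.symm)).symm))
  rw [Category.assoc, Category.assoc, hD.v_bot, vbot_naturality]

theorem Natural.leaf {a b : X.Carrier} (f : a ⟶ b)
    {k : LHom (Raw.leaf a : X.Formal).leaves (Raw.leaf b : X.Formal).leaves}
    (hk : k.arrows = [Arrow.mk f]) : D.Natural k := by
  obtain rfl : k = LHom.cons f LHom.nil := LHom.ext_arrows hk
  have e (a : X.Carrier) : D.evCon (.leaf a) ≋ 𝟙 (D.F.obj a) := D.evCon_same _
  have h : Y.ev.map (treeCell (D.imgHom (r := .leaf a) (s := .leaf b) (.cons f .nil))) ≋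
      D.F.map f := ev_treeCell_leaf (D.F.map f)
  refine Same.eq ((h.comp (e b)).trans (Same.trans (Same.of_eq ?_)
    ((e a).comp (Same.map D.F (ev_treeCell_leaf f))).symm))
  rw [Category.id_comp, Category.comp_id]

/-! ### Coherence: reduction of formal vertical composites to normal form. -/

variable (D) in
/-- The constraints are natural for the coherence isomorphism between two formal composites. -/
def Coherent (r s : X.Formal) : Prop :=
  r.leaves = s.leaves ∧ ∀ f : LHom r.leaves s.leaves, f.IsId → D.Natural f

theorem Coherent.refl (r : X.Formal) : D.Coherent r r := ⟨rfl, fun _ => Natural.of_isId⟩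

/-- The coherence cells in the two directions are mutually inverse, since their composites have
identity components. -/
theorem Coherent.symm {r s : X.Formal} (h : D.Coherent r s) : D.Coherent s r := by
  refine ⟨h.1.symm, fun f hf => (h.2 (LHom.ofEq h.1) (LHom.ofEq_isId _)).of_inverse ?_ ?_⟩
  · refine ((LHom.ofEq_isId h.1).comp_eq h.1 f).trans (hf.trans ?_)
    rw [h.1]
  · refine (hf.comp_eq h.1.symm _).trans ((LHom.ofEq_isId h.1).trans ?_)
    rw [h.1]

theorem Coherent.trans {r s t : X.Formal} (h : D.Coherent r s) (h' : D.Coherent s t) :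
    D.Coherent r t := by
  refine ⟨h.1.trans h'.1, fun f hf => ?_⟩
  have e : f = LHom.comp (LHom.ofEq h.1) (LHom.ofEq h'.1) := by
    refine LHom.ext_arrows (hf.trans (((LHom.ofEq_isId h.1).comp_eq h.1 _).trans
      ((LHom.ofEq_isId h'.1).trans ?_)).symm)
    rw [h.1]
  rw [e]
  exact (h.2 _ (LHom.ofEq_isId _)).comp (h'.2 _ (LHom.ofEq_isId _))

theorem Coherent.comp (hD : D.IsMonoidal) {r r' s s' : X.Formal} (h : D.Coherent r r')
    (h' : D.Coherent s s') : D.Coherent (.comp r s) (.comp r' s') := by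
  refine ⟨congrArg₂ List.append h.1 h'.1, fun f hf => ?_⟩
  refine (h.2 _ (LHom.ofEq_isId h.1)).append hD (h'.2 _ (LHom.ofEq_isId h'.1)) (hf.trans ?_)
  rw [LHom.arrows_append, LHom.ofEq_isId, LHom.ofEq_isId, ← List.map_append]
  rfl

/-- The formal composite bracketed to the right, ending in a unit. -/
def normal : List X.Carrier → X.Formal
  | [] => .one default
  | a :: l => .comp (.leaf a) (normal l)

theorem leaves_normal (l : List X.Carrier) : (normal l).leaves = l := by
  induction l with
  | nil => rfl
  | cons a l ih => exact congrArg (a :: ·) ih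

/-- The final unit of the first normal form is removed by the upper unit isomorphism, after one
reassociation for each of its entries. -/
theorem coherent_append (hD : D.IsMonoidal) (l m : List X.Carrier) :
    D.Coherent (.comp (normal l) (normal m)) (normal (l ++ m)) := by
  induction l with
  | nil => exact ⟨rfl, fun _ => Natural.top hD _⟩
  | cons a l ih =>
    refine Coherent.trans ⟨?_, fun _ => Natural.assoc hD (.leaf a) (normal l) (normal m)⟩
      ((Coherent.refl (.leaf a)).comp hD ih)
    exact List.append_assoc _ _ _

/-- At a leaf, the terminating unit of the normal form is introduced by the inverse of the lower
unit isomorphism; at a binary node the two normal forms are merged. -/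
theorem coherent_normal (hD : D.IsMonoidal) (r : X.Formal) :
    D.Coherent r (normal r.leaves) := by
  induction r with
  | one a =>
    obtain rfl : a = default := Subsingleton.elim (α := X.alg.A.C1) _ _
    exact Coherent.refl _
  | leaf a => exact Coherent.symm ⟨rfl, fun _ => Natural.bot hD (.leaf a)⟩
  | comp r s ih ih' => exact (ih.comp hD ih').trans (coherent_append hD _ _)

/-- Normal forms of lists of equal length have the same shape, so the 3-cell is built from its
leaves with `Natural.append`. The induction runs over `f`, of which `g` is the version between
leaves of normal forms. -/
theorem natural_normal (hD : D.IsMonoidal) {l m : List X.Carrier} (f : LHom l m)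
    (g : LHom (normal l).leaves (normal m).leaves) (h : g.arrows = f.arrows) : D.Natural g := by
  induction f using LHom.ind with
  | nil => exact Natural.of_isId h
  | @cons a b l m f f' ih =>
    let k : LHom (normal l).leaves (normal m).leaves :=
      LHom.cast (leaves_normal l).symm (leaves_normal m).symm f'
    have hk : k.arrows = f'.arrows := LHom.arrows_cast _ _ _
    refine (Natural.leaf f (k := .cons f .nil) rfl).append hD (ih k hk) (h.trans ?_)
    exact ((LHom.arrows_append (LHom.cons f LHom.nil) k).trans (congrArg _ hk)).symm

/-- Any 3-cell between trees is a coherence cell to the normal form, then a leafwise cell `k`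
between normal forms, then a coherence cell back. -/
theorem natural (hD : D.IsMonoidal) {r s : X.Formal} (f : LHom r.leaves s.leaves) :
    D.Natural f := by
  have hr := coherent_normal hD r
  have hs := (coherent_normal hD s).symm
  let k : LHom (normal r.leaves).leaves (normal s.leaves).leaves := LHom.cast hr.1 hs.1.symm f
  have hk : k.arrows = f.arrows := LHom.arrows_cast _ _ _
  have e : f = LHom.comp (LHom.ofEq hr.1) (LHom.comp k (LHom.ofEq hs.1)) :=
    LHom.ext_arrows (((LHom.ofEq_isId hr.1).comp_eq hr.1 _).trans
      ((LHom.comp_isId_eq _ (LHom.ofEq_isId hs.1) hs.1).trans hk)).symm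
  rw [e]
  exact (hr.2 _ (LHom.ofEq_isId _)).comp
    ((natural_normal hD f k hk).comp (hs.2 _ (LHom.ofEq_isId _)))

end MapData

namespace MapData

variable (D : MapData X Y)

/-! ### Naturality of the constraints at strings -/

/-- The constraint at a string, for evaluation by the 2-monad. -/
def strCon (l : List X.Formal) :
    Y.ev.obj (cell (l.map D.img)) ⟶ D.F.obj (X.ev.obj (cell l)) :=
  eqToHom (ev_cell _) ≫ D.listCon l ≫ eqToHom (congrArg D.F.obj (ev_cell l).symm)

theorem strCon_same (l : List X.Formal) : D.strCon l ≋ D.listCon l := Same.conj _ _ _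

theorem strCon_cons (r : X.Formal) (l : List X.Formal) : D.strCon (r :: l) ≋
    htenMap (D.evCon r) (D.strCon l) ≫ (D.h (X.ev.obj (cell [r])) (X.ev.obj (cell l))).hom :=
  (D.strCon_same _).trans (Same.comp (hten_same (D.evCon_same r).symm (D.strCon_same l).symm)
    (D.h_same (ev_tree r).symm (ev_cell l).symm))

variable {D}

theorem cellHom_nil (f : (cell [] : (HV.obj X.alg.A).C2) ⟶ cell []) : f = 𝟙 _ :=
  Str.hom_ext (LHom.ext_arrows rfl)

/-- Decomposition of a 3-cell between strings. -/
theorem exists_cons {r s : X.Formal} {l m : List X.Formal} (f : cell (r :: l) ⟶ cell (s :: m)) :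
    ∃ (f₁ : LHom r.leaves s.leaves) (f₂ : cell l ⟶ cell m), comps f = f₁.arrows :: comps f₂ :=
  ⟨VTree.Hom.hom (Prod.fst (Str.Hom.hom f)), cellHom (Prod.snd (Str.Hom.hom f)), rfl⟩

/-- A 3-cell between strings splits into its first column and the rest. The first is covered by
`natural`, the rest by induction, and naturality of `h` joins them. -/
theorem strCon_natural (hD : D.IsMonoidal) : ∀ {l m : List X.Formal} (f : cell l ⟶ cell m)
    (g : cell (l.map D.img) ⟶ cell (m.map D.img))
    (_ : comps g = (comps f).map (List.map fun a => Arrow.mk (D.F.map a.hom))),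
    Y.ev.map g ≫ D.strCon m = D.strCon l ≫ D.F.map (X.ev.map f)
  | [], [], f, g, _ => by
    rw [cellHom_nil f, X.ev.map_id, D.F.map_id]
    refine Eq.trans (congrArg (· ≫ D.strCon [])
      ((congrArg Y.ev.map (cellHom_nil g)).trans (Y.ev.map_id _))) ?_
    exact (Category.id_comp _).trans (Category.comp_id _).symm
  | [], _ :: _, f, _, _ => by
    have := length_trees_eq f
    rw [trees_cell, trees_cell] at this
    exact nomatch this
  | _ :: _, [], f, _, _ => by
    have := length_trees_eq f
    rw [trees_cell, trees_cell] at this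
    exact nomatch this
  | r :: l, s :: m, f, g, h => by
    obtain ⟨f₁, f₂, hf⟩ := exists_cons f
    obtain ⟨g₁, g₂, hg⟩ := exists_cons (r := D.img r) (s := D.img s) (l := l.map D.img)
      (m := m.map D.img) g
    have h' := hg.symm.trans (h.trans (congrArg _ hf))
    rw [List.map_cons, List.cons.injEq] at h'
    have ih := strCon_natural hD f₂ g₂ h'.2
    have n := natural hD f₁
    have e : g₁ = D.imgHom f₁ := LHom.ext_arrows (h'.1.trans (D.arrows_imgHom f₁).symm)
    rw [Natural, ← e] at n
    have k₁ : Y.ev.map g ≋ htenMap (Y.ev.map (treeCell g₁)) (Y.ev.map g₂) :=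
      (htenMap_ev (treeCell g₁) g₂ g (by rw [trees_cell, trees_cell, trees_cell]; rfl)
        (by rw [trees_cell, trees_cell, trees_cell]; rfl) hg).symm
    have k₂ : X.ev.map f ≋ htenMap (X.ev.map (treeCell f₁)) (X.ev.map f₂) :=
      (htenMap_ev (treeCell f₁) f₂ f (by rw [trees_cell, trees_cell, trees_cell]; rfl)
        (by rw [trees_cell, trees_cell, trees_cell]; rfl) hf).symm
    refine Same.eq ((k₁.comp (D.strCon_cons s m)).trans (Same.trans (Same.of_eq ?_)
      ((D.strCon_cons r l).comp (Same.map D.F k₂)).symm))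
    rw [← Category.assoc, ← htenMap_comp, n, ih, htenMap_comp, Category.assoc, Category.assoc,
      hD.h_natural]

/-! ### Constraints at composites of strings -/

/-- This and the next three lemmas are axioms 2 and 3 with the transports along the strict
equalities absorbed. -/
theorem IsMonoidal.assoc_same (hD : D.IsMonoidal) (a b c : X.Carrier) :
    htenMap (D.h a b).hom (𝟙 (D.F.obj c)) ≫ (D.h (hten a b) c).hom ≋
      htenMap (𝟙 (D.F.obj a)) (D.h b c).hom ≫ (D.h a (hten b c)).hom := by
  have h := hD.h_assoc a b c
  rw [← Category.assoc] at h
  exact (Same.comp_id _ (Same.map_eqToHom _ _)).symm.trans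
    ((Same.of_eq h).trans (Same.eqToHom_comp _ _))

theorem IsMonoidal.left_same (hD : D.IsMonoidal) (a : X.Carrier) :
    htenMap D.η.hom (𝟙 (D.F.obj a)) ≫ (D.h X.one a).hom ≋ 𝟙 (D.F.obj a) := by
  have h := hD.h_left a
  rw [← Category.assoc] at h
  exact (Same.comp_id _ (Same.map_eqToHom _ _)).symm.trans
    ((Same.of_eq h).trans ((Same.eqToHom _).trans (Same.id_congr (hten_one_left _))))

theorem IsMonoidal.right_same (hD : D.IsMonoidal) (a : X.Carrier) :
    htenMap (𝟙 (D.F.obj a)) D.η.hom ≫ (D.h a X.one).hom ≋ 𝟙 (D.F.obj a) := by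
  have h := hD.h_right a
  rw [← Category.assoc] at h
  exact (Same.comp_id _ (Same.map_eqToHom _ _)).symm.trans
    ((Same.of_eq h).trans ((Same.eqToHom _).trans (Same.id_congr (hten_one_right _))))

theorem IsMonoidal.interaction_same (hD : D.IsMonoidal) (a b c d : X.Carrier) :
    vtenMap (D.h a b).hom (D.h c d).hom ≫ (D.v (hten a b) (hten c d)).hom ≋
      htenMap (D.v a c).hom (D.v b d).hom ≫ (D.h (vten a c) (vten b d)).hom := by
  have h := hD.interaction a b c d
  rw [← Category.assoc] at h
  exact (Same.comp_id _ (Same.map_eqToHom _ _)).symm.trans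
    ((Same.of_eq h).trans (Same.eqToHom_comp _ _))

/-- The nullary interaction law. -/
theorem IsMonoidal.unit_interaction (hD : D.IsMonoidal) :
    vtenMap D.η.hom D.η.hom ≫ (D.v X.one X.one).hom ≋ D.η.hom := by
  have h := hD.v_top X.one
  rw [← Category.assoc] at h
  -- The image of the unit isomorphism at `X.one` drops out by `vtop_one`. Once `η` is moved past
  -- the remaining unit isomorphism, that one too is taken at the unit, now of `Y`, and drops out.
  have h₁ : vtenMap D.η.hom (𝟙 _) ≫ (D.v X.one X.one).hom ≋ (vtop (D.F.obj X.one)).hom :=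
    (Same.comp_id _ ((Same.map D.F vtop_one).trans (Same.of_eq (D.F.map_id _)))).symm.trans
      (Same.of_eq h)
  have h₂ : vtenMap D.η.hom D.η.hom = vtenMap (𝟙 _) D.η.hom ≫ vtenMap D.η.hom (𝟙 _) := by
    rw [← vtenMap_comp, Category.id_comp, Category.comp_id]
  rw [h₂, Category.assoc]
  refine (Same.comp (Same.refl _) h₁).trans ?_
  rw [vtop_naturality]
  exact Same.id_comp vtop_one _

/-- Strings are bracketed to the right: the empty string is the left unit axiom for `h`, and each
further entry is one use of its associativity axiom. -/
theorem listCon_append (hD : D.IsMonoidal) (l m : List X.Formal) : D.listCon (l ++ m) ≋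
    htenMap (D.listCon l) (D.listCon m) ≫ (D.h (lval l) (lval m)).hom := by
  induction l with
  | nil =>
    change D.listCon m ≋ htenMap D.η.hom (D.listCon m) ≫ (D.h X.one (lval m)).hom
    have h : htenMap D.η.hom (D.listCon m) =
        htenMap (𝟙 _) (D.listCon m) ≫ htenMap D.η.hom (𝟙 _) := by
      rw [← htenMap_comp, Category.id_comp, Category.comp_id]
    rw [h, Category.assoc]
    exact (htenMap_one_left _).symm.trans (Same.comp_id _ (hD.left_same _)).symm
  | cons r l ih =>
    have hl : lval (l ++ m) = hten (lval l) (lval m) :=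
      (ev_cell _).symm.trans ((hten_ev l m).symm.trans (congrArg₂ hten (ev_cell l) (ev_cell m)))
    have h₁ : D.listCon (r :: l ++ m) ≋ htenMap (D.treeCon r) (htenMap (D.listCon l) (D.listCon m)) ≫
        htenMap (𝟙 _) (D.h (lval l) (lval m)).hom ≫ (D.h (tval r) _).hom := by
      rw [← Category.assoc, ← htenMap_comp, Category.comp_id]
      exact Same.comp (hten_same (Same.refl _) ih) (D.h_same rfl hl)
    have h₂ : htenMap (D.listCon (r :: l)) (D.listCon m) ≫ (D.h (lval (r :: l)) (lval m)).hom =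
        htenMap (htenMap (D.treeCon r) (D.listCon l)) (D.listCon m) ≫
          htenMap (D.h (tval r) (lval l)).hom (𝟙 _) ≫ (D.h (hten (tval r) (lval l)) _).hom := by
      rw [← Category.assoc, ← htenMap_comp, Category.comp_id]
      rfl
    exact h₁.trans ((Same.comp (htenMap_assoc _ _ _).symm (hD.assoc_same _ _ _).symm).trans
      (Same.of_eq h₂).symm)

theorem lval_zipWith {l m : List X.Formal} (h : l.length = m.length) :
    lval (List.zipWith .comp l m) = vten (lval l) (lval m) :=
  (ev_cell _).symm.trans ((vten_ev l m h).symm.trans (congrArg₂ vten (ev_cell l) (ev_cell m)))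

/-- The interaction axiom, used once for each column, extends to two rows of any length. Strings
without columns are the nullary interaction law. -/
theorem listCon_zipWith (hD : D.IsMonoidal) : ∀ (l m : List X.Formal) (_ : l.length = m.length),
    D.listCon (List.zipWith .comp l m) ≋
      vtenMap (D.listCon l) (D.listCon m) ≫ (D.v (lval l) (lval m)).hom
  | [], [], _ => hD.unit_interaction.symm
  | [], _ :: _, h => nomatch h
  | _ :: _, [], h => nomatch h
  | r :: l, s :: m, h => by
    have h' : l.length = m.length := Nat.succ.inj h
    have ih := listCon_zipWith hD l m h'
    have h₁ : D.listCon (List.zipWith .comp (r :: l) (s :: m)) ≋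
        htenMap (vtenMap (D.treeCon r) (D.treeCon s)) (vtenMap (D.listCon l) (D.listCon m)) ≫
        htenMap (D.v (tval r) (tval s)).hom (D.v (lval l) (lval m)).hom ≫ (D.h _ _).hom := by
      rw [← Category.assoc, ← htenMap_comp]
      exact Same.comp (hten_same (Same.refl _) ih) (D.h_same rfl (lval_zipWith h'))
    have h₂ : vtenMap (D.listCon (r :: l)) (D.listCon (s :: m)) ≫
          (D.v (lval (r :: l)) (lval (s :: m))).hom =
        vtenMap (htenMap (D.treeCon r) (D.listCon l)) (htenMap (D.treeCon s) (D.listCon m)) ≫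
          vtenMap (D.h (tval r) (lval l)).hom (D.h (tval s) (lval m)).hom ≫
          (D.v (hten (tval r) (lval l)) (hten (tval s) (lval m))).hom := by
      rw [← Category.assoc, ← vtenMap_comp]
      rfl
    exact h₁.trans ((Same.comp (vtenMap_htenMap _ _ _ _).symm
      (hD.interaction_same _ _ _ _).symm).trans (Same.of_eq h₂).symm)

/-- By the left unit axiom for `h`, each additional unit is absorbed. This is the case of a nullary
vertical composite, whose columns are units. -/
theorem listCon_replicate (hD : D.IsMonoidal) (n : ℕ) :
    D.listCon (List.replicate n (.one default)) ≋ D.η.hom := by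
  induction n with
  | zero => exact Same.refl _
  | succ n ih =>
    have hl : lval (List.replicate n (.one default)) = X.one := by
      clear ih
      induction n with
      | zero => rfl
      | succ n ih => exact (congrArg (hten X.one) ih).trans (hten_one_left _)
    have h₁ : D.listCon (List.replicate (n + 1) (.one default)) ≋
        htenMap D.η.hom D.η.hom ≫ (D.h X.one X.one).hom :=
      Same.comp (hten_same (Same.refl _) ih) (D.h_same rfl hl)
    refine h₁.trans ?_
    have h : htenMap D.η.hom D.η.hom = htenMap (𝟙 _) D.η.hom ≫ htenMap D.η.hom (𝟙 _) := by
      rw [← htenMap_comp, Category.id_comp, Category.comp_id]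
    rw [h, Category.assoc]
    exact (Same.comp_id _ (hD.left_same _)).trans (htenMap_one_left _)

/-- The factor `η` from the empty remainder of the string is absorbed by the right unit axiom for
`h`. -/
theorem listCon_single (hD : D.IsMonoidal) (r : X.Formal) : D.listCon [r] ≋ D.treeCon r := by
  have h : htenMap (D.treeCon r) D.η.hom =
      htenMap (D.treeCon r) (𝟙 _) ≫ htenMap (𝟙 _) D.η.hom := by
    rw [← htenMap_comp, Category.id_comp, Category.comp_id]
  change htenMap (D.treeCon r) D.η.hom ≫ (D.h (tval r) X.one).hom ≋ _
  rw [h, Category.assoc]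
  exact (Same.comp_id _ (hD.right_same _)).trans (htenMap_one_right _)

/-! ### The weak map with given constraints -/

variable (D) in
/-- The underlying morphism. -/
def toHom : X.alg.A ⟶ Y.alg.A where
  f0 := fun _ => default
  f1 := fun _ => default
  f2 := D.F
  s_f1 _ := Subsingleton.elim (α := Y.alg.A.C0) _ _
  t_f1 _ := Subsingleton.elim (α := Y.alg.A.C0) _ _
  src_f2 _ := Subsingleton.elim (α := Y.alg.A.C1) _ _
  tgt_f2 _ := Subsingleton.elim (α := Y.alg.A.C1) _ _

theorem trees_toHom (p : (HV.obj X.alg.A).C2) :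
    trees ((HV.map D.toHom).f2.obj p) = (trees p).map D.img :=
  (trees_HVmap _ _).trans List.map_map.symm

theorem ev_toHom (p : (HV.obj X.alg.A).C2) :
    Y.ev.obj ((HV.map D.toHom).f2.obj p) = lval ((trees p).map D.img) := by
  rw [← trees_toHom, ← ev_cell, cell_trees]

theorem ev_trees (p : (HV.obj X.alg.A).C2) : X.ev.obj p = lval (trees p) := by
  rw [← ev_cell, cell_trees]

variable (D) in
/-- The component of the structure 2-cell at a string of formal composites. -/
def app (p : (HV.obj X.alg.A).C2) :
    Y.ev.obj ((HV.map D.toHom).f2.obj p) ⟶ D.F.obj (X.ev.obj p) :=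
  eqToHom (ev_toHom p) ≫ D.listCon (trees p) ≫ eqToHom (congrArg D.F.obj (ev_trees p).symm)

theorem app_same (p : (HV.obj X.alg.A).C2) : D.app p ≋ D.listCon (trees p) := Same.conj _ _ _

instance app_isIso (p : (HV.obj X.alg.A).C2) : IsIso (D.app p) := by
  unfold app; infer_instance

theorem app_natural (hD : D.IsMonoidal) {p q : (HV.obj X.alg.A).C2} (f : p ⟶ q) :
    Y.ev.map ((HV.map D.toHom).f2.map f) ≫ D.app q = D.app p ≫ D.F.map (X.ev.map f) := by
  have e (p : (HV.obj X.alg.A).C2) : (HV.map D.toHom).f2.obj p = cell ((trees p).map D.img) := by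
    rw [← trees_toHom, cell_trees]
  -- The naturality already proved concerns strings in the form `cell l`, so the 3-cells are first
  -- transported along `cell_trees`.
  let f' : cell (trees p) ⟶ cell (trees q) :=
    eqToHom (cell_trees p) ≫ f ≫ eqToHom (cell_trees q).symm
  let g : cell ((trees p).map D.img) ⟶ cell ((trees q).map D.img) :=
    eqToHom (e p).symm ≫ (HV.map D.toHom).f2.map f ≫ eqToHom (e q)
  have hf : f' ≋ f := Same.conj _ _ _
  have hg : g ≋ (HV.map D.toHom).f2.map f := Same.conj _ _ _
  have comps_same {Z : DDBicatSCat.{v, u}} {p q p' q' : (HV.obj Z.alg.A).C2} {f : p ⟶ q}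
      {g : p' ⟶ q'} (h : f ≋ g) : comps f = comps g :=
    congrArg (fun a : Arrow (HV.obj Z.alg.A).C2 => comps a.hom) h
  have n := strCon_natural hD f' g (by
    rw [comps_same hf, comps_same hg, comps_HVmap]; rfl)
  have h (p : (HV.obj X.alg.A).C2) : D.app p ≋ D.strCon (trees p) :=
    (D.app_same p).trans (D.strCon_same _).symm
  exact Same.eq (((Same.map Y.ev hg.symm).comp (h q)).trans ((Same.of_eq n).trans
    ((h p).comp (Same.map D.F (Same.map X.ev hf.symm))).symm))

/-- The structure 2-cell. -/
def con (hD : D.IsMonoidal) : HV.map D.toHom ≫ Y.alg.a ⟶ X.alg.a ≫ D.toHom where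
  e0 := funext fun _ => Subsingleton.elim (α := Y.alg.A.C0) _ _
  e1 := funext fun _ => Subsingleton.elim (α := Y.alg.A.C1) _ _
  nat := { app := D.app, naturality := fun _ _ f => app_natural hD f }

theorem inv_app_natural (hD : D.IsMonoidal) {p q : (HV.obj X.alg.A).C2} (f : p ⟶ q) :
    D.F.map (X.ev.map f) ≫ inv (D.app q) =
      inv (D.app p) ≫ Y.ev.map ((HV.map D.toHom).f2.map f) := by
  rw [IsIso.comp_inv_eq, Category.assoc, IsIso.eq_inv_comp]
  exact (app_natural hD f).symm

/-- The structure 2-cell is invertible. -/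
def conIso (hD : D.IsMonoidal) : HV.map D.toHom ≫ Y.alg.a ≅ X.alg.a ≫ D.toHom where
  hom := con hD
  inv :=
    { e0 := (con hD).e0.symm
      e1 := (con hD).e1.symm
      nat :=
        { app := fun p => @inv _ _ _ _ (D.app p) (app_isIso p)
          naturality := fun _ _ f => inv_app_natural hD f } }
  hom_inv_id := hom₂_ext fun p => IsIso.hom_inv_id (D.app p)
  inv_hom_id := hom₂_ext fun p => IsIso.inv_hom_id (D.app p)

/-! ### The multiplication axiom for the generated constraints. -/

variable (D) in
/-- The evaluated constraints in a vertical composite of strings. -/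
def midCon : (q : Raw (HV.obj X.alg.A).C1 (HV.obj X.alg.A).C2) →
    (tval (q.map (HV.map D.toHom ≫ Y.alg.a).f1 (HV.map D.toHom ≫ Y.alg.a).f2.obj) ⟶
      tval (D.img (evTree q)))
  | .one _ => 𝟙 Y.one
  | .leaf c => D.app c
  | .comp q q' => vtenMap (midCon q) (midCon q')

/-- This is the multiplication axiom for a single vertical composite of strings, by induction on its
shape: a nullary node is `listCon_replicate` and a binary node is `listCon_zipWith`. -/
theorem listCon_columns (hD : D.IsMonoidal) (q : VCell X) :
    D.listCon (columns q.tree) ≋ D.midCon q.tree ≫ D.treeCon (evTree q.tree) := by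
  obtain ⟨q, hq⟩ := q
  dsimp only
  induction q with
  | one f =>
    rw [columns_one]
    exact (listCon_replicate hD _).trans (Same.of_eq (Category.id_comp _)).symm
  | leaf c =>
    rw [columns_leaf]
    exact (D.app_same c).symm.trans (Same.of_eq (Category.comp_id _)).symm
  | comp q q' ih ih' =>
    -- Well-formedness of the node says that the target of `q` is the source of `q'`, and each has
    -- one entry per column.
    have hl : (columns q).length = (columns q').length :=
      (length_columns_tgt ⟨q, hq.1⟩).trans
        ((congrArg (fun f : (HV.obj X.alg.A).C1 => (Str.list f).length) hq.2.2).trans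
          (length_columns_src ⟨q', hq.2.1⟩).symm)
    have e (q : VCell X) : lval (columns q.tree) = tval (evTree q.tree) := by
      rw [← ev_cell, ← ev_tree]
      exact (ev_ev (Str.mk (O := X.alg.A.C0) default [q] (isChain _ _ _ _)) rfl
        (List.append_nil _)).symm
    rw [columns_comp]
    refine (listCon_zipWith hD _ _ hl).trans ((Same.comp (vten_same (ih hq.1) (ih' hq.2.1))
      (D.v_same (e ⟨q, hq.1⟩) (e ⟨q', hq.2.1⟩))).trans (Same.of_eq ?_))
    rw [vtenMap_comp, Category.assoc]
    rfl

theorem leaves_img_evTree (q : Raw (HV.obj X.alg.A).C1 (HV.obj X.alg.A).C2) :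
    q.leaves.map (fun c => D.F.obj (X.ev.obj c)) = (D.img (evTree q)).leaves := by
  rw [img, Raw.leaves_map, evTree, Raw.leaves_map, List.map_map]
  rfl

variable (D) in
/-- The list of constraints in a vertical composite of strings. -/
def midHom (q : Raw (HV.obj X.alg.A).C1 (HV.obj X.alg.A).C2) :
    LHom (q.map (HV.map D.toHom ≫ Y.alg.a).f1 (HV.map D.toHom ≫ Y.alg.a).f2.obj).leaves
      (D.img (evTree q)).leaves :=
  LHom.cast (Raw.leaves_map _ _ _).symm (leaves_img_evTree q) (LHom.fam D.app q.leaves)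

theorem arrows_midHom (q : Raw (HV.obj X.alg.A).C1 (HV.obj X.alg.A).C2) :
    (D.midHom q).arrows = q.leaves.map fun c => Arrow.mk (D.app c) :=
  (LHom.arrows_cast ..).trans (LHom.arrows_fam _ _)

/-- This connects the recursive description, convenient for induction, with the evaluation of a
3-cell whose components are the constraints at the leaves. -/
theorem midCon_same (q : Raw (HV.obj X.alg.A).C1 (HV.obj X.alg.A).C2) :
    Y.ev.map (treeCell (D.midHom q)) ≋ D.midCon q := by
  induction q with
  | one f =>
    refine Same.trans (Same.map Y.ev (treeCell_same (g := LHom.nil) (s := .one default)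
      (s' := .one default) ?_ rfl rfl)) (ev_treeCell_one (X := Y))
    exact congrArg Raw.one (Subsingleton.elim (α := Y.alg.A.C1) _ _)
  | leaf c => exact ev_treeCell_leaf (D.app c)
  | comp q q' ih ih' =>
    refine Same.trans (Same.trans (Same.map Y.ev (treeCell_same rfl rfl ?_))
      (vtenMap_treeCell (D.midHom q) (D.midHom q')).symm) (vten_same ih ih')
    refine (arrows_midHom (Raw.comp q q')).trans (Eq.trans ?_ (LHom.arrows_append _ _).symm)
    rw [arrows_midHom, arrows_midHom, ← List.map_append]
    rfl

variable (D) in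
/-- The evaluated constraints in a string of vertical composites of strings. -/
def midListCon : (L : List (VCell X)) →
    (lval (L.map fun q => q.tree.map (HV.map D.toHom ≫ Y.alg.a).f1
        (HV.map D.toHom ≫ Y.alg.a).f2.obj) ⟶ lval ((L.map fun q => evTree q.tree).map D.img))
  | [] => 𝟙 Y.one
  | q :: L => htenMap (D.midCon q.tree) (midListCon L)

theorem lval_columns (L : List (VCell X)) :
    lval (L.flatMap fun q => columns q.tree) = lval (L.map fun q => evTree q.tree) := by
  rw [← ev_cell, ← ev_cell]
  exact (ev_ev (Str.mk (O := X.alg.A.C0) default L (isChain _ _ _ _)) rfl rfl).symm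

/-- Each entry of `L` is settled by `listCon_columns`; naturality is not used, only `listCon_append`
to join the entries. -/
theorem listCon_flatMap (hD : D.IsMonoidal) (L : List (VCell X)) :
    D.listCon (L.flatMap fun q => columns q.tree) ≋
      D.midListCon L ≫ D.listCon (L.map fun q => evTree q.tree) := by
  induction L with
  | nil => exact (Same.of_eq (Category.id_comp _)).symm
  | cons q L ih =>
    have e : lval (columns q.tree) = tval (evTree q.tree) := by
      rw [← ev_cell, ← ev_tree]
      exact (ev_ev (Str.mk (O := X.alg.A.C0) default [q] (isChain _ _ _ _)) rfl
        (List.append_nil _)).symm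
    refine (listCon_append hD _ _).trans ((Same.comp (hten_same (listCon_columns hD q) ih)
      (D.h_same e (lval_columns L))).trans (Same.of_eq ?_))
    rw [htenMap_comp, Category.assoc]
    rfl

theorem midListCon_same (L : List (VCell X)) {p q : (HV.obj Y.alg.A).C2} (f : p ⟶ q)
    (hp : trees p = L.map fun q => q.tree.map (HV.map D.toHom ≫ Y.alg.a).f1
        (HV.map D.toHom ≫ Y.alg.a).f2.obj)
    (hq : trees q = (L.map fun q => evTree q.tree).map D.img)
    (hf : comps f = L.map fun q => q.tree.leaves.map fun c => Arrow.mk (D.app c)) :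
    Y.ev.map f ≋ D.midListCon L := by
  -- The endpoints of `f` are arbitrary strings with prescribed trees. A 3-cell between canonical
  -- strings with the same components is built by induction on `L` and then identified with `f`.
  have key : ∃ g : cell (trees p) ⟶ cell (trees q), comps g = comps f ∧
      Y.ev.map g ≋ D.midListCon L := by
    rw [hp, hq, hf]
    clear hp hq hf
    induction L with
    | nil => exact ⟨𝟙 _, rfl, Same.of_eq (Y.ev.map_id _)⟩
    | cons q L ih =>
      obtain ⟨g, hg, h⟩ := ih
      let k : cell ((q :: L).map fun q => q.tree.map (HV.map D.toHom ≫ Y.alg.a).f1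
          (HV.map D.toHom ≫ Y.alg.a).f2.obj) ⟶
          cell (((q :: L).map fun q => evTree q.tree).map D.img) :=
        cellHom (.cons (treeHom (D.midHom q.tree)) (Str.Hom.hom g))
      have hk : comps k = (D.midHom q.tree).arrows :: comps g := rfl
      refine ⟨k, ?_, ?_⟩
      · rw [hk, hg, arrows_midHom]; rfl
      · exact (htenMap_ev (treeCell (D.midHom q.tree)) g k
          (by rw [trees_cell, trees_cell, trees_cell]; rfl)
          (by rw [trees_cell, trees_cell, trees_cell]; rfl) hk).symm.trans
          (hten_same (midCon_same q.tree) h)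
  obtain ⟨g, hg, h⟩ := key
  exact (Same.map Y.ev (same_of_comps (trees_cell _).symm (trees_cell _).symm hg.symm)).trans h

/-- The left side is the constraint at the flattening of `P`, so `listCon_flatMap` applies; its
first factor is the evaluated 2-cell `HV.map₂` by `midListCon_same`. -/
theorem con_mul (hD : D.IsMonoidal) (P : (HV.obj (HV.obj X.alg.A)).C2) :
    (con hD).nat.app ((HV.μ.app X.alg.A).f2.obj P) ≋
      Y.ev.map ((HV.map₂ (con hD)).nat.app P) ≫ eqToHom (middle_eq D.toHom P) ≫
        (con hD).nat.app ((HV.map X.alg.a).f2.obj P) := by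
  refine (D.app_same _).trans ((D.listCon_congr (trees_mul P)).trans
    ((listCon_flatMap hD (Str.list P)).trans (Same.comp ?_ ?_)))
  · refine (midListCon_same (Str.list P) _ (trees_HVmap _ _) ?_ (comps_map₂ _ _)).symm
    refine (trees_HVmap _ _).trans ?_
    rw [List.map_map]
    refine List.map_congr_left fun q _ => ?_
    exact (Raw.map_map X.alg.a.f1 X.ev.obj (fun _ => default) D.F.obj q.tree).symm
  · exact ((Same.eqToHom_comp _ _).trans
      ((D.app_same _).trans (D.listCon_congr (trees_map P)))).symm

/-- The weak map with given constraints. -/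
def toWeakMap (hD : D.IsMonoidal) : WeakMap HV X.alg Y.alg where
  f := D.toHom
  φ := conIso hD
  unit := (unit_iff (con hD) _).2 fun a =>
    (D.app_same _).trans ((D.listCon_congr (trees_cell [.leaf a])).trans
      (listCon_single hD (.leaf a)))
  mul := (mul_iff (con hD) _ _ _).2 (con_mul hD)

theorem constraint_toWeakMap (hD : D.IsMonoidal) (l : List X.Formal) :
    ((toWeakMap hD).constraint l).hom ≋ D.listCon l :=
  ((toWeakMap hD).constraint_same l).trans ((D.app_same _).trans (D.listCon_congr (trees_cell l)))

theorem toMapData_toWeakMap (hD : D.IsMonoidal) : (toWeakMap hD).toMapData = D := by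
  have hv (a b : X.Carrier) : (toWeakMap hD).toMapData.v a b = D.v a b := by
    refine Iso.ext (Same.eq ((constraint_toWeakMap hD _).trans ((listCon_single hD _).trans
      (Same.of_eq ?_))))
    change vtenMap (𝟙 _) (𝟙 _) ≫ (D.v a b).hom = _
    rw [vtenMap_id, Category.id_comp]
  -- The recursive value of a one-leaf string is `a | 1`, so the strict right unit law is needed to
  -- recover `h` at `a` and `b`.
  have e (a : X.Carrier) : lval [.leaf a] = tval (.leaf a : X.Formal) := hten_one_right a
  have hh (a b : X.Carrier) : (toWeakMap hD).toMapData.h a b = D.h a b := by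
    refine Iso.ext (Same.eq ((constraint_toWeakMap hD _).trans
      ((listCon_append hD [.leaf a] [.leaf b]).trans ((Same.comp (hten_same (listCon_single hD _)
        (listCon_single hD _)) (D.h_same (e a) (e b))).trans
        (Same.of_eq ?_)))))
    change htenMap (𝟙 _) (𝟙 _) ≫ (D.h a b).hom = _
    rw [htenMap_id, Category.id_comp]
  have hη : (toWeakMap hD).toMapData.η = D.η :=
    Iso.ext (Same.eq (constraint_toWeakMap hD []))
  exact MapData.ext rfl (heq_of_eq (funext fun a => funext (hv a)))
    (heq_of_eq (funext fun a => funext (hh a))) (heq_of_eq hη)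

end MapData

end BicatS

end

/-- Weak maps of doubly-degenerate `Bicat_s`-categories (weak maps of `HV`-algebras) are exactly
functors with vertical, horizontal and unit constraints satisfying the monoidal functor axioms and
the `2 × 2` interaction axiom; the vertical and horizontal unit constraints coincide. -/
theorem mainTheorem4 (X Y : BicatS.DDBicatSCat.{v, u}) :
    (∀ w : BicatS.WeakMap BicatS.HV X.alg Y.alg,
      w.toMapData.IsMonoidal ∧
      w.vunit.hom = eqToHom Y.vone_eq ≫ w.toMapData.η.hom ≫
        w.toMapData.F.map (eqToHom X.vone_eq.symm)) ∧
    ∀ D : BicatS.MapData X Y, D.IsMonoidal →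
      ∃! w : BicatS.WeakMap BicatS.HV X.alg Y.alg, w.toMapData = D :=
  ⟨fun w => ⟨w.isMonoidal, w.vunit_eq⟩, fun _ hD =>
    ⟨BicatS.MapData.toWeakMap hD, BicatS.MapData.toMapData_toWeakMap hD, fun _ h =>
      BicatS.WeakMap.toMapData_injective (h.trans (BicatS.MapData.toMapData_toWeakMap hD).symm)⟩⟩
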